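/- **Theorem 1 (Linking integrals in $S^3$ and $H^3$).** Let $M$ be either the unit sphere $S^3=\{x\in\mathbb R^4:\langle x,x\rangle=1\}$, or hyperbolic space $H^3=\{x\in\mathbb R^{1,3}:\langle x,x\rangle=1,\ x_0>0\}$, where $\mathbb R^{1,3}$ carries $\langle x,y\rangle=x_0y_0-x_1y_1-x_2y_2-x_3y_3$. The inner product on tangent spaces is $v\bullet w=\langle v,w\rangle$ on $S^3$ and $v\bullet w=-\langle v,w\rangle$ on $H^3$, and $M$ is oriented so that $u,v,w\in T_xM$ is positive when $\det(x,u,v,w)>0$. Let $\alpha(x,y)$ be the geodesic distance, $\cos\alpha=\langle x,y\rangle$ on $S^3$ and $\cosh\alpha=\langle x,y\rangle$ on $H^3$. The cross product in $T_yM$ is given by $(v\times w)\bullet z=\det(y,v,w,z)$. For a function $\varphi$ of one variable, $\nabla_y\varphi(x,y)\in T_yM$ is the Riemannian gradient in the variable $y$ of $\varphi(\alpha(x,y))$. For $v\in T_xS^3$, let $L_{yx^{-1}}v\in T_yS^3$ be its image under the differential of left translation by $yx^{-1}$ in the group $S^3$ of unit quaternions $x_0+x_1i+x_2j+x_3k$.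 For $v\in T_xM$, let $P_{yx}v\in T_yM$ be its parallel transport along the geodesic segment from $x$ to $y$. Let $K_1=\{x(s)\}$ and $K_2=\{y(t)\}$ be disjoint oriented smooth closed curves in $M$, not necessarily simple, given by smooth periodic parametrizations; integrals over $K_1\times K_2$ are taken over one period in each of $s$ and $t$. The linking number $\mathrm{Lk}(K_1,K_2)\in\mathbb Z$ is the intersection number of either one of the two curves with any oriented (possibly singular) compact surface that is bounded by the other and is transverse to the first; such surfaces exist, and the number depends neither on the surface nor on which of the two curves bounds it. Then the integrands below are integrable, and: 1. On $S^3$ in left-translation format, with $\varphi(\alpha)=(\pi-\alpha)\cot\alpha$ (and $\varphi(\pi)=-1$), $$\mathrm{Lk}(K_1,K_2)=\frac1{4\pi^2}\int_{K_1\times K_2}\Bigl(L_{yx^{-1}}\frac{dx}{ds}\times\frac{dy}{dt}\Bigr)\bullet\nabla_y\varphi(x,y)\,ds\,dt-\frac1{4\pi^2}\int_{K_1\times K_2}L_{yx^{-1}}\frac{dx}{ds}\bullet\frac{dy}{dt}\,ds\,dt .$$ 2. On $S^3$ in parallel transport format, with $\varphi(\alpha)=(\pi-\alpha)\csc\alpha$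 (and $\varphi(\pi)=1$), $$\mathrm{Lk}(K_1,K_2)=\frac1{4\pi^2}\int_{K_1\times K_2}\Bigl(P_{yx}\frac{dx}{ds}\times\frac{dy}{dt}\Bigr)\bullet\nabla_y\varphi(x,y)\,ds\,dt ;$$ here the ambiguity of $P_{yx}$ for $y=-x$ does not matter, because $\nabla_y\varphi(x,y)=0$ there. 3. On $H^3$ in parallel transport format, with $\varphi(\alpha)=\operatorname{csch}\alpha$, $$\mathrm{Lk}(K_1,K_2)=\frac1{4\pi}\int_{K_1\times K_2}\Bigl(P_{yx}\frac{dx}{ds}\times\frac{dy}{dt}\Bigr)\bullet\nabla_y\varphi(x,y)\,ds\,dt .$$ Moreover each of the four integrands, as a function of $(x,dx/ds,y,dy/dt)$ with $x\ne y$ and $dx/ds$, $dy/dt$ tangent to $M$ at $x$, $y$, is invariant under all orientation-preserving isometries of $M$. -/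

import Mathlib

open scoped ContDiff

namespace LinkingIntegral

/-! ### The two spaces, as hypersurfaces in four-dimensional space -/

/-- Four-dimensional real space, with coordinates `x 0, x 1, x 2, x 3`. Only its linear and smooth
structure is used; the inner products are given explicitly below. -/
abbrev R4 : Type := Fin 4 → ℝ

/-- The Euclidean inner product of `ℝ⁴`. -/
def euc (v w : R4) : ℝ := v 0 * w 0 + v 1 * w 1 + v 2 * w 2 + v 3 * w 3

/-- The Minkowski inner product of `ℝ^{1,3}`. -/
def mink (v w : R4) : ℝ := v 0 * w 0 - v 1 * w 1 - v 2 * w 2 - v 3 * w 3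

/-- The unit 3-sphere. -/
def S3 : Set R4 := {x | euc x x = 1}

/-- Hyperbolic 3-space: the upper sheet of the unit hyperboloid in Minkowski space. -/
def H3 : Set R4 := {x | mink x x = 1 ∧ 0 < x 0}

/-- The Riemannian metric of `S3`: the restriction of the Euclidean inner product. -/
def metricS (v w : R4) : ℝ := euc v w

/-- The Riemannian metric of `H3`: minus the restriction of the Minkowski inner product. -/
def metricH (v w : R4) : ℝ := - mink v w

/-- Geodesic distance on the unit 3-sphere. -/
noncomputable def distS (x y : R4) : ℝ := Real.arccos (euc x y)

/-- Geodesic distance on hyperbolic 3-space. -/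
noncomputable def distH (x y : R4) : ℝ := Real.arcosh (mink x y)

/-- Tangent vectors at `x`, for either space: `g` is `metricS` or `metricH`, and the tangent space
is the orthogonal complement of the position vector. -/
def IsTangent (g : R4 → R4 → ℝ) (x v : R4) : Prop := g x v = 0

/-- `vol x u v w = det (x, u, v, w)`. On tangent vectors `u, v, w` at a point `x` of `S3` or `H3`
this is the oriented Riemannian volume form; it fixes the orientation. -/
noncomputable def vol (x u v w : R4) : ℝ := (Matrix.of ![x, u, v, w]).det

/-! ### Closed curves, surfaces and linking numbers -/

/-- An oriented smooth closed curve in `M`, given by a smooth periodic parametrization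
(not necessarily simple). -/
structure ClosedCurve (M : Set R4) where
  toFun : ℝ → R4
  period : ℝ
  period_pos : 0 < period
  smooth : ContDiff ℝ ∞ toFun
  periodic : Function.Periodic toFun period
  mem : ∀ s, toFun s ∈ M

/-- Two closed curves are disjoint. -/
def ClosedCurve.Disjoint {M : Set R4} (K₁ K₂ : ClosedCurve M) : Prop :=
  ∀ s t, K₁.toFun s ≠ K₂.toFun t

/-- The closed unit square. -/
def unitSquare : Set (ℝ × ℝ) := Set.Icc 0 1 ×ˢ Set.Icc 0 1

/-- The open unit square. -/
def openSquare : Set (ℝ × ℝ) := Set.Ioo 0 1 ×ˢ Set.Ioo 0 1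

/-- The four edges of the unit square, each parametrized by `[0, 1]`, run through
counterclockwise. -/
def squareEdge (k : Fin 4) (u : ℝ) : ℝ × ℝ :=
  match k with
  | 0 => (u, 0)
  | 1 => (1, u)
  | 2 => (1 - u, 1)
  | 3 => (0, 1 - u)

/-- A compact oriented surface in `M` bounded by the closed curve `K` (a singular surface:
self-intersections are allowed). It is presented as finitely many smooth squares, each with the
orientation of the unit square, glued along their edges: all edges but one are glued by an
involution, an edge being glued to another one (or folded onto itself) with direction reversed,
so that orientations match; the one free edge runs exactly once along `K`, in the direction
of `K`. -/
structure BoundedSurface (M : Set R4) (K : ClosedCurve M) where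
  count : ℕ
  patch : Fin count → ℝ × ℝ → R4
  smooth : ∀ i, ContDiffOn ℝ ∞ (patch i) unitSquare
  mem : ∀ i, ∀ p ∈ unitSquare, patch i p ∈ M
  glue : Fin count × Fin 4 → Fin count × Fin 4
  free : Fin count × Fin 4
  glue_glue : ∀ e, glue (glue e) = e
  glue_free : glue free = free
  glue_edge : ∀ e, e ≠ free → ∀ u ∈ Set.Icc (0 : ℝ) 1,
    patch (glue e).1 (squareEdge (glue e).2 u) = patch e.1 (squareEdge e.2 (1 - u))
  free_edge : ∀ u ∈ Set.Icc (0 : ℝ) 1,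
    patch free.1 (squareEdge free.2 u) = K.toFun (K.period * u)

/-- The points where the closed curve `K'` meets the surface `F`: a patch, a point of the open
square and a parameter of one turn of `K'`. -/
def crossings {M : Set R4} {K : ClosedCurve M} (F : BoundedSurface M K) (K' : ClosedCurve M) :
    Set (Fin F.count × (ℝ × ℝ) × ℝ) :=
  {q | q.2.1 ∈ openSquare ∧ q.2.2 ∈ Set.Ico 0 K'.period ∧ F.patch q.1 q.2.1 = K'.toFun q.2.2}

/-- The volume form evaluated on the oriented tangent plane of the surface followed by the tangent
vector of the curve. -/
noncomputable def crossingVol {M : Set R4} {K : ClosedCurve M} (F : BoundedSurface M K)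
    (K' : ClosedCurve M) (q : Fin F.count × (ℝ × ℝ) × ℝ) : ℝ :=
  vol (K'.toFun q.2.2) (fderiv ℝ (F.patch q.1) q.2.1 (1, 0)) (fderiv ℝ (F.patch q.1) q.2.1 (0, 1))
    (deriv K'.toFun q.2.2)

/-- The closed curve `K'` is transverse to the surface `F`: it misses the edges of the patches and
crosses their interiors transversally. -/
def IsTransverse {M : Set R4} {K : ClosedCurve M} (F : BoundedSurface M K)
    (K' : ClosedCurve M) : Prop :=
  (∀ i, ∀ p ∈ unitSquare \ openSquare, ∀ t, F.patch i p ≠ K'.toFun t) ∧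
    ∀ q ∈ crossings F K', crossingVol F K' q ≠ 0

/-- The intersection number of a surface with a closed curve transverse to it: the number of
crossings, counted with signs (there are only finitely many crossings, by compactness). -/
noncomputable def intersectionNumber {M : Set R4} {K : ClosedCurve M} (F : BoundedSurface M K)
    (K' : ClosedCurve M) : ℤ :=
  ∑ᶠ q ∈ crossings F K', ((SignType.sign (crossingVol F K' q) : SignType) : ℤ)

/-- `n` is the linking number of `K₁` and `K₂`: the intersection number of either one of them with
any oriented surface bounded by the other one (and transverse to the first); such surfaces
exist. -/
def IsLinkingNumber {M : Set R4} (K₁ K₂ : ClosedCurve M) (n : ℤ) : Prop :=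
  (∃ F : BoundedSurface M K₁, IsTransverse F K₂) ∧
  (∀ F : BoundedSurface M K₁, IsTransverse F K₂ → intersectionNumber F K₂ = n) ∧
  (∃ F : BoundedSurface M K₂, IsTransverse F K₁) ∧
  (∀ F : BoundedSurface M K₂, IsTransverse F K₁ → intersectionNumber F K₁ = n)

/-! ### Vector calculus on the two spaces -/

/-- `w` is the Riemannian gradient at `y` of the function `f` on `M`. -/
def IsGradient (M : Set R4) (g : R4 → R4 → ℝ) (f : R4 → ℝ) (y w : R4) : Prop :=
  IsTangent g y w ∧ ∀ c : ℝ → R4, ContDiff ℝ ∞ c → (∀ t, c t ∈ M) → c 0 = y →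
    HasDerivAt (fun t => f (c t)) (g w (deriv c 0)) 0

open Classical in
/-- The Riemannian gradient at `y` of the function `f` on `M` (zero where `f` is not
differentiable). -/
noncomputable def grad (M : Set R4) (g : R4 → R4 → ℝ) (f : R4 → ℝ) (y : R4) : R4 :=
  if h : ∃ w, IsGradient M g f y w then h.choose else 0

/-- The cross product of tangent vectors `v, w` at the point `y` of `S3`. -/
noncomputable def crossS (y v w : R4) : R4 := fun i => vol y v w (Pi.single i 1)

/-- The cross product of tangent vectors `v, w` at the point `y` of `H3`. -/
noncomputable def crossH (y v w : R4) : R4 :=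
  fun i => (if i = 0 then -1 else 1) * vol y v w (Pi.single i 1)

theorem metricS_crossS (y v w z : R4) : metricS (crossS y v w) z = vol y v w z := by
  simp [metricS, euc, crossS, vol, Matrix.det_succ_row_zero, Fin.sum_univ_succ, Fin.succAbove,
    Pi.single_apply]
  ring

theorem metricH_crossH (y v w z : R4) : metricH (crossH y v w) z = vol y v w z := by
  simp [metricH, mink, crossH, vol, Matrix.det_succ_row_zero, Fin.sum_univ_succ, Fin.succAbove,
    Pi.single_apply]
  ring

/-- `ℝ⁴` as the quaternions. -/
def toQuat (x : R4) : Quaternion ℝ := ⟨x 0, x 1, x 2, x 3⟩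

/-- The quaternions as `ℝ⁴`. -/
def ofQuat (q : Quaternion ℝ) : R4 := ![q.re, q.imI, q.imJ, q.imK]

/-- Left translation by `y x⁻¹` on the group `S3` of unit quaternions. It is the restriction of a
linear map, which is therefore its own differential, and takes tangent vectors at `x` to tangent
vectors at `y`. -/
noncomputable def leftTranslate (x y v : R4) : R4 :=
  ofQuat (toQuat y * (toQuat x)⁻¹ * toQuat v)

/-- Parallel transport in `S3` of the tangent vector `v` at `x` along the geodesic segment from `x`
to `y` (for `y ≠ -x`). -/
noncomputable def transportS (x y v : R4) : R4 := v - (euc y v / (1 + euc x y)) • (x + y)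

/-- Parallel transport in `H3` of the tangent vector `v` at `x` along the geodesic segment from `x`
to `y`. -/
noncomputable def transportH (x y v : R4) : R4 := v - (mink y v / (1 + mink x y)) • (x + y)

/-- Along a unit speed great circle `c` issuing from `x`, the field `transportS x (c θ) v` starts
with `v`, is tangent, and has covariant derivative zero (the derivative in `ℝ⁴` is normal). -/
theorem transportS_parallel (x u v : R4) (hx : x ∈ S3) (hu : IsTangent metricS x u)
    (hu1 : metricS u u = 1) (hv : IsTangent metricS x v) (θ : ℝ) (hθ : |θ| < Real.pi) :
    let c : ℝ → R4 := fun a => Real.cos a • x + Real.sin a • u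
    transportS x (c 0) v = v ∧ IsTangent metricS (c θ) (transportS x (c θ) v) ∧
      HasDerivAt (fun a => transportS x (c a) v) (-(euc u v) • c θ) θ := by
  intro c
  change euc x x = 1 at hx
  simp only [IsTangent, metricS] at hu hu1 hv
  have key : ∀ a, |a| < Real.pi → transportS x (c a) v =
      v - (euc u v) • (Real.sin a • x + (1 - Real.cos a) • u) := by
    intro a ha
    have h1 : 1 + Real.cos a ≠ 0 := by
      have h2 : 0 < Real.cos (a / 2) := by
        apply Real.cos_pos_of_mem_Ioo
        constructor <;> linarith [(abs_lt.mp ha).1, (abs_lt.mp ha).2]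
      have h3 : Real.cos a = 2 * Real.cos (a / 2) ^ 2 - 1 := by
        rw [← Real.cos_two_mul]; congr 1; ring
      rw [h3]
      have : 0 < Real.cos (a / 2) ^ 2 := by positivity
      linarith
    have h4 : euc (c a) v = Real.sin a * euc u v := by
      simp only [c, euc, Pi.add_apply, Pi.smul_apply, smul_eq_mul] at hv ⊢
      linear_combination (Real.cos a) * hv
    have h5 : euc x (c a) = Real.cos a := by
      simp only [c, euc, Pi.add_apply, Pi.smul_apply, smul_eq_mul] at hx hu ⊢
      linear_combination (Real.cos a) * hx + (Real.sin a) * hu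
    ext i
    simp only [transportS, h4, h5, c, Pi.add_apply, Pi.smul_apply, Pi.sub_apply, smul_eq_mul]
    field_simp
    linear_combination (- euc u v * u i) * Real.sin_sq_add_cos_sq a
  have h0 : |(0 : ℝ)| < Real.pi := by simpa using Real.pi_pos
  refine ⟨by rw [key 0 h0]; simp, ?_, ?_⟩
  · rw [key θ hθ]
    have e1 : euc (c θ) (v - (euc u v) • (Real.sin θ • x + (1 - Real.cos θ) • u)) =
        Real.cos θ * euc x v + Real.sin θ * euc u v - euc u v *
          (Real.cos θ * Real.sin θ * euc x x + (Real.cos θ * (1 - Real.cos θ) +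
            Real.sin θ * Real.sin θ) * euc x u + Real.sin θ * (1 - Real.cos θ) * euc u u) := by
      simp only [c, euc, Pi.add_apply, Pi.smul_apply, Pi.sub_apply, smul_eq_mul]
      ring
    simp only [IsTangent, metricS]
    rw [e1, hx, hu, hu1, hv]
    ring
  · have hd : HasDerivAt (fun a => v - (euc u v) • (Real.sin a • x + (1 - Real.cos a) • u))
        (-(euc u v) • c θ) θ := by
      have := ((((Real.hasDerivAt_sin θ).smul_const x).add
        (((Real.hasDerivAt_cos θ).const_sub 1).smul_const u)).const_smul (euc u v)).const_sub v
      have e : -(euc u v) • c θ =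
          -(euc u v • (Real.cos θ • x + - -Real.sin θ • u)) := by simp [c, add_comm]
      rw [e]
      exact this
    refine hd.congr_of_eventuallyEq ?_
    filter_upwards [(isOpen_lt continuous_abs continuous_const).mem_nhds hθ] with a ha
    exact key a ha

/-- The same for unit speed geodesics of `H3`. -/
theorem transportH_parallel (x u v : R4) (hx : x ∈ H3) (hu : IsTangent metricH x u)
    (hu1 : metricH u u = 1) (hv : IsTangent metricH x v) (θ : ℝ) :
    let c : ℝ → R4 := fun a => Real.cosh a • x + Real.sinh a • u
    transportH x (c 0) v = v ∧ IsTangent metricH (c θ) (transportH x (c θ) v) ∧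
      HasDerivAt (fun a => transportH x (c a) v) (-(mink u v) • c θ) θ := by
  intro c
  have hx := hx.1
  simp only [IsTangent, metricH, neg_eq_zero] at hu hu1 hv
  have hu1 : mink u u = -1 := by linarith
  have key : ∀ a, transportH x (c a) v =
      v - (mink u v) • (Real.sinh a • x + (Real.cosh a - 1) • u) := by
    intro a
    have h1 : 1 + Real.cosh a ≠ 0 := by
      have := Real.cosh_pos a
      positivity
    have h4 : mink (c a) v = Real.sinh a * mink u v := by
      simp only [c, mink, Pi.add_apply, Pi.smul_apply, smul_eq_mul] at hv ⊢
      linear_combination (Real.cosh a) * hv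
    have h5 : mink x (c a) = Real.cosh a := by
      simp only [c, mink, Pi.add_apply, Pi.smul_apply, smul_eq_mul] at hx hu ⊢
      linear_combination (Real.cosh a) * hx + (Real.sinh a) * hu
    ext i
    simp only [transportH, h4, h5, c, Pi.add_apply, Pi.smul_apply, Pi.sub_apply, smul_eq_mul]
    field_simp
    linear_combination (mink u v * u i) * Real.cosh_sq a
  refine ⟨by rw [key 0]; simp, ?_, ?_⟩
  · rw [key θ]
    have e1 : mink (c θ) (v - (mink u v) • (Real.sinh θ • x + (Real.cosh θ - 1) • u)) =
        Real.cosh θ * mink x v + Real.sinh θ * mink u v - mink u v *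
          (Real.cosh θ * Real.sinh θ * mink x x + (Real.cosh θ * (Real.cosh θ - 1) +
            Real.sinh θ * Real.sinh θ) * mink x u +
              Real.sinh θ * (Real.cosh θ - 1) * mink u u) := by
      simp only [c, mink, Pi.add_apply, Pi.smul_apply, Pi.sub_apply, smul_eq_mul]
      ring
    simp only [IsTangent, metricH]
    rw [e1, hx, hu, hu1, hv]
    ring
  · have hd : HasDerivAt (fun a => v - (mink u v) • (Real.sinh a • x + (Real.cosh a - 1) • u))
        (-(mink u v) • c θ) θ := by
      have := ((((Real.hasDerivAt_sinh θ).smul_const x).add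
        (((Real.hasDerivAt_cosh θ).sub_const 1).smul_const u)).const_smul (mink u v)).const_sub v
      have e : -(mink u v) • c θ =
          -(mink u v • (Real.cosh θ • x + Real.sinh θ • u)) := by simp [c, add_comm]
      rw [e]
      exact this
    exact hd.congr_of_eventuallyEq (Filter.Eventually.of_forall key)

/-! ### The kernels and the integrands -/

/-- The function `(π - α) cot α` on `(0, π]`, with its limit `-1` at `α = π`. -/
noncomputable def kernelCot (α : ℝ) : ℝ :=
  if α = Real.pi then -1 else (Real.pi - α) * Real.cot α

/-- The function `(π - α) csc α` on `(0, π]`, with its limit `1` at `α = π`. -/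
noncomputable def kernelCsc (α : ℝ) : ℝ :=
  if α = Real.pi then 1 else (Real.pi - α) * (Real.sin α)⁻¹

/-- The function `csch α` for `α > 0`. -/
noncomputable def kernelCsch (α : ℝ) : ℝ := (Real.sinh α)⁻¹

/-- `(L_{yx⁻¹} v × w) • ∇_y φ(x, y)` for `φ = (π - α) cot α`, with `v` tangent to `S3` at `x` and `w`
tangent at `y`. -/
noncomputable def leftIntegrand (x v y w : R4) : ℝ :=
  metricS (crossS y (leftTranslate x y v) w) (grad S3 metricS (fun z => kernelCot (distS x z)) y)

/-- `L_{yx⁻¹} v • w`. -/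
noncomputable def leftCorrection (x v y w : R4) : ℝ := metricS (leftTranslate x y v) w

/-- `(P_{yx} v × w) • ∇_y φ(x, y)` on `S3`, for `φ = (π - α) csc α`. -/
noncomputable def transportIntegrandS (x v y w : R4) : ℝ :=
  metricS (crossS y (transportS x y v) w) (grad S3 metricS (fun z => kernelCsc (distS x z)) y)

/-- `(P_{yx} v × w) • ∇_y φ(x, y)` on `H3`, for `φ = csch α`. -/
noncomputable def transportIntegrandH (x v y w : R4) : ℝ :=
  metricH (crossH y (transportH x y v) w) (grad H3 metricH (fun z => kernelCsch (distH x z)) y)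

/-- The function `I (x(s), x'(s), y(t), y'(t))` of `(s, t)`. -/
noncomputable def pullback {M : Set R4} (I : R4 → R4 → R4 → R4 → ℝ) (K₁ K₂ : ClosedCurve M)
    (p : ℝ × ℝ) : ℝ :=
  I (K₁.toFun p.1) (deriv K₁.toFun p.1) (K₂.toFun p.2) (deriv K₂.toFun p.2)

/-- One turn of each curve: the parameter domain of `K₁ × K₂`. -/
def paramBox {M : Set R4} (K₁ K₂ : ClosedCurve M) : Set (ℝ × ℝ) :=
  Set.Icc 0 K₁.period ×ˢ Set.Icc 0 K₂.period

/-- The integrand `I` is integrable over `K₁ × K₂`. -/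
def IntegrableOver {M : Set R4} (I : R4 → R4 → R4 → R4 → ℝ) (K₁ K₂ : ClosedCurve M) : Prop :=
  MeasureTheory.IntegrableOn (pullback I K₁ K₂) (paramBox K₁ K₂) MeasureTheory.volume

/-- `∫_{K₁ × K₂} I(x(s), x'(s), y(t), y'(t)) ds dt`. -/
noncomputable def integralOver {M : Set R4} (I : R4 → R4 → R4 → R4 → ℝ) (K₁ K₂ : ClosedCurve M) :
    ℝ :=
  ∫ p in paramBox K₁ K₂, pullback I K₁ K₂ p

/-- `f` restricts to an orientation-preserving isometry of `M` (with metric `g` and distance `d`)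
onto itself; `f` is a smooth extension to `ℝ⁴`, of which only the restriction to `M` matters. -/
structure IsOrientedIsometry (M : Set R4) (g : R4 → R4 → ℝ) (d : R4 → R4 → ℝ) (f : R4 → R4) :
    Prop where
  smooth : ContDiff ℝ ∞ f
  bijOn : Set.BijOn f M M
  dist_eq : ∀ x ∈ M, ∀ y ∈ M, d (f x) (f y) = d x y
  oriented : ∀ x ∈ M, ∀ u v w, IsTangent g x u → IsTangent g x v → IsTangent g x w →
    0 < vol x u v w → 0 < vol (f x) (fderiv ℝ f x u) (fderiv ℝ f x v) (fderiv ℝ f x w)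

/-- The integrand `I` is invariant under all orientation-preserving isometries of `M`. -/
def IsometryInvariant (M : Set R4) (g : R4 → R4 → ℝ) (d : R4 → R4 → ℝ) (I : R4 → R4 → R4 → R4 → ℝ) :
    Prop :=
  ∀ f, IsOrientedIsometry M g d f → ∀ x ∈ M, ∀ y ∈ M, x ≠ y → ∀ v w,
    IsTangent g x v → IsTangent g y w →
    I (f x) (fderiv ℝ f x v) (f y) (fderiv ℝ f y w) = I x v y w

end LinkingIntegral

open LinkingIntegral

/-! ### Inner products, volumes and the properties shared by `S3` and `H3` -/

namespace LinkingIntegral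

/-! Both geometries are treated at once through `form σ`, with σ = 1 for the sphere and σ = -1 for
hyperbolic space. The gap w = σ(1 - ⟨x, y⟩) vanishes only on the diagonal. By `vol_transport`, each
parallel transport integrand is -h'(w) det(x, x', y, y'), where h is the kernel φ as a function of w
(`kernelIntegrand`). As a function on M, h satisfies Δh = σh away from its pole, where it behaves
like lam / α, with lam = π on the sphere and lam = 1 on hyperbolic space. `IsLinkingKernel` records
what is needed of this.

The heart is `IsLinkingKernel.integralOver_eq`. Replacing h'(w) by h'(w + e) with e > 0 removes the
singularity. If K₁ bounds a surface F, Stokes' theorem on its squares (`sum_lineInt_squareEdge`) and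
the cancellation of glued edges (`sum_lineInt_eq`) turn the regularized double integral into the
integral over F × K₂ of the exterior derivative in x. By the equation for h, this derivative is the
sum of a derivative along K₂, which integrates to zero over the closed curve, and a term with a
factor e (`divergence_identity`). The second term tends to zero away from the crossings. At scale √e
around a transverse crossing it becomes a multiple of (1 + Q)^(-5/2), for a positive quadratic form
Q whose determinant is, up to a constant, the square of the crossing volume, because that square is
a Gram determinant. In the limit e → 0 each crossing therefore contributes 4π lam times its sign,
while the double integral tends to the linking integral because the curves are disjoint.

Consequently every transverse surface yields the same intersection number, and the symmetry of the
integral covers surfaces bounded by K₂. Transverse surfaces exist because the cone over K₁ with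
generic apex, projected centrally to M, is transverse to K₂: the bad apexes form a null set
(`exists_transverse_surface`).

On the sphere, the left-translation integrand minus its correction term is the parallel transport
integrand plus a derivative along K₂ (`leftIntegrand_sub_leftCorrection`). Invariance holds because
all four integrands are functions of inner products and one determinant, which an oriented isometry
and its differential preserve (`IsMetricSpaceForm.isometryInvariant`). -/

theorem vol_eq (x u v w : R4) : vol x u v w =
    x 0 * (u 1 * (v 2 * w 3 - v 3 * w 2) - u 2 * (v 1 * w 3 - v 3 * w 1)
      + u 3 * (v 1 * w 2 - v 2 * w 1))
    - x 1 * (u 0 * (v 2 * w 3 - v 3 * w 2) - u 2 * (v 0 * w 3 - v 3 * w 0)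
      + u 3 * (v 0 * w 2 - v 2 * w 0))
    + x 2 * (u 0 * (v 1 * w 3 - v 3 * w 1) - u 1 * (v 0 * w 3 - v 3 * w 0)
      + u 3 * (v 0 * w 1 - v 1 * w 0))
    - x 3 * (u 0 * (v 1 * w 2 - v 2 * w 1) - u 1 * (v 0 * w 2 - v 2 * w 0)
      + u 2 * (v 0 * w 1 - v 1 * w 0)) := by
  simp [vol, Matrix.det_succ_row_zero, Fin.sum_univ_succ, Fin.succAbove]
  ring

/-- The Euclidean (`σ = 1`) or Minkowski (`σ = -1`) inner product. -/
def form (σ : ℝ) (v w : R4) : ℝ := v 0 * w 0 + σ * (v 1 * w 1 + v 2 * w 2 + v 3 * w 3)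

theorem form_one (v w : R4) : form 1 v w = euc v w := by simp [form, euc]; ring

theorem form_neg_one (v w : R4) : form (-1) v w = mink v w := by simp [form, mink]; ring

theorem form_comm (σ : ℝ) (v w : R4) : form σ v w = form σ w v := by simp only [form]; ring

theorem form_add_left (σ : ℝ) (u v w : R4) : form σ (u + v) w = form σ u w + form σ v w := by
  simp only [form, Pi.add_apply]; ring

theorem form_smul_left (σ a : ℝ) (v w : R4) : form σ (a • v) w = a * form σ v w := by
  simp only [form, Pi.smul_apply, smul_eq_mul]; ring

theorem form_sub_left (σ : ℝ) (u v w : R4) : form σ (u - v) w = form σ u w - form σ v w := by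
  simp only [form, Pi.sub_apply]; ring

theorem form_add_right (σ : ℝ) (u v w : R4) : form σ u (v + w) = form σ u v + form σ u w := by
  simp only [form, Pi.add_apply]; ring

theorem form_smul_right (σ a : ℝ) (v w : R4) : form σ v (a • w) = a * form σ v w := by
  simp only [form, Pi.smul_apply, smul_eq_mul]; ring

theorem form_sub_right (σ : ℝ) (u v w : R4) : form σ u (v - w) = form σ u v - form σ u w := by
  simp only [form, Pi.sub_apply]; ring

/-- Five vectors in `ℝ⁴` satisfy a linear relation with `4 × 4` minors as coefficients. -/
theorem form_vol_relation (σ : ℝ) (l a b c d e : R4) :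
    form σ l a * vol b c d e - form σ l b * vol a c d e + form σ l c * vol a b d e
      - form σ l d * vol a b c e + form σ l e * vol a b c d = 0 := by
  simp only [vol_eq, form]; ring

theorem vol_swap_pairs (x u v w : R4) : vol v w x u = vol x u v w := by
  simp only [vol_eq]; ring

theorem vol_neg_second (x u v w : R4) : vol x (-u) v w = -vol x u v w := by
  simp only [vol_eq, Pi.neg_apply]; ring

theorem vol_smul_second (a : ℝ) (x u v w : R4) : vol x (a • u) v w = a * vol x u v w := by
  simp only [vol_eq, Pi.smul_apply, smul_eq_mul]; ring

/-- The square of the volume of three vectors orthogonal to the unit vector `x` is a Gram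
determinant. -/
theorem vol_sq_eq_gram (σ : ℝ) (hσ : σ * σ = 1) (x u v w : R4) (hx : form σ x x = 1)
    (hu : form σ x u = 0) (hv : form σ x v = 0) (hw : form σ x w = 0) :
    vol x u v w ^ 2 = σ *
      (form σ u u * (form σ v v * form σ w w - form σ v w * form σ v w)
       - form σ u v * (form σ u v * form σ w w - form σ v w * form σ u w)
       + form σ u w * (form σ u v * form σ v w - form σ v v * form σ u w)) := by
  have h3 : ∀ t : ℝ, t = σ * (σ * t) := fun t => by rw [← mul_assoc, hσ, one_mul]
  -- The Gram matrix is A D Aᵀ with D = diag(1, σ, σ, σ), so its determinant is σ³ times the squared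
  -- volume; σ² = 1 moves the sign to the other side.
  have key : σ * σ * σ * vol x u v w ^ 2 =
      (Matrix.of ![![form σ x x, form σ x u, form σ x v, form σ x w],
        ![form σ u x, form σ u u, form σ u v, form σ u w],
        ![form σ v x, form σ v u, form σ v v, form σ v w],
        ![form σ w x, form σ w u, form σ w v, form σ w w]]).det := by
    have e : (Matrix.of ![![form σ x x, form σ x u, form σ x v, form σ x w],
        ![form σ u x, form σ u u, form σ u v, form σ u w],
        ![form σ v x, form σ v u, form σ v v, form σ v w],
        ![form σ w x, form σ w u, form σ w v, form σ w w]]) =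
        Matrix.of ![x, u, v, w] * Matrix.diagonal ![1, σ, σ, σ] *
          (Matrix.of ![x, u, v, w]).transpose := by
      ext i j
      rw [Matrix.mul_apply]
      simp only [Matrix.mul_diagonal, Matrix.transpose_apply, Fin.sum_univ_four]
      fin_cases i <;> fin_cases j <;> simp [form] <;> ring
    rw [e, Matrix.det_mul, Matrix.det_mul, Matrix.det_transpose, Matrix.det_diagonal]
    simp [vol, Fin.prod_univ_succ]
    ring
  rw [hσ, one_mul] at key
  rw [h3 (vol x u v w ^ 2), key]
  congr 1
  rw [form_comm σ u x, form_comm σ v x, form_comm σ w x, form_comm σ v u, form_comm σ w u,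
    form_comm σ w v, hx, hu, hv, hw]
  simp [Matrix.det_succ_row_zero, Fin.sum_univ_succ, Fin.succAbove]
  ring

/-- The properties of `S3` (`σ = 1`) and `H3` (`σ = -1`) on which the linking integrals rely. -/
structure IsSpaceForm (σ : ℝ) (M : Set R4) : Prop where
  sq : σ * σ = 1
  form_self : ∀ x ∈ M, form σ x x = 1
  gap_pos : ∀ x ∈ M, ∀ y ∈ M, x ≠ y → 0 < σ * (1 - form σ x y)
  metric_pos : ∀ x ∈ M, ∀ v, form σ x v = 0 → v ≠ 0 → 0 < σ * form σ v v

/-- `1 - cos α` on the sphere, `cosh α - 1` on hyperbolic space. -/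
def gap (σ : ℝ) (x y : R4) : ℝ := σ * (1 - form σ x y)

theorem gap_comm (σ : ℝ) (x y : R4) : gap σ x y = gap σ y x := by
  rw [gap, gap, form_comm]

/-- Being half the squared chord, the gap of two moving points is, near a coincidence, controlled to
second order by the first-order expansion of their difference. -/
theorem IsSpaceForm.gap_eq {σ : ℝ} {M : Set R4} (h : IsSpaceForm σ M) {x y : R4} (hx : x ∈ M)
    (hy : y ∈ M) : gap σ x y = 1 / 2 * (σ * form σ (x - y) (x - y)) := by
  rw [form_sub_left, form_sub_right, form_sub_right, h.form_self x hx, h.form_self y hy,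
    form_comm σ y x, gap]
  ring

theorem IsSpaceForm.gap_self {σ : ℝ} {M : Set R4} (h : IsSpaceForm σ M) {x : R4} (hx : x ∈ M) :
    gap σ x x = 0 := by rw [gap, h.form_self x hx]; ring

theorem IsSpaceForm.gap_nonneg {σ : ℝ} {M : Set R4} (h : IsSpaceForm σ M) {x y : R4} (hx : x ∈ M)
    (hy : y ∈ M) : 0 ≤ gap σ x y := by
  by_cases e : x = y
  · rw [e, h.gap_self hy]
  · exact (h.gap_pos x hx y hy e).le

theorem euc_self_pos {v : R4} (hv : v ≠ 0) : 0 < euc v v := by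
  by_contra! h
  apply hv
  simp only [euc] at h
  ext i
  fin_cases i <;> simp <;>
    nlinarith [mul_self_nonneg (v 0), mul_self_nonneg (v 1), mul_self_nonneg (v 2),
      mul_self_nonneg (v 3)]

theorem isSpaceForm_S3 : IsSpaceForm 1 S3 where
  sq := by norm_num
  form_self x hx := by rw [form_one]; exact hx
  gap_pos x hx y hy h := by
    rw [form_one]
    have hx : euc x x = 1 := hx
    have hy : euc y y = 1 := hy
    have := euc_self_pos (sub_ne_zero.mpr h)
    simp only [euc, Pi.sub_apply] at *
    nlinarith
  metric_pos x _ v _ hv := by rw [form_one, one_mul]; exact euc_self_pos hv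

/-- The metric of `H3` is positive definite on tangent spaces. -/
theorem metricH_bound {x v : R4} (hx : x ∈ H3) (hv : mink x v = 0) :
    v 0 ^ 2 ≤ metricH v v * (x 0 ^ 2 - 1) := by
  have h1 : mink x x = 1 := hx.1
  simp only [metricH, mink] at *
  have e1 : x 1 * v 1 + x 2 * v 2 + x 3 * v 3 = x 0 * v 0 := by linarith
  have e2 : x 1 * x 1 + x 2 * x 2 + x 3 * x 3 = x 0 ^ 2 - 1 := by linarith
  -- Cauchy–Schwarz for the spatial parts; tangency and the equation of the hyperboloid turn it into
  -- (x₀v₀)² ≤ (x₀² - 1)(v₀² + g(v, v)).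
  have cs : (x 1 * v 1 + x 2 * v 2 + x 3 * v 3) ^ 2 ≤
      (x 1 * x 1 + x 2 * x 2 + x 3 * x 3) * (v 1 * v 1 + v 2 * v 2 + v 3 * v 3) := by
    nlinarith [sq_nonneg (x 1 * v 2 - x 2 * v 1), sq_nonneg (x 1 * v 3 - x 3 * v 1),
      sq_nonneg (x 2 * v 3 - x 3 * v 2)]
  rw [e1, e2] at cs
  nlinarith

theorem metricH_pos {x v : R4} (hx : x ∈ H3) (hv : mink x v = 0) (h0 : v ≠ 0) :
    0 < metricH v v := by
  have h1 : mink x x = 1 := hx.1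
  have hb := metricH_bound hx hv
  have hx1 : 0 ≤ x 0 ^ 2 - 1 := by
    simp only [mink] at h1
    nlinarith [mul_self_nonneg (x 1), mul_self_nonneg (x 2), mul_self_nonneg (x 3)]
  by_contra! h
  have h2 : v 0 ^ 2 ≤ 0 := by nlinarith
  have h3 : v 0 = 0 := by nlinarith
  apply h0
  simp only [metricH, mink, h3] at h
  ext i
  fin_cases i <;> simp [h3] <;>
    nlinarith [mul_self_nonneg (v 1), mul_self_nonneg (v 2), mul_self_nonneg (v 3)]

/-- Positivity of the gap is the reversed Cauchy–Schwarz inequality: ⟨x, y⟩ > 0 on the upper sheet,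
and y - ⟨x, y⟩x is tangent at x with squared length ⟨x, y⟩² - 1, which is positive unless x = y. -/
theorem isSpaceForm_H3 : IsSpaceForm (-1) H3 where
  sq := by norm_num
  form_self x hx := by rw [form_neg_one]; exact hx.1
  gap_pos x hx y hy h := by
    rw [form_neg_one]
    have hx1 : mink x x = 1 := hx.1
    have hy1 : mink y y = 1 := hy.1
    have hc : 0 < mink x y := by
      have a := hx.2
      have b := hy.2
      simp only [mink] at hx1 hy1 ⊢
      have cs : (x 1 * y 1 + x 2 * y 2 + x 3 * y 3) ^ 2 ≤
          (x 1 * x 1 + x 2 * x 2 + x 3 * x 3) * (y 1 * y 1 + y 2 * y 2 + y 3 * y 3) := by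
        nlinarith [sq_nonneg (x 1 * y 2 - x 2 * y 1), sq_nonneg (x 1 * y 3 - x 3 * y 1),
          sq_nonneg (x 2 * y 3 - x 3 * y 2)]
      have e1 : x 1 * x 1 + x 2 * x 2 + x 3 * x 3 = x 0 ^ 2 - 1 := by linarith
      have e2 : y 1 * y 1 + y 2 * y 2 + y 3 * y 3 = y 0 ^ 2 - 1 := by linarith
      rw [e1, e2] at cs
      have p1 : 0 < x 0 * y 0 := mul_pos a b
      have q1 : 0 ≤ x 0 ^ 2 - 1 := by
        nlinarith [mul_self_nonneg (x 1), mul_self_nonneg (x 2), mul_self_nonneg (x 3)]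
      have : (x 1 * y 1 + x 2 * y 2 + x 3 * y 3) ^ 2 < (x 0 * y 0) ^ 2 := by nlinarith
      have := abs_lt_of_sq_lt_sq this p1.le
      linarith [le_abs_self (x 1 * y 1 + x 2 * y 2 + x 3 * y 3)]
    have ht : mink x (y - mink x y • x) = 0 := by
      simp only [mink, Pi.sub_apply, Pi.smul_apply, smul_eq_mul] at hx1 ⊢
      linear_combination (-(x 0 * y 0 - x 1 * y 1 - x 2 * y 2 - x 3 * y 3)) * hx1
    have hm : metricH (y - mink x y • x) (y - mink x y • x) = mink x y ^ 2 - 1 := by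
      have : metricH (y - mink x y • x) (y - mink x y • x) =
          2 * mink x y * mink x y - mink y y - mink x y ^ 2 * mink x x := by
        simp only [metricH, mink, Pi.sub_apply, Pi.smul_apply, smul_eq_mul]
        ring
      rw [this, hx1, hy1]; ring
    by_cases h0 : y - mink x y • x = 0
    · exfalso
      rw [h0] at hm
      have : mink x y = 1 := by
        simp [metricH, mink] at hm
        simp only [mink] at hc ⊢
        nlinarith
      rw [this, one_smul] at h0
      exact h (sub_eq_zero.mp h0).symm
    · have := metricH_pos hx ht h0
      rw [hm] at this
      nlinarith
  metric_pos x hx v hv h0 := by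
    rw [form_neg_one] at hv ⊢
    have := metricH_pos hx hv h0
    simp only [metricH] at this
    linarith

end LinkingIntegral

/-! ### Kernels as functions of the gap: differential equations and singularity -/

namespace LinkingIntegral
open Set Filter Topology

/-- A function `h` of the gap, singular at `0` only, whose derivative is (up to sign) the kernel of a
linking integral; `h1`, `h2` are its first two derivatives and `4 π lam` is the normalization. -/
structure IsLinkingKernel (σ lam : ℝ) (h h1 h2 : ℝ → ℝ) : Prop where
  hasDerivAt : ∀ w, 0 < w → HasDerivAt h (h1 w) w
  hasDerivAt_deriv : ∀ w, 0 < w → HasDerivAt h1 (h2 w) w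
  continuousOn : ContinuousOn h2 (Ioi 0)
  ode : ∀ w, 0 < w → (2 * w - σ * w ^ 2) * h2 w + 3 * (1 - σ * w) * h1 w - σ * h w = 0
  tendsto_one : Tendsto (fun w => w ^ 2 * √w * h1 w) (𝓝[>] 0) (𝓝 0)
  tendsto_two : Tendsto (fun w => w ^ 2 * √w * h2 w) (𝓝[>] 0) (𝓝 (3 * lam / (4 * √2)))

/-- The second order equation and the asymptotics follow from the first order equation. -/
theorem IsLinkingKernel.of_first_order {σ lam κ : ℝ} {h h1 h2 : ℝ → ℝ} (hσ : σ * σ = 1)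
    (d1 : ∀ w, 0 < w → HasDerivAt h (h1 w) w) (d2 : ∀ w, 0 < w → HasDerivAt h1 (h2 w) w)
    (hc : ContinuousOn h2 (Ioi 0))
    (ode : ∀ w, 0 < w → (2 * w - σ * w ^ 2) * h1 w + (1 - σ * w) * h w = κ)
    (hl : Tendsto (fun w => √w * h w) (𝓝[>] 0) (𝓝 (lam / √2))) :
    IsLinkingKernel σ lam h h1 h2 := by
  -- Differentiate the first-order equation; its right-hand side κ is constant.
  have ode2 : ∀ w, 0 < w →
      (2 * w - σ * w ^ 2) * h2 w + 3 * (1 - σ * w) * h1 w - σ * h w = 0 := by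
    intro w hw
    have e1 : HasDerivAt (fun w => (2 * w - σ * w ^ 2) * h1 w + (1 - σ * w) * h w)
        ((2 * 1 - σ * (2 * w)) * h1 w + (2 * w - σ * w ^ 2) * h2 w
          + (-(σ * 1) * h w + (1 - σ * w) * h1 w)) w := by
      refine HasDerivAt.add (HasDerivAt.mul ?_ (d2 w hw)) (HasDerivAt.mul ?_ (d1 w hw))
      · refine ((hasDerivAt_id w).const_mul 2).sub (HasDerivAt.const_mul σ ?_)
        simpa using hasDerivAt_pow 2 w
      · exact ((hasDerivAt_id w).const_mul σ).const_sub 1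
    have e2 : HasDerivAt (fun w => (2 * w - σ * w ^ 2) * h1 w + (1 - σ * w) * h w) 0 w := by
      refine (hasDerivAt_const w κ).congr_of_eventuallyEq ?_
      filter_upwards [Ioi_mem_nhds hw] with v hv using ode v hv
    linear_combination e1.unique e2
  have hσ1 : |σ| = 1 := by
    have : |σ| * |σ| = 1 := by rw [← abs_mul, hσ, abs_one]
    nlinarith [abs_nonneg σ]
  have hs : σ ≤ 1 := hσ1 ▸ le_abs_self σ
  have s0 : Tendsto (fun w : ℝ => √w) (𝓝[>] 0) (𝓝 0) := by
    have := (Real.continuous_sqrt.tendsto 0).mono_left (nhdsWithin_le_nhds (s := Ioi 0))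
    simpa using this
  have i0 : Tendsto (fun w : ℝ => w) (𝓝[>] 0) (𝓝 0) := nhdsWithin_le_nhds
  have small : ∀ᶠ w : ℝ in 𝓝[>] 0, 0 < w ∧ 0 < 2 - σ * w := by
    filter_upwards [Ioo_mem_nhdsGT (show (0 : ℝ) < 1 by norm_num)] with w hw
    exact ⟨hw.1, by nlinarith [hw.1, hw.2]⟩
  -- Since 2w - σw² = w(2 - σw), multiplying the first-order equation by √w determines the limit of
  -- w^(3/2) h'; the second-order equation times w^(3/2) then determines that of w^(5/2) h''.
  have a1 : Tendsto (fun w => w * √w * h1 w) (𝓝[>] 0) (𝓝 (-(lam / √2) / 2)) := by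
    have t : Tendsto (fun w => (κ * √w - (1 - σ * w) * (√w * h w)) / (2 - σ * w)) (𝓝[>] 0)
        (𝓝 ((κ * 0 - (1 - σ * 0) * (lam / √2)) / (2 - σ * 0))) :=
      (((s0.const_mul κ).sub ((((i0.const_mul σ).const_sub 1)).mul hl))).div
        ((i0.const_mul σ).const_sub 2) (by norm_num)
    have e : (κ * 0 - (1 - σ * 0) * (lam / √2)) / (2 - σ * 0) = -(lam / √2) / 2 := by ring
    rw [e] at t
    refine t.congr' ?_
    filter_upwards [small] with w hw
    rw [div_eq_iff hw.2.ne']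
    linear_combination (-√w) * ode w hw.1
  have a2 : Tendsto (fun w => w ^ 2 * √w * h2 w) (𝓝[>] 0) (𝓝 (3 * lam / (4 * √2))) := by
    have t : Tendsto (fun w => (σ * w * (√w * h w) - 3 * (1 - σ * w) * (w * √w * h1 w)) /
        (2 - σ * w)) (𝓝[>] 0) (𝓝 ((σ * 0 * (lam / √2) - 3 * (1 - σ * 0) * (-(lam / √2) / 2)) /
          (2 - σ * 0))) :=
      (((i0.const_mul σ).mul hl).sub ((((i0.const_mul σ).const_sub 1).const_mul 3).mul a1)).div
        ((i0.const_mul σ).const_sub 2) (by norm_num)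
    have e : (σ * 0 * (lam / √2) - 3 * (1 - σ * 0) * (-(lam / √2) / 2)) / (2 - σ * 0) =
        3 * lam / (4 * √2) := by
      have : √2 ≠ 0 := by positivity
      field_simp
      ring
    rw [e] at t
    refine t.congr' ?_
    filter_upwards [small] with w hw
    rw [div_eq_iff hw.2.ne']
    linear_combination (-w * √w) * ode2 w hw.1
  refine ⟨d1, d2, hc, ode2, ?_, a2⟩
  have := i0.mul a1
  simp only [zero_mul] at this
  refine this.congr fun w => by ring

/-! ### The kernel of hyperbolic space -/

/-- `csch` as a function of the gap. -/
noncomputable def cschGap (w : ℝ) : ℝ := (√(w ^ 2 + 2 * w))⁻¹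

/-- The derivative of `cschGap`. -/
noncomputable def cschGapDeriv (w : ℝ) : ℝ := -((w + 1) * (√(w ^ 2 + 2 * w))⁻¹ ^ 3)

theorem hasDerivAt_cschGap {w : ℝ} (hw : 0 < w) : HasDerivAt cschGap (cschGapDeriv w) w := by
  have hp : 0 < w ^ 2 + 2 * w := by positivity
  have d : HasDerivAt (fun w : ℝ => w ^ 2 + 2 * w) (2 * w + 2) w := by
    refine ((hasDerivAt_pow 2 w).add ((hasDerivAt_id w).const_mul 2)).congr_deriv ?_
    norm_num
  have := (d.sqrt hp.ne').inv (Real.sqrt_pos.mpr hp).ne'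
  refine this.congr_deriv ?_
  have h0 : √(w ^ 2 + 2 * w) ≠ 0 := (Real.sqrt_pos.mpr hp).ne'
  rw [cschGapDeriv]
  field_simp

/-- With w = cosh α - 1 one has w² + 2w = sinh² α, so the first-order equation has right-hand side
0, and the kernel is asymptotic to 1 / √(2w). -/
theorem isLinkingKernel_csch : IsLinkingKernel (-1) 1 cschGap cschGapDeriv
    (fun w => -((√(w ^ 2 + 2 * w))⁻¹ ^ 3 - 3 * (w + 1) ^ 2 * (√(w ^ 2 + 2 * w))⁻¹ ^ 5)) := by
  refine IsLinkingKernel.of_first_order (κ := 0) (by norm_num)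
    (fun w hw => hasDerivAt_cschGap hw) ?_ ?_ ?_ ?_
  · intro w hw
    have := (((hasDerivAt_id w).add_const 1).mul ((hasDerivAt_cschGap hw).pow 3)).neg
    refine this.congr_deriv ?_
    simp only [cschGap, cschGapDeriv, id, Pi.pow_apply, Nat.add_one_sub_one, Nat.cast_ofNat]
    ring
  · have : ContinuousOn (fun w : ℝ => (√(w ^ 2 + 2 * w))⁻¹) (Ioi 0) := by
      refine ContinuousOn.inv₀ (by fun_prop) fun w hw => ?_
      have hw : 0 < w := hw
      positivity
    fun_prop
  · intro w hw
    have hp : 0 < w ^ 2 + 2 * w := by positivity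
    have h0 : √(w ^ 2 + 2 * w) ≠ 0 := (Real.sqrt_pos.mpr hp).ne'
    have e : √(w ^ 2 + 2 * w) ^ 2 = w ^ 2 + 2 * w := Real.sq_sqrt hp.le
    have e2 : √(w ^ 2 + 2 * w) * (√(w ^ 2 + 2 * w))⁻¹ = 1 := mul_inv_cancel₀ h0
    simp only [cschGap, cschGapDeriv]
    generalize (√(w ^ 2 + 2 * w))⁻¹ = r at e2 ⊢
    generalize √(w ^ 2 + 2 * w) = q at e e2
    linear_combination (w + 1) * r ^ 3 * e - (w + 1) * r * (q * r + 1) * e2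
  · have t : Tendsto (fun w : ℝ => (√(w + 2))⁻¹) (𝓝[>] 0) (𝓝 (√(0 + 2))⁻¹) := by
      refine Tendsto.mono_left ?_ nhdsWithin_le_nhds
      refine Tendsto.inv₀ ?_ (by positivity)
      exact (Continuous.tendsto (by fun_prop) 0)
    rw [zero_add, inv_eq_one_div] at t
    refine t.congr' ?_
    filter_upwards [self_mem_nhdsWithin] with w hw
    have hw : 0 < w := hw
    have : w ^ 2 + 2 * w = w * (w + 2) := by ring
    rw [cschGap, this, Real.sqrt_mul hw.le]
    have : √w ≠ 0 := by positivity
    field_simp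

/-! ### The kernel of the sphere -/

/-- `∫₀¹ q(s)ᵏ / (1 - q(s) (2 - w))ⁿ ds` with `q(s) = 2 s (1 - s)`. -/
noncomputable def quadInt (k n : ℕ) (w : ℝ) : ℝ :=
  ∫ s in (0 : ℝ)..1, (2 * s * (1 - s)) ^ k * (1 - 2 * s * (1 - s) * (2 - w))⁻¹ ^ n

/-- The denominator is affine in 2s(1 - s), which stays in [0, 1/2]; its values at the ends of that
interval are 1 and w/2. -/
theorem quadInt_denom_bound {s w : ℝ} (hs : s ∈ Icc (0 : ℝ) 1) :
    min 1 (w / 2) ≤ 1 - 2 * s * (1 - s) * (2 - w) := by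
  have h1 : 0 ≤ 2 * s * (1 - s) := mul_nonneg (by linarith [hs.1]) (by linarith [hs.2])
  have h2 : 2 * s * (1 - s) ≤ 1 / 2 := by nlinarith [sq_nonneg (2 * s - 1)]
  rcases le_total w 2 with h | h
  · exact (min_le_right _ _).trans (by nlinarith)
  · exact (min_le_left _ _).trans (by nlinarith)

theorem hasDerivAt_quadInt (k n : ℕ) {w : ℝ} (hw : 0 < w) :
    HasDerivAt (quadInt k n) (-n * quadInt (k + 1) (n + 1) w) w := by
  have pos : ∀ v, 0 < v → ∀ s ∈ Icc (0 : ℝ) 1, 0 < 1 - 2 * s * (1 - s) * (2 - v) := fun v hv s hs =>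
    (lt_min one_pos (half_pos hv)).trans_le (quadInt_denom_bound hs)
  have cont : ∀ (k n : ℕ) (v : ℝ), 0 < v → ContinuousOn (fun s : ℝ =>
      (2 * s * (1 - s)) ^ k * (1 - 2 * s * (1 - s) * (2 - v))⁻¹ ^ n) (uIcc 0 1) := by
    intro k n v hv
    rw [uIcc_of_le zero_le_one]
    have : ContinuousOn (fun s : ℝ => (1 - 2 * s * (1 - s) * (2 - v))⁻¹) (Icc 0 1) :=
      ContinuousOn.inv₀ (by fun_prop) fun s hs => (pos v hv s hs).ne'
    fun_prop
  have hsub : uIoc (0 : ℝ) 1 ⊆ Icc 0 1 := by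
    rw [uIoc_of_le zero_le_one]; exact Ioc_subset_Icc_self
  -- A lower bound for the denominators valid for all v > w/2, the neighbourhood on which the
  -- derivative is dominated.
  set m := min 1 (w / 4)
  have hm : 0 < m := lt_min one_pos (by linarith)
  have main := (intervalIntegral.hasDerivAt_integral_of_dominated_loc_of_deriv_le
    (μ := MeasureTheory.volume) (a := 0) (b := 1) (x₀ := w) (s := Ioi (w / 2))
    (F := fun v s => (2 * s * (1 - s)) ^ k * (1 - 2 * s * (1 - s) * (2 - v))⁻¹ ^ n)
    (F' := fun v s => -n * ((2 * s * (1 - s)) ^ (k + 1) *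
      (1 - 2 * s * (1 - s) * (2 - v))⁻¹ ^ (n + 1)))
    (bound := fun _ => n * (1 ^ (k + 1) * m⁻¹ ^ (n + 1))) (Ioi_mem_nhds (by linarith))
    ?_ ?_ ?_ ?_ ?_ ?_).2
  · rw [intervalIntegral.integral_const_mul] at main
    exact main
  · filter_upwards [Ioi_mem_nhds hw] with v hv
    exact ((cont k n v hv).mono uIoc_subset_uIcc).aestronglyMeasurable measurableSet_uIoc
  · exact (cont k n w hw).intervalIntegrable
  · exact (((cont (k + 1) (n + 1) w hw).mono uIoc_subset_uIcc).aestronglyMeasurable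
      measurableSet_uIoc).const_mul _
  · refine Eventually.of_forall fun s hs v hv => ?_
    have hv : w / 2 < v := hv
    have hs := hsub hs
    have h1 : 0 ≤ 2 * s * (1 - s) := mul_nonneg (by linarith [hs.1]) (by linarith [hs.2])
    have h2 : 2 * s * (1 - s) ≤ 1 := by nlinarith [sq_nonneg (2 * s - 1)]
    have h3 : m ≤ 1 - 2 * s * (1 - s) * (2 - v) :=
      (min_le_min le_rfl (by linarith)).trans (quadInt_denom_bound (w := v) hs)
    have h4 : 0 < 1 - 2 * s * (1 - s) * (2 - v) := hm.trans_le h3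
    rw [norm_mul, norm_neg, Real.norm_natCast, Real.norm_of_nonneg (by positivity)]
    gcongr
  · exact intervalIntegrable_const
  · refine Eventually.of_forall fun s hs v hv => ?_
    have hv : w / 2 < v := hv
    have hs := hsub hs
    have h4 := pos v (by linarith) s hs
    have d : HasDerivAt (fun v => 1 - 2 * s * (1 - s) * (2 - v)) (2 * s * (1 - s)) v := by
      have := ((((hasDerivAt_id v).const_sub 2).const_mul (2 * s * (1 - s)))).const_sub 1
      simpa using this
    refine (((d.inv h4.ne').pow n).const_mul ((2 * s * (1 - s)) ^ k)).congr_deriv ?_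
    rcases n with _ | n
    · simp
    · simp only [Nat.add_sub_cancel]
      simp only [Pi.inv_apply, div_eq_mul_inv, inv_pow]
      push_cast
      generalize 1 - 2 * s * (1 - s) * (2 - v) = D
      ring

/-- `(π - α) csc α` as a function of `1 - cos α`. -/
noncomputable def cscGap : ℝ → ℝ := quadInt 0 1

/-- The derivative of `cscGap`. -/
noncomputable def cscGapDeriv (w : ℝ) : ℝ := -quadInt 1 2 w

theorem hasDerivAt_cscGap {w : ℝ} (hw : 0 < w) : HasDerivAt cscGap (cscGapDeriv w) w := by
  simpa [cscGapDeriv, cscGap] using hasDerivAt_quadInt 0 1 hw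

theorem hasDerivAt_cscGapDeriv {w : ℝ} (hw : 0 < w) :
    HasDerivAt cscGapDeriv (2 * quadInt 2 3 w) w := by
  refine (hasDerivAt_quadInt 1 2 hw).neg.congr_deriv ?_
  norm_num

/-- Integrate over [0, 1] the s-derivative of (1/2 - s) / (1 - 2s(1 - s)(2 - w)). The boundary
values -1/2 and 1/2 account for the constant -1. -/
theorem cscGap_ode {w : ℝ} (hw : 0 < w) :
    (2 * w - 1 * w ^ 2) * cscGapDeriv w + (1 - 1 * w) * cscGap w = -1 := by
  have pos : ∀ s ∈ Icc (0 : ℝ) 1, 0 < 1 - 2 * s * (1 - s) * (2 - w) := fun s hs =>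
    (lt_min one_pos (half_pos hw)).trans_le (quadInt_denom_bound hs)
  have cinv : ContinuousOn (fun s : ℝ => (1 - 2 * s * (1 - s) * (2 - w))⁻¹) (uIcc 0 1) := by
    rw [uIcc_of_le zero_le_one]
    exact ContinuousOn.inv₀ (by fun_prop) fun s hs => (pos s hs).ne'
  have c1 : ContinuousOn (fun s : ℝ => (2 * s * (1 - s)) ^ 1 *
      (1 - 2 * s * (1 - s) * (2 - w))⁻¹ ^ 2) (uIcc 0 1) := by fun_prop
  have c0 : ContinuousOn (fun s : ℝ => (2 * s * (1 - s)) ^ 0 *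
      (1 - 2 * s * (1 - s) * (2 - w))⁻¹ ^ 1) (uIcc 0 1) := by fun_prop
  have ftc := intervalIntegral.integral_eq_sub_of_hasDerivAt (a := 0) (b := 1)
    (f := fun s : ℝ => (1 / 2 - s) * (1 - 2 * s * (1 - s) * (2 - w))⁻¹)
    (f' := fun s : ℝ => -(2 * w - 1 * w ^ 2) * ((2 * s * (1 - s)) ^ 1 *
      (1 - 2 * s * (1 - s) * (2 - w))⁻¹ ^ 2) + (1 - 1 * w) * ((2 * s * (1 - s)) ^ 0 *
      (1 - 2 * s * (1 - s) * (2 - w))⁻¹ ^ 1)) ?_ ?_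
  · rw [intervalIntegral.integral_add (c1.intervalIntegrable.const_mul _)
      (c0.intervalIntegrable.const_mul _), intervalIntegral.integral_const_mul,
      intervalIntegral.integral_const_mul] at ftc
    simp only [cscGapDeriv, cscGap, quadInt]
    rw [show (-1 : ℝ) = (1 / 2 - 1) * (1 - 2 * 1 * (1 - 1) * (2 - w))⁻¹ -
      (1 / 2 - 0) * (1 - 2 * 0 * (1 - 0) * (2 - w))⁻¹ by norm_num, ← ftc]
    ring
  · intro s hs
    rw [uIcc_of_le zero_le_one] at hs
    have h4 := pos s hs
    have d : HasDerivAt (fun s => 1 - 2 * s * (1 - s) * (2 - w)) (-((2 - 4 * s) * (2 - w))) s := by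
      have := ((((hasDerivAt_id s).const_mul 2).mul ((hasDerivAt_id s).const_sub 1)).mul_const
        (2 - w)).const_sub 1
      refine this.congr_deriv ?_
      simp only [id]
      ring
    refine (((hasDerivAt_id s).const_sub (1 / 2)).mul (d.inv h4.ne')).congr_deriv ?_
    simp only [id, Pi.inv_apply]
    field_simp
    ring
  · exact (c1.intervalIntegrable.const_mul _).add (c0.intervalIntegrable.const_mul _)

/-- The closed form (π - α) / sin α degenerates at the antipode w = 2, whereas the integral `cscGap`
is differentiable there. By `cscGap_ode`, sin α · `cscGap` (1 - cos α) + α has derivative zero on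
(0, 2π), and at α = π it equals π. -/
theorem sin_mul_cscGap {α : ℝ} (h0 : 0 < α) (hα : α ≤ Real.pi) :
    Real.sin α * cscGap (1 - Real.cos α) = Real.pi - α := by
  have hpos : ∀ a ∈ Ioo 0 (2 * Real.pi), 0 < 1 - Real.cos a := by
    intro a ha
    have : Real.cos a = 1 - 2 * Real.sin (a / 2) ^ 2 := by
      rw [Real.sin_sq]
      have := Real.cos_two_mul (a / 2)
      rw [show 2 * (a / 2) = a by ring] at this
      linarith
    have h2 : 0 < Real.sin (a / 2) :=
      Real.sin_pos_of_pos_of_lt_pi (by linarith [ha.1]) (by linarith [ha.2])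
    rw [this]
    nlinarith
  have d : ∀ a ∈ Ioo 0 (2 * Real.pi),
      HasDerivAt (fun a => Real.sin a * cscGap (1 - Real.cos a) + a) 0 a := by
    intro a ha
    have hp := hpos a ha
    have e := ((Real.hasDerivAt_sin a).mul ((hasDerivAt_cscGap hp).comp a
      ((Real.hasDerivAt_cos a).const_sub 1))).add (hasDerivAt_id a)
    refine e.congr_deriv ?_
    have o := cscGap_ode hp
    simp only [Function.comp]
    linear_combination o + cscGapDeriv (1 - Real.cos a) * Real.sin_sq_add_cos_sq a
  have hπ := Real.pi_pos
  have := isOpen_Ioo.is_const_of_deriv_eq_zero isPreconnected_Ioo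
    (f := fun a => Real.sin a * cscGap (1 - Real.cos a) + a) (s := Ioo 0 (2 * Real.pi))
    (fun a ha => (d a ha).differentiableAt.differentiableWithinAt) (fun a ha => (d a ha).deriv)
    (x := α) (y := Real.pi) ⟨h0, by linarith⟩ ⟨hπ, by linarith⟩
  simp only [Real.sin_pi, zero_mul, zero_add] at this
  linarith

theorem cscGap_two : cscGap 2 = 1 := by simp [cscGap, quadInt]

/-- Since sin α = √(w(2 - w)), the product √w · `cscGap` w is (π - α) / √(2 - w) with α = arccos (1
- w), and this tends to π / √2. -/
theorem isLinkingKernel_csc :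
    IsLinkingKernel 1 Real.pi cscGap cscGapDeriv (fun w => 2 * quadInt 2 3 w) := by
  refine IsLinkingKernel.of_first_order (κ := -1) (by norm_num)
    (fun w hw => hasDerivAt_cscGap hw) (fun w hw => hasDerivAt_cscGapDeriv hw) ?_
    (fun w hw => cscGap_ode hw) ?_
  · refine ContinuousOn.mul continuousOn_const fun w hw => ?_
    exact (hasDerivAt_quadInt 2 3 hw).continuousAt.continuousWithinAt
  · have t : Tendsto (fun w : ℝ => (Real.pi - Real.arccos (1 - w)) / √(2 - w)) (𝓝[>] 0)
        (𝓝 ((Real.pi - Real.arccos (1 - 0)) / √(2 - 0))) := by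
      refine Tendsto.mono_left ?_ nhdsWithin_le_nhds
      refine Tendsto.div ?_ ?_ (by norm_num)
      · exact Continuous.tendsto (by have := Real.continuous_arccos; fun_prop) 0
      · exact Continuous.tendsto (by fun_prop) 0
    simp only [sub_zero, Real.arccos_one] at t
    refine t.congr' ?_
    filter_upwards [Ioo_mem_nhdsGT (show (0 : ℝ) < 2 by norm_num)] with w hw
    have hpos : 0 < Real.arccos (1 - w) := Real.arccos_pos.mpr (by linarith [hw.1])
    have e := sin_mul_cscGap hpos (Real.arccos_le_pi _)
    rw [Real.cos_arccos (by linarith [hw.2]) (by linarith [hw.1]), Real.sin_arccos,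
      show 1 - (1 - w) ^ 2 = w * (2 - w) by ring, Real.sqrt_mul hw.1.le, sub_sub_cancel] at e
    have : √(2 - w) ≠ 0 := by
      have : 0 < 2 - w := by linarith [hw.2]
      positivity
    rw [div_eq_iff this, ← e]
    ring

end LinkingIntegral

/-! ### The model integral of (1 + Q)^(-5/2) over three-space -/

namespace LinkingIntegral
open Set Filter Topology MeasureTheory Asymptotics

/-- The function `w ^ (5/2)`. -/
noncomputable def powFiveHalves (w : ℝ) : ℝ := w ^ 2 * √w

theorem continuous_powFiveHalves : Continuous powFiveHalves := by
  unfold powFiveHalves; fun_prop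

theorem powFiveHalves_pos {w : ℝ} (hw : 0 < w) : 0 < powFiveHalves w := by
  unfold powFiveHalves; positivity

theorem powFiveHalves_mono {v w : ℝ} (hv : 0 ≤ v) (h : v ≤ w) :
    powFiveHalves v ≤ powFiveHalves w := by
  unfold powFiveHalves; gcongr

theorem powFiveHalves_sq_mul {ε w : ℝ} (hε : 0 ≤ ε) :
    powFiveHalves (ε ^ 2 * w) = ε ^ 5 * powFiveHalves w := by
  unfold powFiveHalves
  rw [Real.sqrt_mul (by positivity), Real.sqrt_sq hε]; ring

theorem inv_powFiveHalves {w : ℝ} (hw : 0 < w) :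
    (powFiveHalves w)⁻¹ = w ^ (-(5 : ℝ) / 2) := by
  rw [powFiveHalves, Real.sqrt_eq_rpow, ← Real.rpow_natCast, ← Real.rpow_add hw,
    ← Real.rpow_neg hw.le]
  norm_num

/-- The integrand decays like the power -5 of the norm, and 5 exceeds the dimension 3. It serves as
the dominating function at a crossing. -/
theorem integrable_inv_powFiveHalves {E : Type*} [NormedAddCommGroup E] [NormedSpace ℝ E]
    [FiniteDimensional ℝ E] [MeasurableSpace E] [BorelSpace E] (μ : Measure E)
    [μ.IsAddHaarMeasure] (hE : Module.finrank ℝ E = 3) {a : ℝ} (ha : 0 < a) :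
    Integrable (fun p : E => (powFiveHalves (1 + a * ‖p‖ ^ 2))⁻¹) μ := by
  have h := integrable_rpow_neg_one_add_norm_sq (E := E) (μ := μ) (r := 5)
    (by rw [hE]; norm_num)
  have := h.comp_smul (R := √a) (by positivity)
  refine this.congr (Eventually.of_forall fun p => ?_)
  simp only
  rw [inv_powFiveHalves (by positivity), norm_smul, mul_pow, Real.norm_eq_abs, sq_abs,
    Real.sq_sqrt ha.le]

/-- In polar coordinates r²(1 + r²)^(-5/2) has the primitive r³ / (3(1 + r²)^(3/2)), rising from 0
to 1/3; the angular factor, three times the volume of the unit ball, is 4π. -/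
theorem integral_inv_powFiveHalves_norm :
    ∫ q : EuclideanSpace ℝ (Fin 3), (powFiveHalves (1 + ‖q‖ ^ 2))⁻¹ = 4 * Real.pi / 3 := by
  rw [integral_fun_norm_addHaar volume (fun r => (powFiveHalves (1 + r ^ 2))⁻¹)]
  have hd : ∀ r ∈ Ioi (0 : ℝ), HasDerivAt (fun r : ℝ => r ^ 3 / 3 * (√(1 + r ^ 2))⁻¹ ^ 3)
      (r ^ (3 - 1) • (powFiveHalves (1 + r ^ 2))⁻¹) r := by
    intro r _
    have hp : 0 < 1 + r ^ 2 := by positivity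
    have h0 := (Real.sqrt_pos.mpr hp).ne'
    have d : HasDerivAt (fun r : ℝ => 1 + r ^ 2) (2 * r) r := by
      simpa using (hasDerivAt_pow 2 r).const_add 1
    refine (((hasDerivAt_pow 3 r).div_const 3).mul (((d.sqrt hp.ne').inv h0).pow 3)).congr_deriv ?_
    have e : √(1 + r ^ 2) ^ 2 = 1 + r ^ 2 := Real.sq_sqrt hp.le
    rw [powFiveHalves, ← e]
    simp only [Pi.inv_apply, Pi.pow_apply, Nat.cast_ofNat, smul_eq_mul, Nat.add_one_sub_one]
    rw [Real.sqrt_sq (Real.sqrt_nonneg _)]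
    field_simp
    linear_combination r ^ 2 * e
  have ht : Tendsto (fun r : ℝ => r ^ 3 / 3 * (√(1 + r ^ 2))⁻¹ ^ 3) atTop (𝓝 (1 / 3)) := by
    have t : Tendsto (fun r : ℝ => 1 / 3 * (√(r⁻¹ ^ 2 + 1))⁻¹ ^ 3) atTop
        (𝓝 (1 / 3 * (√(0 ^ 2 + 1))⁻¹ ^ 3)) := by
      refine ((Tendsto.inv₀ ?_ (by norm_num)).pow 3).const_mul _
      exact ((tendsto_inv_atTop_zero.pow 2).add_const 1).sqrt
    norm_num at t
    norm_num
    refine t.congr' ?_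
    filter_upwards [eventually_gt_atTop 0] with r hr
    have : 1 + r ^ 2 = r ^ 2 * ((r ^ 2)⁻¹ + 1) := by field_simp
    rw [this, Real.sqrt_mul (by positivity), Real.sqrt_sq hr.le]
    field_simp
  have key := integral_Ioi_of_hasDerivAt_of_nonneg (a := 0)
    (g := fun r : ℝ => r ^ 3 / 3 * (√(1 + r ^ 2))⁻¹ ^ 3) ?_ hd ?_ ht
  · simp only [finrank_euclideanSpace, Fintype.card_fin]
    rw [key]
    simp [Measure.real]
    ring_nf
    exact ENNReal.toReal_ofReal (by positivity)
  · have : Continuous fun r : ℝ => (√(1 + r ^ 2))⁻¹ :=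
      Continuous.inv₀ (by fun_prop) fun r => (Real.sqrt_pos.mpr (by positivity)).ne'
    exact Continuous.continuousWithinAt (by fun_prop)
  · intro r (hr : 0 < r)
    have := powFiveHalves_pos (show 0 < 1 + r ^ 2 by positivity)
    rw [smul_eq_mul]
    exact mul_nonneg (pow_nonneg hr.le _) (inv_nonneg.mpr this.le)

/-- The standard identification of `ℝ³` with `(ℝ × ℝ) × ℝ` preserves volume. -/
theorem integral_fin_three (f : (ℝ × ℝ) × ℝ → ℝ) :
    ∫ q : Fin 3 → ℝ, f ((q 0, q 1), q 2) = ∫ p, f p := by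
  have e1 := volume_preserving_piFinSuccAbove (fun _ : Fin 3 => ℝ) 2
  have e2 : MeasurePreserving (Prod.map (id : ℝ → ℝ) (MeasurableEquiv.finTwoArrow (α := ℝ))) :=
    (MeasurePreserving.id volume).prod (volume_preserving_finTwoArrow ℝ)
  have e3 : MeasurePreserving (Prod.swap : ℝ × (ℝ × ℝ) → (ℝ × ℝ) × ℝ) :=
    Measure.measurePreserving_swap
  have e := (e3.comp e2).comp e1
  have emb : MeasurableEmbedding ((Prod.swap : ℝ × (ℝ × ℝ) → (ℝ × ℝ) × ℝ) ∘
      Prod.map (id : ℝ → ℝ) (MeasurableEquiv.finTwoArrow (α := ℝ)) ∘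
      MeasurableEquiv.piFinSuccAbove (fun _ : Fin 3 => ℝ) 2) := by
    refine (MeasurableEquiv.prodComm (α := ℝ) (β := ℝ × ℝ)).measurableEmbedding.comp (.comp ?_
      (MeasurableEquiv.measurableEmbedding _))
    exact ((MeasurableEquiv.refl ℝ).prodCongr
      (MeasurableEquiv.finTwoArrow (α := ℝ))).measurableEmbedding
  rw [← e.integral_comp emb f]
  rfl

/-- A positive definite ternary quadratic form, diagonalized by completing squares. -/
theorem integral_inv_powFiveHalves_quadratic {A B C D E F : ℝ} (h1 : 0 < A)
    (h2 : 0 < A * D - B ^ 2)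
    (h3 : 0 < A * (D * F - E * E) - B * (B * F - E * C) + C * (B * E - D * C)) :
    ∫ p : (ℝ × ℝ) × ℝ, (powFiveHalves (1 + 1 / 2 * (A * p.1.1 ^ 2 + 2 * B * p.1.1 * p.1.2
      + 2 * C * p.1.1 * p.2 + D * p.1.2 ^ 2 + 2 * E * p.1.2 * p.2 + F * p.2 ^ 2)))⁻¹ =
    2 * √2 * (4 * Real.pi / 3) /
      √(A * (D * F - E * E) - B * (B * F - E * C) + C * (B * E - D * C)) := by
  rw [← integral_fin_three]
  set G := A * (D * F - E * E) - B * (B * F - E * C) + C * (B * E - D * C) with hG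
  set H := A * D - B ^ 2 with hH
  have hA := Real.sq_sqrt h1.le
  have hA0 := Real.sqrt_pos.mpr h1
  have hH1 := Real.sq_sqrt h2.le
  have hH0 := Real.sqrt_pos.mpr h2
  have hG1 := Real.sq_sqrt h3.le
  have hG0 := Real.sqrt_pos.mpr h3
  set a := √A
  set b := √H
  set g := √G
  -- The Cholesky factor of the form: Mᵀ M is its matrix, and the product of the diagonal entries of
  -- M is √G.
  let M : Matrix (Fin 3) (Fin 3) ℝ :=
    !![a, B / a, C / a; 0, b / a, (A * E - B * C) / (a * b); 0, 0, g / b]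
  have det : M.det = g := by
    simp [M, Matrix.det_fin_three]
    field_simp
  have hM : M.det ≠ 0 := by rw [det]; exact hG0.ne'
  have quad : ∀ q : Fin 3 → ℝ, A * q 0 ^ 2 + 2 * B * q 0 * q 1 + 2 * C * q 0 * q 2 + D * q 1 ^ 2
      + 2 * E * q 1 * q 2 + F * q 2 ^ 2 = ‖WithLp.toLp 2 (M.toLin' q)‖ ^ 2 := by
    intro q
    rw [EuclideanSpace.norm_sq_eq]
    simp only [Fin.sum_univ_three, Real.norm_eq_abs, sq_abs, Matrix.toLin'_apply, Matrix.mulVec,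
      dotProduct]
    simp [M]
    field_simp
    rw [hA, hH1, hG1, hG, hH]
    ring
  have sub : ∫ q : Fin 3 → ℝ, (powFiveHalves (1 + 1 / 2 * ‖WithLp.toLp 2 (M.toLin' q)‖ ^ 2))⁻¹ =
      g⁻¹ * ∫ q : Fin 3 → ℝ, (powFiveHalves (1 + 1 / 2 * ‖WithLp.toLp 2 q‖ ^ 2))⁻¹ := by
    have hm := Real.map_matrix_volume_pi_eq_smul_volume_pi hM
    have emb : MeasurableEmbedding (M.toLin') := by
      have hdet : LinearMap.det M.toLin' ≠ 0 := by rwa [LinearMap.det_toLin']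
      exact ((LinearEquiv.ofIsUnitDet (f := M.toLin') (v := Pi.basisFun ℝ (Fin 3))
        (v' := Pi.basisFun ℝ (Fin 3)) (by
          rw [← Matrix.toLin_eq_toLin', LinearMap.toMatrix_toLin]
          exact hM.isUnit)).toContinuousLinearEquiv.toHomeomorph).measurableEmbedding
    have := emb.integral_map (μ := volume) (fun q : Fin 3 → ℝ =>
      (powFiveHalves (1 + 1 / 2 * ‖WithLp.toLp 2 q‖ ^ 2))⁻¹)
    rw [← this, hm, integral_smul_measure, det, ENNReal.toReal_ofReal (abs_nonneg _),
      abs_of_pos (inv_pos.mpr hG0), smul_eq_mul]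
  simp only [quad, sub]
  rw [(PiLp.volume_preserving_toLp (Fin 3)).integral_comp
    (MeasurableEquiv.toLp 2 (Fin 3 → ℝ)).measurableEmbedding
    (fun q : EuclideanSpace ℝ (Fin 3) => (powFiveHalves (1 + 1 / 2 * ‖q‖ ^ 2))⁻¹)]
  -- Scaling by 1/√2 absorbs the factor 1/2 in the form and yields √2³ = 2√2.
  have sc := Measure.integral_comp_smul (volume : Measure (EuclideanSpace ℝ (Fin 3)))
    (fun q => (powFiveHalves (1 + ‖q‖ ^ 2))⁻¹) ((√2)⁻¹)
  have e : ∀ q : EuclideanSpace ℝ (Fin 3), ‖(√2)⁻¹ • q‖ ^ 2 = 1 / 2 * ‖q‖ ^ 2 := by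
    intro q
    rw [norm_smul, mul_pow, Real.norm_eq_abs, sq_abs, inv_pow, Real.sq_sqrt (by norm_num)]
    norm_num
  simp only [e] at sc
  rw [sc, integral_inv_powFiveHalves_norm, finrank_euclideanSpace, Fintype.card_fin, inv_pow,
    inv_inv, abs_of_pos (by positivity), smul_eq_mul]
  have : √2 ^ 3 = 2 * √2 := by
    rw [pow_succ, Real.sq_sqrt (by norm_num)]
  rw [this]
  ring

/-- By homogeneity it suffices to look at the unit sphere, where a positive continuous function has
a positive minimum by compactness. -/
theorem exists_pos_mul_norm_sq_le {E : Type*} [NormedAddCommGroup E] [NormedSpace ℝ E]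
    [FiniteDimensional ℝ E] {Q : E → ℝ} (hc : Continuous Q)
    (hom : ∀ (t : ℝ) p, Q (t • p) = t ^ 2 * Q p) (pos : ∀ p, p ≠ 0 → 0 < Q p) :
    ∃ a, 0 < a ∧ ∀ p, a * ‖p‖ ^ 2 ≤ Q p := by
  have h0 : Q 0 = 0 := by simpa using hom 0 0
  rcases subsingleton_or_nontrivial E with hE | hE
  · exact ⟨1, one_pos, fun p => by rw [Subsingleton.elim p 0, h0]; simp⟩
  obtain ⟨m, hm, hmin⟩ := (isCompact_sphere (0 : E) 1).exists_isMinOn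
    (NormedSpace.sphere_nonempty.mpr zero_le_one) hc.continuousOn
  have hm0 : m ≠ 0 := by
    rintro rfl
    simp at hm
  refine ⟨Q m, pos m hm0, fun p => ?_⟩
  by_cases hp : p = 0
  · rw [hp, h0]; simp
  have hn : 0 < ‖p‖ := norm_pos_iff.mpr hp
  have := hmin (show ‖p‖⁻¹ • p ∈ Metric.sphere (0 : E) 1 by
    simp [norm_smul, hn.ne'])
  simp only [mem_ofPred_eq, hom] at this
  have e : ‖p‖ ^ 2 * (‖p‖⁻¹ ^ 2 * Q p) = Q p := by field_simp
  rw [← e, mul_comm]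
  gcongr

/-- The model integral at a transverse crossing. -/
theorem integral_inv_powFiveHalves_form {σ : ℝ} {M : Set R4} (hM : IsSpaceForm σ M) {x a b c : R4}
    (hx : x ∈ M) (ha : form σ x a = 0) (hb : form σ x b = 0) (hc : form σ x c = 0)
    (hv : vol x a b c ≠ 0) :
    (∀ p : (ℝ × ℝ) × ℝ, p ≠ 0 → 0 < σ * form σ (p.1.1 • a + p.1.2 • b + p.2 • c)
      (p.1.1 • a + p.1.2 • b + p.2 • c)) ∧
    ∫ p : (ℝ × ℝ) × ℝ, (powFiveHalves (1 + 1 / 2 * (σ * form σ (p.1.1 • a + p.1.2 • b + p.2 • c)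
      (p.1.1 • a + p.1.2 • b + p.2 • c))))⁻¹ = 2 * √2 * (4 * Real.pi / 3) / |vol x a b c| := by
  have pos : ∀ p : (ℝ × ℝ) × ℝ, p ≠ 0 → 0 < σ * form σ (p.1.1 • a + p.1.2 • b + p.2 • c)
      (p.1.1 • a + p.1.2 • b + p.2 • c) := by
    intro p hp
    refine hM.metric_pos x hx _ ?_ ?_
    · simp only [form_add_right, form_smul_right, ha, hb, hc]; ring
    · intro h0
      apply hp
      have z : ∀ i, p.1.1 * a i + p.1.2 * b i + p.2 * c i = 0 := fun i => by
        simpa using congrFun h0 i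
      -- Inserting the vanishing combination into a volume with two of the three vectors isolates
      -- the coefficient of the third, times a nonzero volume.
      have v0 : ∀ u w, vol x (p.1.1 • a + p.1.2 • b + p.2 • c) u w = 0 := by
        intro u w; rw [h0, vol_eq]; simp
      have k1 : p.1.1 * vol x a b c = 0 := by
        have := v0 b c
        rw [← this]
        simp only [vol_eq, Pi.add_apply, Pi.smul_apply, smul_eq_mul]; ring
      have k2 : p.1.2 * vol x a b c = 0 := by
        have := v0 c a
        rw [← this]
        simp only [vol_eq, Pi.add_apply, Pi.smul_apply, smul_eq_mul]; ring
      have k3 : p.2 * vol x a b c = 0 := by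
        have := v0 a b
        rw [← this]
        simp only [vol_eq, Pi.add_apply, Pi.smul_apply, smul_eq_mul]; ring
      have := (mul_eq_zero.mp k1).resolve_right hv
      have := (mul_eq_zero.mp k2).resolve_right hv
      have := (mul_eq_zero.mp k3).resolve_right hv
      ext <;> simpa
  refine ⟨pos, ?_⟩
  have expand : ∀ p : (ℝ × ℝ) × ℝ, σ * form σ (p.1.1 • a + p.1.2 • b + p.2 • c)
      (p.1.1 • a + p.1.2 • b + p.2 • c) = (σ * form σ a a) * p.1.1 ^ 2
        + 2 * (σ * form σ a b) * p.1.1 * p.1.2 + 2 * (σ * form σ a c) * p.1.1 * p.2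
        + (σ * form σ b b) * p.1.2 ^ 2 + 2 * (σ * form σ b c) * p.1.2 * p.2
        + (σ * form σ c c) * p.2 ^ 2 := by
    intro p
    simp only [form_add_left, form_add_right, form_smul_left, form_smul_right, form_comm σ b a,
      form_comm σ c a, form_comm σ c b]
    ring
  have hA : 0 < σ * form σ a a := by
    have := pos ((1, 0), 0) (by simp)
    rw [expand] at this
    simpa using this
  have hdet := vol_sq_eq_gram σ hM.sq x a b c (hM.form_self x hx) ha hb hc
  have hdet' : vol x a b c ^ 2 = (σ * form σ a a) * ((σ * form σ b b) * (σ * form σ c c)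
      - (σ * form σ b c) * (σ * form σ b c)) - (σ * form σ a b) * ((σ * form σ a b) *
      (σ * form σ c c) - (σ * form σ b c) * (σ * form σ a c)) + (σ * form σ a c) *
      ((σ * form σ a b) * (σ * form σ b c) - (σ * form σ b b) * (σ * form σ a c)) := by
    rw [hdet]
    linear_combination (-σ * (form σ a a * (form σ b b * form σ c c - form σ b c * form σ b c)
       - form σ a b * (form σ a b * form σ c c - form σ b c * form σ a c)
       + form σ a c * (form σ a b * form σ b c - form σ b b * form σ a c))) * hM.sq
  have hH : 0 < (σ * form σ a a) * (σ * form σ b b) - (σ * form σ a b) ^ 2 := by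
    -- On this vector the form takes the value ⟨a, a⟩ times the second leading minor.
    have := pos ((-(σ * form σ a b), σ * form σ a a), 0) (by
      intro h
      simp only [Prod.mk_eq_zero] at h
      exact hA.ne' h.1.2)
    rw [expand] at this
    have e : 0 < (σ * form σ a a) * ((σ * form σ a a) * (σ * form σ b b) - (σ * form σ a b) ^ 2) := by
      refine this.trans_eq ?_
      ring
    exact (mul_pos_iff_of_pos_left hA).mp e
  simp only [expand]
  rw [integral_inv_powFiveHalves_quadratic hA hH (by rw [← hdet']; positivity), ← hdet',
    Real.sqrt_sq_eq_abs]

end LinkingIntegral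

/-! ### Localization of the density at one crossing -/

namespace LinkingIntegral
open Set Filter Topology MeasureTheory Asymptotics

/-- The density concentrating on the crossings as `e → 0`, as a function of the gap `z`. -/
noncomputable def crossingDensity (σ : ℝ) (h1 h2 : ℝ → ℝ) (e z : ℝ) : ℝ :=
  e * ((2 - 2 * σ * (z + e) + σ * e) * h2 (z + e) - 3 * σ * h1 (z + e))

section
variable {σ lam : ℝ} {h h1 h2 : ℝ → ℝ}

theorem IsLinkingKernel.continuousOn_deriv (hk : IsLinkingKernel σ lam h h1 h2) :
    ContinuousOn h1 (Ioi 0) := fun w hw =>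
  (hk.hasDerivAt_deriv w hw).continuousAt.continuousWithinAt

theorem IsLinkingKernel.continuousOn_self (hk : IsLinkingKernel σ lam h h1 h2) :
    ContinuousOn h (Ioi 0) := fun w hw =>
  (hk.hasDerivAt w hw).continuousAt.continuousWithinAt

/-- The density is continuous where the gap is nonnegative and `e > 0`. -/
theorem IsLinkingKernel.continuousOn_crossingDensity (hk : IsLinkingKernel σ lam h h1 h2) :
    ContinuousOn (fun p : ℝ × ℝ => crossingDensity σ h1 h2 p.1 p.2) {p | 0 < p.2 + p.1} := by
  have c1 : ContinuousOn (fun p : ℝ × ℝ => h1 (p.2 + p.1)) {p | 0 < p.2 + p.1} :=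
    hk.continuousOn_deriv.comp (by fun_prop) fun p hp => hp
  have c2 : ContinuousOn (fun p : ℝ × ℝ => h2 (p.2 + p.1)) {p | 0 < p.2 + p.1} :=
    hk.continuousOn.comp (by fun_prop) fun p hp => hp
  exact ContinuousOn.mul (by fun_prop) (ContinuousOn.sub (ContinuousOn.mul (by fun_prop) c2)
    (ContinuousOn.mul continuousOn_const c1))

/-- The bracket in `crossingDensity`, multiplied by `w ^ (5/2)`. -/
theorem IsLinkingKernel.tendsto_bracket (hk : IsLinkingKernel σ lam h h1 h2) {ι : Type*}
    {l : Filter ι} {e w : ι → ℝ} (he : Tendsto e l (𝓝 0)) (hw : Tendsto w l (𝓝[>] 0)) :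
    Tendsto (fun i => powFiveHalves (w i) *
      ((2 - 2 * σ * w i + σ * e i) * h2 (w i) - 3 * σ * h1 (w i))) l
      (𝓝 (3 * lam / (2 * √2))) := by
  have w0 : Tendsto w l (𝓝 0) := hw.mono_right nhdsWithin_le_nhds
  -- After multiplication by w^(5/2) the term in `h1` tends to 0 and only 2 · `h2` survives, which
  -- doubles the constant of `tendsto_two`.
  have t := ((((w0.const_mul (2 * σ)).const_sub 2).add (he.const_mul σ)).mul
    (hk.tendsto_two.comp hw)).sub ((hk.tendsto_one.comp hw).const_mul (3 * σ))
  have e : (2 - 2 * σ * 0 + σ * 0) * (3 * lam / (4 * √2)) - 3 * σ * 0 = 3 * lam / (2 * √2) := by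
    ring
  rw [e] at t
  refine t.congr fun i => ?_
  simp only [Function.comp, powFiveHalves]
  ring

/-- The limit in `tendsto_bracket`, taken jointly in e and w, gives a bound uniform in both, as
dominated convergence requires. -/
theorem IsLinkingKernel.bracket_bounded (hk : IsLinkingKernel σ lam h h1 h2) :
    ∃ r C : ℝ, 0 < r ∧ 0 ≤ C ∧ ∀ e w, 0 < w → w ≤ r → 0 ≤ e → e ≤ r →
      |powFiveHalves w * ((2 - 2 * σ * w + σ * e) * h2 w - 3 * σ * h1 w)| ≤ C := by
  have t := hk.tendsto_bracket (l := 𝓝 (0 : ℝ) ×ˢ 𝓝[>] (0 : ℝ)) (e := Prod.fst) (w := Prod.snd)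
    tendsto_fst tendsto_snd
  have ev := t.abs.eventually (eventually_lt_nhds (b := |3 * lam / (2 * √2)| + 1) (by linarith))
  obtain ⟨s, hs, u, hu, hsub⟩ := mem_prod_iff.mp ev
  obtain ⟨r1, hr1, hb1⟩ := Metric.mem_nhds_iff.mp hs
  obtain ⟨r2, hr2, hb2⟩ := mem_nhdsGT_iff_exists_Ioo_subset.mp hu
  have hr2 : 0 < r2 := hr2
  refine ⟨min (r1 / 2) (r2 / 2), |3 * lam / (2 * √2)| + 1, by positivity, by positivity, ?_⟩
  intro e w hw hwr he her
  refine le_of_lt (hsub (show (e, w) ∈ s ×ˢ u from ⟨hb1 ?_, hb2 ⟨hw, ?_⟩⟩))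
  · rw [Metric.mem_ball, Real.dist_eq, sub_zero, abs_of_nonneg he]
    linarith [min_le_left (r1 / 2) (r2 / 2)]
  · linarith [min_le_right (r1 / 2) (r2 / 2)]

end

/-- If `z` agrees with a definite quadratic function to second order at `q`, then it is bounded
below by a multiple of the square of the distance to `q`. -/
theorem eventually_mul_norm_sq_le {E : Type*} [NormedAddCommGroup E] {z Q : E → ℝ} {q : E} {a : ℝ} (ha : 0 < a)
    (hz : (fun p => z (q + p) - Q p) =o[𝓝 0] fun p => ‖p‖ ^ 2)
    (hQ : ∀ p, a * ‖p‖ ^ 2 ≤ Q p) : ∀ᶠ p in 𝓝 q, a / 2 * ‖p - q‖ ^ 2 ≤ z p := by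
  have h1 := hz.def (half_pos ha)
  have h2 : Tendsto (fun p => p - q) (𝓝 q) (𝓝 0) := by
    have : Tendsto (fun p => p - q) (𝓝 q) (𝓝 (q - q)) := tendsto_id.sub_const q
    rwa [sub_self] at this
  filter_upwards [h2.eventually h1] with p hp
  have hp : ‖z (q + (p - q)) - Q (p - q)‖ ≤ a / 2 * ‖‖p - q‖ ^ 2‖ := hp
  rw [add_sub_cancel, Real.norm_eq_abs, Real.norm_of_nonneg (by positivity)] at hp
  linarith [(abs_le.mp hp).1, hQ (p - q)]

section
variable {E : Type*} [NormedAddCommGroup E] [NormedSpace ℝ E] [FiniteDimensional ℝ E]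
variable [MeasurableSpace E] [BorelSpace E] (μ : Measure E) [μ.IsAddHaarMeasure]
variable {σ lam : ℝ} {h h1 h2 : ℝ → ℝ}

/-- The contribution of one crossing. -/
theorem IsLinkingKernel.tendsto_integral_crossingDensity (hk : IsLinkingKernel σ lam h h1 h2)
    (hE : Module.finrank ℝ E = 3) {z D Q : E → ℝ} {q : E} {a : ℝ} (ha : 0 < a)
    (hz : (fun p => z (q + p) - Q p) =o[𝓝 0] fun p => ‖p‖ ^ 2)
    (hQ : ∀ p, a * ‖p‖ ^ 2 ≤ Q p) (hom : ∀ (t : ℝ) p, Q (t • p) = t ^ 2 * Q p)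
    (hq : z q = 0) (hzc : ∀ᶠ p in 𝓝 q, ContinuousAt z p) (hDc : ∀ᶠ p in 𝓝 q, ContinuousAt D p) :
    ∃ V ∈ 𝓝 q, ∀ U ⊆ V, IsOpen U → q ∈ U →
      Tendsto (fun e => ∫ p in U, crossingDensity σ h1 h2 e (z p) * D p ∂μ) (𝓝[>] 0)
        (𝓝 (3 * lam / (2 * √2) * D q * ∫ p, (powFiveHalves (1 + Q p))⁻¹ ∂μ)) := by
  obtain ⟨r, C, hr, hC, hrC⟩ := hk.bracket_bounded
  have hzq : ContinuousAt z q := hzc.self_of_nhds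
  have hDq : ContinuousAt D q := hDc.self_of_nhds
  have hV := (eventually_mul_norm_sq_le ha hz hQ).and (hzc.and (hDc.and
    ((hzq.eventually (eventually_lt_nhds (b := r / 2) (by rw [hq]; positivity))).and
      (hDq.abs.eventually (eventually_lt_nhds (b := |D q| + 1) (by linarith))))))
  refine ⟨_, hV, fun U hUV hUo hqU => ?_⟩
  have low : ∀ p ∈ U, a / 2 * ‖p - q‖ ^ 2 ≤ z p := fun p hp => (hUV hp).1
  have zc : ContinuousOn z U := fun p hp => (hUV hp).2.1.continuousWithinAt
  have Dc : ContinuousOn D U := fun p hp => (hUV hp).2.2.1.continuousWithinAt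
  have zs : ∀ p ∈ U, z p < r / 2 := fun p hp => (hUV hp).2.2.2.1
  have Db : ∀ p ∈ U, |D p| < |D q| + 1 := fun p hp => (hUV hp).2.2.2.2
  have z0 : ∀ p ∈ U, 0 ≤ z p := fun p hp => le_trans (by positivity) (low p hp)
  -- The substitution p ↦ q + εp with e = ε²; ε³ is the Jacobian in dimension three.
  set F : ℝ → E → ℝ := fun ε p => ε ^ 3 *
    U.indicator (fun p => crossingDensity σ h1 h2 (ε ^ 2) (z p) * D p) (q + ε • p) with hF
  have rescale : ∀ ε : ℝ, 0 < ε →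
      ∫ p in U, crossingDensity σ h1 h2 (ε ^ 2) (z p) * D p ∂μ = ∫ p, F ε p ∂μ := by
    intro ε hε
    rw [← integral_indicator hUo.measurableSet]
    set g := U.indicator (fun p => crossingDensity σ h1 h2 (ε ^ 2) (z p) * D p)
    rw [hF]
    simp only
    rw [integral_const_mul, Measure.integral_comp_smul μ (fun p => g (q + p)) ε, hE,
      integral_add_left_eq_self g q, abs_of_pos (by positivity), smul_eq_mul]
    field_simp
  -- On U the gap at q + εp is at least ε² a|p|²/2, so (gap + ε²)^(5/2) is at least ε⁵(1 +
  -- a|p|²/2)^(5/2). These five powers of ε cancel the Jacobian ε³ and the factor e = ε² of the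
  -- density.
  have bound : ∀ ε : ℝ, 0 < ε → ε ^ 2 ≤ r / 2 → ∀ p,
      ‖F ε p‖ ≤ C * (|D q| + 1) * (powFiveHalves (1 + a / 2 * ‖p‖ ^ 2))⁻¹ := by
    intro ε hε hεr p
    have hpos : 0 < powFiveHalves (1 + a / 2 * ‖p‖ ^ 2) := powFiveHalves_pos (by positivity)
    by_cases hp : q + ε • p ∈ U
    · simp only [hF, indicator_of_mem hp, crossingDensity]
      set w := z (q + ε • p) + ε ^ 2 with hw
      have hw0 : 0 < w := by have := z0 _ hp; positivity
      have l1 := low _ hp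
      rw [add_sub_cancel_left, norm_smul, mul_pow, Real.norm_eq_abs, sq_abs] at l1
      have l2 : ε ^ 2 * (1 + a / 2 * ‖p‖ ^ 2) ≤ w := by rw [hw]; linarith
      have l3 := powFiveHalves_mono (by positivity) l2
      rw [powFiveHalves_sq_mul hε.le] at l3
      have hb := hrC (ε ^ 2) w hw0 (by rw [hw]; linarith [zs _ hp]) (by positivity) (by linarith)
      have hwp := powFiveHalves_pos hw0
      have hd := (Db _ hp).le
      set B := (2 - 2 * σ * w + σ * ε ^ 2) * h2 w - 3 * σ * h1 w
      have e1 : ε ^ 3 * (ε ^ 2 * B * D (q + ε • p)) =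
          (ε ^ 5 * (powFiveHalves w)⁻¹) * ((powFiveHalves w * B) * D (q + ε • p)) := by
        field_simp
      rw [e1, norm_mul, norm_mul (powFiveHalves w * B), Real.norm_of_nonneg (by positivity),
        Real.norm_eq_abs, Real.norm_eq_abs, mul_comm]
      have e2 : ε ^ 5 * (powFiveHalves w)⁻¹ ≤ (powFiveHalves (1 + a / 2 * ‖p‖ ^ 2))⁻¹ := by
        rw [← div_eq_mul_inv, div_le_iff₀ hwp]
        calc ε ^ 5 = (powFiveHalves (1 + a / 2 * ‖p‖ ^ 2))⁻¹ *
              (ε ^ 5 * powFiveHalves (1 + a / 2 * ‖p‖ ^ 2)) := by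
              rw [mul_left_comm, inv_mul_cancel₀ hpos.ne', mul_one]
          _ ≤ _ := by gcongr
      gcongr
    · simp only [hF, indicator_of_notMem hp, mul_zero, norm_zero]
      positivity
  have meas : ∀ ε : ℝ, 0 < ε → AEStronglyMeasurable (F ε) μ := by
    intro ε hε
    have c : ContinuousOn (fun p => crossingDensity σ h1 h2 (ε ^ 2) (z p) * D p) U := by
      refine ContinuousOn.mul ?_ Dc
      refine hk.continuousOn_crossingDensity.comp (f := fun p => (ε ^ 2, z p)) (by fun_prop) ?_
      intro p hp
      have := z0 p hp
      change 0 < z p + ε ^ 2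
      positivity
    classical
    have m : Measurable (U.indicator (fun p => crossingDensity σ h1 h2 (ε ^ 2) (z p) * D p)) := by
      rw [← piecewise_eq_indicator]
      exact ContinuousOn.measurable_piecewise c continuousOn_const hUo.measurableSet
    exact (Measurable.const_mul (m.comp (by fun_prop)) _).aestronglyMeasurable
  have point : ∀ p, Tendsto (fun ε => F ε p) (𝓝[>] 0)
      (𝓝 (3 * lam / (2 * √2) * D q * (powFiveHalves (1 + Q p))⁻¹)) := by
    intro p
    have i0 : Tendsto (fun ε : ℝ => ε) (𝓝[>] 0) (𝓝 0) := nhdsWithin_le_nhds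
    have s0 : Tendsto (fun ε : ℝ => ε • p) (𝓝[>] 0) (𝓝 0) := by
      simpa using i0.smul_const p
    have q0 : Tendsto (fun ε : ℝ => q + ε • p) (𝓝[>] 0) (𝓝 q) := by
      simpa using s0.const_add q
    have pos : ∀ᶠ ε : ℝ in 𝓝[>] 0, 0 < ε := self_mem_nhdsWithin
    -- Homogeneity of Q turns the second-order expansion at q into convergence of the rescaled gap.
    have zlim : Tendsto (fun ε => z (q + ε • p) / ε ^ 2) (𝓝[>] 0) (𝓝 (Q p)) := by
      have o := hz.comp_tendsto s0
      have o2 : (fun ε : ℝ => z (q + ε • p) - Q (ε • p)) =o[𝓝[>] 0] fun ε => ε ^ 2 := by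
        refine o.trans_isBigO ?_
        refine IsBigO.of_bound (‖p‖ ^ 2) (Eventually.of_forall fun ε => ?_)
        simp only [Function.comp, norm_smul, norm_mul, norm_pow, norm_norm, mul_pow]
        rw [mul_comm]
      have t := o2.tendsto_div_nhds_zero.add_const (Q p)
      rw [zero_add] at t
      refine t.congr' ?_
      filter_upwards [pos] with ε hε
      rw [hom]
      field_simp
      ring
    have wlim : Tendsto (fun ε => z (q + ε • p) + ε ^ 2) (𝓝[>] 0) (𝓝[>] 0) := by
      refine tendsto_nhdsWithin_iff.mpr ⟨?_, ?_⟩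
      · have := (hzq.tendsto.comp q0).add (i0.pow 2)
        simpa [hq] using this
      · filter_upwards [pos, q0.eventually (hUo.mem_nhds hqU)] with ε hε hU
        have := z0 _ hU
        change 0 < z (q + ε • p) + ε ^ 2
        positivity
    have e0 : Tendsto (fun ε : ℝ => ε ^ 2) (𝓝[>] 0) (𝓝 0) := by simpa using i0.pow 2
    have br := hk.tendsto_bracket e0 wlim
    have Qp : 0 ≤ Q p := le_trans (by positivity) (hQ p)
    have pw : Tendsto (fun ε => (powFiveHalves (1 + z (q + ε • p) / ε ^ 2))⁻¹) (𝓝[>] 0)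
        (𝓝 (powFiveHalves (1 + Q p))⁻¹) :=
      ((continuous_powFiveHalves.tendsto _).comp (zlim.const_add 1)).inv₀
        (powFiveHalves_pos (by positivity)).ne'
    refine ((br.mul (hDq.tendsto.comp q0)).mul pw).congr' ?_
    filter_upwards [pos, q0.eventually (hUo.mem_nhds hqU)] with ε hε hU
    simp only [hF, indicator_of_mem hU, crossingDensity, Function.comp]
    have hw0 : 0 < z (q + ε • p) + ε ^ 2 := by have := z0 _ hU; positivity
    have hwp := powFiveHalves_pos hw0
    have e1 : powFiveHalves (z (q + ε • p) + ε ^ 2) =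
        ε ^ 5 * powFiveHalves (1 + z (q + ε • p) / ε ^ 2) := by
      rw [← powFiveHalves_sq_mul hε.le]
      congr 1
      field_simp
      ring
    have hz1 : 0 < powFiveHalves (1 + z (q + ε • p) / ε ^ 2) := by
      have := z0 _ hU
      exact powFiveHalves_pos (by positivity)
    rw [e1]
    generalize powFiveHalves (1 + z (q + ε • p) / ε ^ 2) = P at hz1 ⊢
    field_simp
  have lim : Tendsto (fun ε => ∫ p, F ε p ∂μ) (𝓝[>] 0)
      (𝓝 (3 * lam / (2 * √2) * D q * ∫ p, (powFiveHalves (1 + Q p))⁻¹ ∂μ)) := by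
    rw [← integral_const_mul]
    refine tendsto_integral_filter_of_dominated_convergence
      (fun p => C * (|D q| + 1) * (powFiveHalves (1 + a / 2 * ‖p‖ ^ 2))⁻¹) ?_ ?_
      ((integrable_inv_powFiveHalves μ hE (half_pos ha)).const_mul _)
      (Eventually.of_forall point)
    · filter_upwards [self_mem_nhdsWithin] with ε hε using meas ε hε
    · have : ∀ᶠ ε : ℝ in 𝓝[>] 0, ε ^ 2 < r / 2 := by
        have t : Tendsto (fun ε : ℝ => ε ^ 2) (𝓝[>] 0) (𝓝 (0 ^ 2)) :=
          Tendsto.pow (tendsto_id.mono_left nhdsWithin_le_nhds) 2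
        exact t.eventually (eventually_lt_nhds (by simpa using hr))
      filter_upwards [self_mem_nhdsWithin, this] with ε hε hεr
      exact Eventually.of_forall (bound ε hε hεr.le)
  -- Back to the parameter e, with ε = √e.
  have sq : Tendsto (fun e : ℝ => √e) (𝓝[>] 0) (𝓝[>] 0) := by
    refine tendsto_nhdsWithin_iff.mpr ⟨?_, ?_⟩
    · have := (Real.continuous_sqrt.tendsto 0).mono_left (nhdsWithin_le_nhds (s := Ioi 0))
      simpa using this
    · filter_upwards [self_mem_nhdsWithin] with e he
      exact Real.sqrt_pos.mpr he
  refine (lim.comp sq).congr' ?_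
  filter_upwards [self_mem_nhdsWithin] with e he
  have he : 0 < e := he
  have := rescale (√e) (Real.sqrt_pos.mpr he)
  rw [Real.sq_sqrt he.le] at this
  simp only [Function.comp]
  exact this.symm

end

end LinkingIntegral

namespace LinkingIntegral
open Set Filter Topology MeasureTheory Asymptotics

/-! ### Derivatives of the inner product and of the volume form -/

theorem hasDerivAt_form {σ t : ℝ} {a b : ℝ → R4} {a' b' : R4} (ha : HasDerivAt a a' t)
    (hb : HasDerivAt b b' t) :
    HasDerivAt (fun s => form σ (a s) (b s)) (form σ a' (b t) + form σ (a t) b') t := by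
  have ha := hasDerivAt_pi.1 ha
  have hb := hasDerivAt_pi.1 hb
  refine (((ha 0).mul (hb 0)).add (((((ha 1).mul (hb 1)).add ((ha 2).mul (hb 2))).add
    ((ha 3).mul (hb 3))).const_mul σ)).congr_deriv ?_
  simp only [form]
  ring

theorem hasDerivAt_gap {σ t : ℝ} {a b : ℝ → R4} {a' b' : R4} (ha : HasDerivAt a a' t)
    (hb : HasDerivAt b b' t) :
    HasDerivAt (fun s => gap σ (a s) (b s))
      (-σ * (form σ a' (b t) + form σ (a t) b')) t := by
  refine (((hasDerivAt_form (σ := σ) ha hb).const_sub 1).const_mul σ).congr_deriv ?_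
  ring

theorem hasDerivAt_vol {t : ℝ} {a b c d : ℝ → R4} {a' b' c' d' : R4} (ha : HasDerivAt a a' t)
    (hb : HasDerivAt b b' t) (hc : HasDerivAt c c' t) (hd : HasDerivAt d d' t) :
    HasDerivAt (fun s => vol (a s) (b s) (c s) (d s))
      (vol a' (b t) (c t) (d t) + vol (a t) b' (c t) (d t) + vol (a t) (b t) c' (d t)
        + vol (a t) (b t) (c t) d') t := by
  have ha := hasDerivAt_pi.1 ha
  have hb := hasDerivAt_pi.1 hb
  have hc := hasDerivAt_pi.1 hc
  have hd := hasDerivAt_pi.1 hd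
  have m := fun i j => ((hc i).mul (hd j)).sub ((hc j).mul (hd i))
  have A := fun i j k => (((hb i).mul (m j k)).sub ((hb j).mul (m i k))).add ((hb k).mul (m i j))
  have key := ((((ha 0).mul (A 1 2 3)).sub ((ha 1).mul (A 0 2 3))).add ((ha 2).mul (A 0 1 3))).sub
    ((ha 3).mul (A 0 1 2))
  have e : (fun s => vol (a s) (b s) (c s) (d s)) = _ :=
    funext fun s => vol_eq (a s) (b s) (c s) (d s)
  rw [e]
  refine key.congr_deriv ?_
  simp only [vol_eq, Pi.mul_apply, Pi.sub_apply, Pi.add_apply]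
  ring

theorem contDiff_vol : ContDiff ℝ ∞ fun p : R4 × R4 × R4 × R4 => vol p.1 p.2.1 p.2.2.1 p.2.2.2 := by
  simp only [vol_eq]
  fun_prop

theorem contDiff_form (σ : ℝ) : ContDiff ℝ ∞ fun p : R4 × R4 => form σ p.1 p.2 := by
  unfold form
  fun_prop

theorem contDiff_gap (σ : ℝ) : ContDiff ℝ ∞ fun p : R4 × R4 => gap σ p.1 p.2 := by
  unfold gap form
  fun_prop

section
variable {E : Type*} [TopologicalSpace E] {s : Set E} {a b c d : E → R4}

theorem continuousOn_vol (ha : ContinuousOn a s) (hb : ContinuousOn b s) (hc : ContinuousOn c s)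
    (hd : ContinuousOn d s) : ContinuousOn (fun p => vol (a p) (b p) (c p) (d p)) s :=
  Continuous.comp_continuousOn (g := fun p : R4 × R4 × R4 × R4 => vol p.1 p.2.1 p.2.2.1 p.2.2.2)
    (f := fun p => (a p, b p, c p, d p)) contDiff_vol.continuous
    (ha.prodMk (hb.prodMk (hc.prodMk hd)))

theorem continuousOn_gap {σ : ℝ} (ha : ContinuousOn a s) (hb : ContinuousOn b s) :
    ContinuousOn (fun p => gap σ (a p) (b p)) s :=
  (contDiff_gap σ).continuous.comp_continuousOn (ha.prodMk hb)

theorem continuousOn_form {σ : ℝ} (ha : ContinuousOn a s) (hb : ContinuousOn b s) :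
    ContinuousOn (fun p => form σ (a p) (b p)) s :=
  (contDiff_form σ).continuous.comp_continuousOn (ha.prodMk hb)

end

/-! ### Smooth squares -/

theorem unitSquare_eq_Icc : unitSquare = Icc ((0 : ℝ), (0 : ℝ)) (1, 1) := by
  rw [unitSquare, Icc_prod_Icc]

theorem isCompact_unitSquare : IsCompact unitSquare := isCompact_Icc.prod isCompact_Icc

theorem isOpen_openSquare : IsOpen openSquare := isOpen_Ioo.prod isOpen_Ioo

theorem openSquare_subset : openSquare ⊆ unitSquare :=
  prod_mono Ioo_subset_Icc_self Ioo_subset_Icc_self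

theorem unitSquare_mem_nhds {p : ℝ × ℝ} (hp : p ∈ openSquare) : unitSquare ∈ 𝓝 p :=
  mem_of_superset (isOpen_openSquare.mem_nhds hp) openSquare_subset

theorem uniqueDiffOn_unitSquare : UniqueDiffOn ℝ unitSquare :=
  (uniqueDiffOn_Icc zero_lt_one).prod (uniqueDiffOn_Icc zero_lt_one)

/-- The partial derivative of a smooth square in the direction `d`. -/
noncomputable def partialDeriv (X : ℝ × ℝ → R4) (d p : ℝ × ℝ) : R4 :=
  fderivWithin ℝ X unitSquare p d

section
variable {X : ℝ × ℝ → R4} (hX : ContDiffOn ℝ ∞ X unitSquare)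
include hX

theorem contDiffOn_partialDeriv (d : ℝ × ℝ) : ContDiffOn ℝ ∞ (partialDeriv X d) unitSquare :=
  (hX.fderivWithin uniqueDiffOn_unitSquare (by simp)).clm_apply contDiffOn_const

theorem hasFDerivAt_of_mem_openSquare {p : ℝ × ℝ} (hp : p ∈ openSquare) :
    HasFDerivAt X (fderivWithin ℝ X unitSquare p) p :=
  ((hX.differentiableOn (by simp)) p (openSquare_subset hp)).hasFDerivWithinAt.hasFDerivAt
    (unitSquare_mem_nhds hp)

/-- Derivatives within the closed square are continuous up to its edges, as Stokes' theorem needs;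
in the interior they are the derivatives that occur in `crossingVol`. -/
theorem partialDeriv_eq_fderiv {p : ℝ × ℝ} (hp : p ∈ openSquare) (d : ℝ × ℝ) :
    partialDeriv X d p = fderiv ℝ X p d := by
  rw [(hasFDerivAt_of_mem_openSquare hX hp).fderiv, partialDeriv]

/-- Mixed second partial derivatives agree. -/
theorem fderiv_partialDeriv_comm {p : ℝ × ℝ} (hp : p ∈ openSquare) (d d' : ℝ × ℝ) :
    fderiv ℝ (partialDeriv X d) p d' = fderiv ℝ (partialDeriv X d') p d := by
  have hc : ContDiffAt ℝ ∞ X p := hX.contDiffAt (unitSquare_mem_nhds hp)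
  have sym : IsSymmSndFDerivAt ℝ X p := hc.isSymmSndFDerivAt (by simp; exact WithTop.coe_le_coe.2 (le_top : (2 : ℕ∞) ≤ ⊤))
  have e : ∀ d, fderiv ℝ (partialDeriv X d) p = (fderiv ℝ (fderiv ℝ X) p).flip d := by
    intro d
    have : partialDeriv X d =ᶠ[𝓝 p] fun q => fderiv ℝ X q d := by
      filter_upwards [isOpen_openSquare.mem_nhds hp] with q hq using partialDeriv_eq_fderiv hX hq d
    rw [this.fderiv_eq]
    have hd : DifferentiableAt ℝ (fderiv ℝ X) p :=
      (hc.fderiv_right (m := ∞) (by simp)).differentiableAt (by simp)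
    refine ContinuousLinearMap.ext fun v => ?_
    rw [fderiv_clm_apply hd (differentiableAt_const d)]
    simp
  rw [e, e]
  exact sym d' d

/-- The direction in which an edge of the unit square is traversed. -/
theorem hasDerivAt_comp_squareEdge (k : Fin 4) {u : ℝ} (hu : u ∈ Ioo (0 : ℝ) 1) :
    HasDerivAt (fun s => X (squareEdge k s))
      (partialDeriv X (![((1 : ℝ), (0 : ℝ)), (0, 1), (-1, 0), (0, -1)] k) (squareEdge k u)) u := by
  have maps : ∀ s ∈ Icc (0 : ℝ) 1, squareEdge k s ∈ unitSquare := by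
    intro s hs
    fin_cases k <;> simp [squareEdge, unitSquare, hs.1, hs.2]
  have d : HasDerivAt (squareEdge k) (![((1 : ℝ), (0 : ℝ)), (0, 1), (-1, 0), (0, -1)] k) u := by
    fin_cases k
    · exact (hasDerivAt_id u).prodMk (hasDerivAt_const u 0)
    · exact (hasDerivAt_const u 1).prodMk (hasDerivAt_id u)
    · exact ((hasDerivAt_id u).const_sub 1).prodMk (hasDerivAt_const u 1)
    · exact (hasDerivAt_const u 0).prodMk ((hasDerivAt_id u).const_sub 1)
  have dX := ((hX.differentiableOn (by simp)) _
    (maps u (Ioo_subset_Icc_self hu))).hasFDerivWithinAt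
  exact (dX.comp_hasDerivWithinAt u d.hasDerivWithinAt maps).hasDerivAt
    (Icc_mem_nhds hu.1 hu.2)

end

/-- The integral over `γ`, defined on `[0, 1]`, of the 1-form `k(gap) vol(γ, ·, y, w)`. -/
noncomputable def lineInt (σ : ℝ) (k : ℝ → ℝ) (γ : ℝ → R4) (y w : R4) : ℝ :=
  ∫ s in (0 : ℝ)..1, k (gap σ (γ s) y) * vol (γ s) (deriv γ s) y w

/-- The exterior derivative of the regularized form: a derivative along the curve `y` plus a
term proportional to `crossingDensity`. -/
theorem divergence_identity {σ e h h1 h2 : ℝ} (hσ : σ * σ = 1) {a u v b w : R4}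
    (haa : form σ a a = 1) (hbb : form σ b b = 1) (hau : form σ a u = 0) (hav : form σ a v = 0)
    (hbw : form σ b w = 0)
    (ode : (2 * (gap σ a b + e) - σ * (gap σ a b + e) ^ 2) * h2
      + 3 * (1 - σ * (gap σ a b + e)) * h1 - σ * h = 0) :
    -h2 * (-σ * form σ u b * vol a v b w + σ * form σ v b * vol a u b w) - 2 * h1 * vol u v b w =
      (((1 - σ * gap σ a b) * h2 - 2 * σ * h1) * (-σ * form σ a w) * vol a u v b
        + ((1 - σ * gap σ a b) * h1 - σ * h) * vol a u v w)
      + e * ((2 - 2 * σ * (gap σ a b + e) + σ * e) * h2 - 3 * σ * h1) * vol a u v w := by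
  -- The vectors a, u, v, b, w are linearly dependent. Pairing the relation with a determines vol u
  -- v b w, and pairing it with b the bracket multiplied by `h2`. What remains is a multiple of vol
  -- a u v w, to which the equation for h applies. That equation holds at gap + e while the geometry
  -- involves the gap alone; the discrepancy is the term with factor e.
  have R1 := form_vol_relation σ b a u v b w
  have R2 := form_vol_relation σ a a u v b w
  rw [form_comm σ b a, form_comm σ b u, form_comm σ b v, hbb, hbw] at R1
  rw [haa, hau, hav] at R2
  rw [gap] at *
  have : σ = 1 ∨ σ = -1 := mul_self_eq_one_iff.mp hσ
  rcases this with rfl | rfl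
  · linear_combination (-h2) * R1 + (h2 * form 1 a b - 2 * h1) * R2 - vol a u v w * ode
  · linear_combination (h2) * R1 + (-h2 * form (-1) a b - 2 * h1) * R2 - vol a u v w * ode

/-- The derivative along the curve `y` of the 2-form that completes the regularized form. -/
noncomputable def completionDeriv (σ : ℝ) (h h1 h2 : ℝ → ℝ) (e : ℝ) (a u v b w : R4) : ℝ :=
  ((1 - σ * gap σ a b) * h2 (gap σ a b + e) - 2 * σ * h1 (gap σ a b + e)) * (-σ * form σ a w)
    * vol a u v b + ((1 - σ * gap σ a b) * h1 (gap σ a b + e) - σ * h (gap σ a b + e)) * vol a u v w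

section
variable {X : ℝ × ℝ → R4} (hX : ContDiffOn ℝ ∞ X unitSquare)
include hX

theorem hasDerivAt_line_of_mem_openSquare {p : ℝ × ℝ} (hp : p ∈ openSquare) (d : ℝ × ℝ) :
    HasDerivAt (fun s : ℝ => X (p + s • d)) (partialDeriv X d p) 0 :=
  (hasFDerivAt_of_mem_openSquare hX hp).hasLineDerivAt d

theorem form_partialDeriv_eq_zero {σ : ℝ} {M : Set R4} (hM : IsSpaceForm σ M)
    (hXM : ∀ p ∈ unitSquare, X p ∈ M) {p : ℝ × ℝ} (hp : p ∈ openSquare) (d : ℝ × ℝ) :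
    form σ (X p) (partialDeriv X d p) = 0 := by
  have hXd := hasDerivAt_line_of_mem_openSquare hX hp d
  have a := hasDerivAt_form (σ := σ) hXd hXd
  have b : HasDerivAt (fun s : ℝ => form σ (X (p + s • d)) (X (p + s • d))) 0 0 := by
    refine (hasDerivAt_const (0 : ℝ) (1 : ℝ)).congr_of_eventuallyEq ?_
    have t : Tendsto (fun s : ℝ => p + s • d) (𝓝 0) (𝓝 p) := by
      have : Continuous (fun s : ℝ => p + s • d) := by fun_prop
      simpa using this.tendsto 0
    filter_upwards [t.eventually (unitSquare_mem_nhds hp)] with s hs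
    exact hM.form_self _ (hXM _ hs)
  have := a.unique b
  simp only [zero_smul, add_zero] at this
  rw [form_comm σ (partialDeriv X d p)] at this
  linarith

/-- Partial derivatives of the coefficients of the 1-form `k(gap) vol(X, dX, y, w)`. -/
theorem differentiableAt_and_fderiv_coefficient {σ κ' : ℝ} {k : ℝ → ℝ} {y w : R4} {p : ℝ × ℝ}
    (hp : p ∈ openSquare) (hk : HasDerivAt k κ' (gap σ (X p) y)) (d d' : ℝ × ℝ) :
    DifferentiableAt ℝ (fun p => k (gap σ (X p) y) * vol (X p) (partialDeriv X d' p) y w) p ∧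
    fderiv ℝ (fun p => k (gap σ (X p) y) * vol (X p) (partialDeriv X d' p) y w) p d =
      (κ' * (-σ * form σ (partialDeriv X d p) y)) * vol (X p) (partialDeriv X d' p) y w +
      k (gap σ (X p) y) * (vol (partialDeriv X d p) (partialDeriv X d' p) y w +
        vol (X p) (fderiv ℝ (partialDeriv X d') p d) y w) := by
  have dX := (hasFDerivAt_of_mem_openSquare hX hp).differentiableAt
  have dd : DifferentiableAt ℝ (partialDeriv X d') p :=
    ((contDiffOn_partialDeriv hX d').contDiffAt (unitSquare_mem_nhds hp)).differentiableAt (by simp)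
  have dg : DifferentiableAt ℝ (fun p => gap σ (X p) y) p :=
    DifferentiableAt.comp (g := fun q : R4 × R4 => gap σ q.1 q.2) (f := fun p => (X p, y)) p
      ((contDiff_gap σ).differentiable (by simp) _) (dX.prodMk (differentiableAt_const y))
  have dk : DifferentiableAt ℝ (fun p => k (gap σ (X p) y)) p :=
    DifferentiableAt.comp (g := k) (f := fun p => gap σ (X p) y) p hk.differentiableAt dg
  have dv : DifferentiableAt ℝ (fun p => vol (X p) (partialDeriv X d' p) y w) p :=
    DifferentiableAt.comp (g := fun q : R4 × R4 × R4 × R4 => vol q.1 q.2.1 q.2.2.1 q.2.2.2)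
      (f := fun p => (X p, partialDeriv X d' p, y, w)) p (contDiff_vol.differentiable (by simp) _)
      (dX.prodMk (dd.prodMk ((differentiableAt_const y).prodMk (differentiableAt_const w))))
  refine ⟨dk.mul dv, ?_⟩
  have hXd := hasDerivAt_line_of_mem_openSquare hX hp d
  have hdd : HasDerivAt (fun s : ℝ => partialDeriv X d' (p + s • d))
    (fderiv ℝ (partialDeriv X d') p d) 0 := dd.hasFDerivAt.hasLineDerivAt d
  have hc := hasDerivAt_const (0 : ℝ) y
  have hcw := hasDerivAt_const (0 : ℝ) w
  have hgap := hasDerivAt_gap (σ := σ) hXd hc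
  have p0 : p + (0 : ℝ) • d = p := by simp
  have hh1 : HasDerivAt (fun s : ℝ => k (gap σ (X (p + s • d)) y)) _ 0 :=
    HasDerivAt.comp (h₂ := k) (h₂' := κ') (0 : ℝ) (by rw [p0]; exact hk) hgap
  have hv := hasDerivAt_vol hXd hdd hc hcw
  have tot : HasDerivAt (fun s : ℝ => k (gap σ (X (p + s • d)) y) *
    vol (X (p + s • d)) (partialDeriv X d' (p + s • d)) y w) _ 0 := hh1.mul hv
  have fd : HasDerivAt (fun s : ℝ => k (gap σ (X (p + s • d)) y) *
    vol (X (p + s • d)) (partialDeriv X d' (p + s • d)) y w) _ 0 :=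
    (dk.mul dv).hasFDerivAt.hasLineDerivAt d
  refine (fd.unique tot).trans ?_
  have z1 : ∀ a b : R4, vol a b 0 w = 0 := fun a b => by simp [vol_eq]
  have z2 : ∀ a b : R4, vol a b y 0 = 0 := fun a b => by simp [vol_eq]
  have z3 : ∀ a : R4, form σ a 0 = 0 := fun a => by simp [form]
  simp only [p0, z1, z2, z3]
  ring

end

section
variable {E : Type*} [TopologicalSpace E] {s : Set E} {a b u v w : E → R4} {σ lam : ℝ}
  {h h1 h2 : ℝ → ℝ}

theorem IsLinkingKernel.continuousOn_crossingDensity_gap (hk : IsLinkingKernel σ lam h h1 h2)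
    {e : ℝ} (ha : ContinuousOn a s) (hb : ContinuousOn b s)
    (pos : ∀ p ∈ s, 0 < gap σ (a p) (b p) + e) :
    ContinuousOn (fun p => crossingDensity σ h1 h2 e (gap σ (a p) (b p))) s :=
  hk.continuousOn_crossingDensity.comp (f := fun p => (e, gap σ (a p) (b p)))
    (continuousOn_const.prodMk (continuousOn_gap ha hb)) pos

theorem IsLinkingKernel.continuousOn_completionDeriv (hk : IsLinkingKernel σ lam h h1 h2)
    {e : ℝ} (ha : ContinuousOn a s) (hu : ContinuousOn u s) (hv : ContinuousOn v s)
    (hb : ContinuousOn b s) (hw : ContinuousOn w s)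
    (pos : ∀ p ∈ s, 0 < gap σ (a p) (b p) + e) :
    ContinuousOn (fun p => completionDeriv σ h h1 h2 e (a p) (u p) (v p) (b p) (w p)) s := by
  have cg := continuousOn_gap (σ := σ) ha hb
  have cge := cg.add (continuousOn_const (c := e))
  have c1 := hk.continuousOn_deriv.comp cge pos
  have c0 := hk.continuousOn_self.comp cge pos
  have c2 := hk.continuousOn.comp cge pos
  have cz := (continuousOn_const (c := (1 : ℝ))).sub ((continuousOn_const (c := σ)).mul cg)
  exact (((cz.mul c2).sub ((continuousOn_const (c := 2 * σ)).mul c1)).mul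
    ((continuousOn_const (c := -σ)).mul (continuousOn_form (σ := σ) ha hw))).mul
    (continuousOn_vol ha hu hv hb) |>.add
    (((cz.mul c1).sub ((continuousOn_const (c := σ)).mul c0)).mul (continuousOn_vol ha hu hv hw))

end

end LinkingIntegral

/-! ### Stokes' theorem for the regularized form -/

namespace LinkingIntegral
open Set Filter Topology MeasureTheory Asymptotics

section
variable {σ lam : ℝ} {h h1 h2 : ℝ → ℝ} {M : Set R4} {X : ℝ × ℝ → R4}

/-- Stokes' theorem on a smooth square. -/
theorem sum_lineInt_squareEdge (hk : IsLinkingKernel σ lam h h1 h2) (hM : IsSpaceForm σ M)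
    (hX : ContDiffOn ℝ ∞ X unitSquare) (hXM : ∀ p ∈ unitSquare, X p ∈ M) {e : ℝ} (he : 0 < e)
    {y w : R4} (hy : y ∈ M) (hw : form σ y w = 0) :
    ∑ k, lineInt σ (fun z => -h1 (z + e)) (fun s => X (squareEdge k s)) y w =
      ∫ p in unitSquare,
        (completionDeriv σ h h1 h2 e (X p) (partialDeriv X (1, 0) p) (partialDeriv X (0, 1) p) y w
        + crossingDensity σ h1 h2 e (gap σ (X p) y) *
          vol (X p) (partialDeriv X (1, 0) p) (partialDeriv X (0, 1) p) w) := by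
  set Xu := partialDeriv X (1, 0)
  set Xv := partialDeriv X (0, 1)
  have cX := hX.continuousOn
  have cu : ContinuousOn Xu unitSquare := (contDiffOn_partialDeriv hX _).continuousOn
  have cv : ContinuousOn Xv unitSquare := (contDiffOn_partialDeriv hX _).continuousOn
  have cy : ContinuousOn (fun _ : ℝ × ℝ => y) unitSquare := continuousOn_const
  have cw : ContinuousOn (fun _ : ℝ × ℝ => w) unitSquare := continuousOn_const
  have cg : ContinuousOn (fun p => gap σ (X p) y) unitSquare := continuousOn_gap cX cy
  have gpos : ∀ p ∈ unitSquare, 0 < gap σ (X p) y + e := fun p hp => by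
    have := hM.gap_nonneg (hXM p hp) hy
    positivity
  have c1 : ContinuousOn (fun p => h1 (gap σ (X p) y + e)) unitSquare :=
    hk.continuousOn_deriv.comp (cg.add continuousOn_const) gpos
  -- The pulled back 1-form is f₁ du + f dv; with g = -f₁ its exterior derivative is the divergence
  -- of (f, g).
  set f : ℝ × ℝ → ℝ := fun p => -h1 (gap σ (X p) y + e) * vol (X p) (Xv p) y w with hf
  set f₁ : ℝ × ℝ → ℝ := fun p => -h1 (gap σ (X p) y + e) * vol (X p) (Xu p) y w with hf₁
  set g : ℝ × ℝ → ℝ := fun p => -f₁ p with hg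
  have cf : ContinuousOn f unitSquare := c1.neg.mul (continuousOn_vol cX cv cy cw)
  have cgg : ContinuousOn g unitSquare := (c1.neg.mul (continuousOn_vol cX cu cy cw)).neg
  have coef : ∀ p ∈ openSquare, ∀ d d', _ := fun p hp d d' =>
    differentiableAt_and_fderiv_coefficient hX hp (κ' := -h2 (gap σ (X p) y + e))
      (k := fun z => -h1 (z + e)) (σ := σ) (y := y) (w := w) (by
        have := (hk.hasDerivAt_deriv _ (gpos p (openSquare_subset hp))).comp_add_const _ e
        exact this.neg) d d'
  have df : ∀ p ∈ openSquare, DifferentiableAt ℝ f p := fun p hp => (coef p hp (1, 0) (0, 1)).1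
  have dg : ∀ p ∈ openSquare, DifferentiableAt ℝ g p := fun p hp =>
    (coef p hp (0, 1) (1, 0)).1.neg
  have div : ∀ p ∈ openSquare, fderiv ℝ f p (1, 0) + fderiv ℝ g p (0, 1) =
      completionDeriv σ h h1 h2 e (X p) (Xu p) (Xv p) y w
        + crossingDensity σ h1 h2 e (gap σ (X p) y) * vol (X p) (Xu p) (Xv p) w := by
    intro p hp
    have pM := hXM p (openSquare_subset hp)
    have tang := form_partialDeriv_eq_zero hX hM hXM hp
    have id := divergence_identity (e := e) hM.sq (hM.form_self _ pM) (hM.form_self _ hy)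
      (tang (1, 0)) (tang (0, 1)) hw (hk.ode _ (gpos p (openSquare_subset hp)))
    have e1 : fderiv ℝ f p (1, 0) = _ := (coef p hp (1, 0) (0, 1)).2
    have e2 : fderiv ℝ f₁ p (0, 1) = _ := (coef p hp (0, 1) (1, 0)).2
    have e3 : fderiv ℝ g p (0, 1) = -fderiv ℝ f₁ p (0, 1) := by
      rw [hg, fderiv_fun_neg]; rfl
    have sw : vol (partialDeriv X (0, 1) p) (partialDeriv X (1, 0) p) y w =
        -vol (partialDeriv X (1, 0) p) (partialDeriv X (0, 1) p) y w := by
      simp only [vol_eq]; ring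
    -- The mixed second derivatives cancel, while the two volumes without X agree up to the sign in
    -- `sw` and add up to the term with factor 2.
    rw [e3, e2, e1, fderiv_partialDeriv_comm hX hp (0, 1) (1, 0), completionDeriv,
      crossingDensity, sw]
    linear_combination id
  set B : ℝ × ℝ → ℝ := fun p => completionDeriv σ h h1 h2 e (X p) (Xu p) (Xv p) y w
        + crossingDensity σ h1 h2 e (gap σ (X p) y) * vol (X p) (Xu p) (Xv p) w with hB
  have cB : ContinuousOn B unitSquare := by
    exact (hk.continuousOn_completionDeriv cX cu cv cy cw gpos).add
      ((hk.continuousOn_crossingDensity_gap cX cy gpos).mul (continuousOn_vol cX cu cv cw))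
  have ae_open : ∀ᵐ p : ℝ × ℝ, p ∈ unitSquare → p ∈ openSquare := by
    have : (openSquare : Set (ℝ × ℝ)) =ᵐ[volume] unitSquare := by
      rw [Measure.volume_eq_prod]
      exact Measure.set_prod_ae_eq Ioo_ae_eq_Icc Ioo_ae_eq_Icc
    filter_upwards [this] with p hp hp2
    exact hp.mpr hp2
  have int_eq : ∫ p in unitSquare, B p =
      ∫ p in Icc ((0 : ℝ), (0 : ℝ)) (1, 1), (fderiv ℝ f p (1, 0) + fderiv ℝ g p (0, 1)) := by
    rw [← unitSquare_eq_Icc]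
    refine setIntegral_congr_ae (unitSquare_eq_Icc ▸ measurableSet_Icc) ?_
    filter_upwards [ae_open] with p hp hp2
    exact (div p (hp hp2)).symm
  have stokes := integral_divergence_prod_Icc_of_hasFDerivAt_of_le f g (fderiv ℝ f) (fderiv ℝ g)
    ((0 : ℝ), (0 : ℝ)) (1, 1) (by constructor <;> simp) (unitSquare_eq_Icc ▸ cf)
    (unitSquare_eq_Icc ▸ cgg) (fun p hp => (df p hp).hasFDerivAt)
    (fun p hp => (dg p hp).hasFDerivAt) (by
      rw [← unitSquare_eq_Icc]
      refine (cB.integrableOn_compact isCompact_unitSquare).congr_fun_ae ?_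
      rw [EventuallyEq, ae_restrict_iff' (unitSquare_eq_Icc ▸ measurableSet_Icc)]
      filter_upwards [ae_open] with p hp hp2
      exact (div p (hp hp2)).symm)
  rw [int_eq, stokes]
  have edge : ∀ k : Fin 4, lineInt σ (fun z => -h1 (z + e)) (fun s => X (squareEdge k s)) y w =
      ∫ s in (0 : ℝ)..1, -h1 (gap σ (X (squareEdge k s)) y + e) * vol (X (squareEdge k s))
        (partialDeriv X (![((1 : ℝ), (0 : ℝ)), (0, 1), (-1, 0), (0, -1)] k) (squareEdge k s)) y w := by
    intro k
    refine intervalIntegral.integral_congr_ae ?_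
    have : ∀ᵐ s : ℝ, s ≠ 1 := by simp [ae_iff, measure_singleton]
    filter_upwards [this] with s hs hs2
    rw [uIoc_of_le zero_le_one] at hs2
    rw [(hasDerivAt_comp_squareEdge hX k ⟨hs2.1, lt_of_le_of_ne hs2.2 hs⟩).deriv]
  have neg : ∀ d p, partialDeriv X (-d) p = -partialDeriv X d p := fun d p => by
    simp [partialDeriv]
  rw [Fin.sum_univ_four, edge, edge, edge, edge]
  have n2 : ((-1 : ℝ), (0 : ℝ)) = -(1, 0) := by simp
  have n3 : ((0 : ℝ), (-1 : ℝ)) = -(0, 1) := by simp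
  have s0 : (∫ s in (0 : ℝ)..1, -h1 (gap σ (X (squareEdge 0 s)) y + e) * vol (X (squareEdge 0 s))
        (partialDeriv X (![((1 : ℝ), (0 : ℝ)), (0, 1), (-1, 0), (0, -1)] 0) (squareEdge 0 s)) y w) =
      -∫ s in (0 : ℝ)..1, g (s, 0) := by
    rw [← intervalIntegral.integral_neg]
    simp [hg, hf₁, squareEdge, Xu]
  have s1 : (∫ s in (0 : ℝ)..1, -h1 (gap σ (X (squareEdge 1 s)) y + e) * vol (X (squareEdge 1 s))
        (partialDeriv X (![((1 : ℝ), (0 : ℝ)), (0, 1), (-1, 0), (0, -1)] 1) (squareEdge 1 s)) y w) =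
      ∫ s in (0 : ℝ)..1, f (1, s) := by
    simp [hf, squareEdge, Xv]
  -- Edges 2 and 3 run backwards: s ↦ 1 - s preserves the integral, and the reversed direction
  -- supplies the sign.
  have s2 : (∫ s in (0 : ℝ)..1, -h1 (gap σ (X (squareEdge 2 s)) y + e) * vol (X (squareEdge 2 s))
        (partialDeriv X (![((1 : ℝ), (0 : ℝ)), (0, 1), (-1, 0), (0, -1)] 2) (squareEdge 2 s)) y w) =
      ∫ s in (0 : ℝ)..1, g (s, 1) := by
    have := intervalIntegral.integral_comp_sub_left (a := 0) (b := 1) (fun s => g (s, 1)) 1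
    simp only [sub_self, sub_zero] at this
    rw [← this]
    simp only [squareEdge, Matrix.cons_val, n2, neg, vol_neg_second, hg, hf₁, Xu, mul_neg]
  have s3 : (∫ s in (0 : ℝ)..1, -h1 (gap σ (X (squareEdge 3 s)) y + e) * vol (X (squareEdge 3 s))
        (partialDeriv X (![((1 : ℝ), (0 : ℝ)), (0, 1), (-1, 0), (0, -1)] 3) (squareEdge 3 s)) y w) =
      -∫ s in (0 : ℝ)..1, f (0, s) := by
    have := intervalIntegral.integral_comp_sub_left (a := 0) (b := 1) (fun s => f (0, s)) 1
    simp only [sub_self, sub_zero] at this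
    rw [← this, ← intervalIntegral.integral_neg]
    simp only [squareEdge, Matrix.cons_val, n3, neg, vol_neg_second, hf, Xv, mul_neg]
  rw [s0, s1, s2, s3]
  ring

end

end LinkingIntegral

/-! ### Concentration at finitely many crossings -/

namespace LinkingIntegral
open Set Filter Topology MeasureTheory Asymptotics

/-- A continuous function on a compact set with isolated zeros has finitely many of them. -/
theorem finite_zeros_of_isolated {E : Type*} [TopologicalSpace E] [T2Space E] {K : Set E}
    (hK : IsCompact K) {z : E → ℝ} (hz : ContinuousOn z K)
    (iso : ∀ q ∈ K, z q = 0 → ∀ᶠ p in 𝓝[≠] q, z p ≠ 0) : {p ∈ K | z p = 0}.Finite := by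
  by_contra hinf
  obtain ⟨x, hx, hacc⟩ := Set.Infinite.exists_accPt_of_subset_isCompact hinf hK (sep_subset _ _)
  have hc : IsClosed {p ∈ K | z p = 0} := by
    have := hz.preimage_isClosed_of_isClosed hK.isClosed (isClosed_singleton (x := (0 : ℝ)))
    exact this
  have hx0 : z x = 0 := (hc.closure_subset (mem_closure_iff_frequently.mpr
    ((accPt_iff_frequently.mp hacc).mono fun y hy => hy.2))).2
  obtain ⟨y, hy1, hy2⟩ := ((accPt_iff_frequently_nhdsNE.mp hacc).and_eventually
    (iso x hx hx0)).exists
  exact hy2 hy1.2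

section
variable {E : Type*} [NormedAddCommGroup E] [MeasurableSpace E] [BorelSpace E] {μ : Measure E}
  [IsFiniteMeasureOnCompacts μ] {σ lam : ℝ} {h h1 h2 : ℝ → ℝ}

/-- Away from the crossings the density tends to zero. -/
theorem IsLinkingKernel.tendsto_integral_crossingDensity_zero
    (hk : IsLinkingKernel σ lam h h1 h2) {K : Set E} (hK : IsCompact K) {z D : E → ℝ}
    (hz : ContinuousOn z K) (hD : ContinuousOn D K) (pos : ∀ p ∈ K, 0 < z p) :
    Tendsto (fun e => ∫ p in K, crossingDensity σ h1 h2 e (z p) * D p ∂μ) (𝓝[>] 0) (𝓝 0) := by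
  -- Since the gap is positive on K, e = 0 is allowed: compactness of [0, 1] × K gives a uniform
  -- bound, and the factor e makes the density vanish at e = 0.
  have cont : ContinuousOn (fun x : ℝ × E => crossingDensity σ h1 h2 x.1 (z x.2) * D x.2)
      (Icc 0 1 ×ˢ K) := by
    have hz2 : ContinuousOn (fun x : ℝ × E => z x.2) (Icc (0 : ℝ) 1 ×ˢ K) :=
      hz.comp continuousOn_snd fun x hx => hx.2
    have hD2 : ContinuousOn (fun x : ℝ × E => D x.2) (Icc (0 : ℝ) 1 ×ˢ K) :=
      hD.comp continuousOn_snd fun x hx => hx.2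
    refine ContinuousOn.mul ?_ hD2
    exact hk.continuousOn_crossingDensity.comp (f := fun x : ℝ × E => (x.1, z x.2))
      (continuousOn_fst.prodMk hz2) fun x hx => add_pos_of_pos_of_nonneg (pos _ hx.2) hx.1.1
  obtain ⟨C, hC⟩ := (isCompact_Icc.prod hK).exists_bound_of_continuousOn cont
  have ev : ∀ᶠ e : ℝ in 𝓝[>] 0, e ∈ Icc (0 : ℝ) 1 := by
    filter_upwards [Ioo_mem_nhdsGT one_pos] with e he using Ioo_subset_Icc_self he
  have : Tendsto (fun e => ∫ p in K, crossingDensity σ h1 h2 e (z p) * D p ∂μ) (𝓝[>] 0)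
      (𝓝 (∫ p in K, (0 : ℝ) ∂μ)) := by
    refine tendsto_integral_filter_of_dominated_convergence (fun _ => C) ?_ ?_ ?_ ?_
    · filter_upwards [ev] with e he
      refine ContinuousOn.aestronglyMeasurable_of_isCompact ?_ hK hK.measurableSet
      exact cont.comp (f := fun p => (e, p)) (by fun_prop) fun p hp => ⟨he, hp⟩
    · filter_upwards [ev] with e he
      filter_upwards [ae_restrict_mem hK.measurableSet] with p hp using hC (e, p) ⟨he, hp⟩
    · exact integrableOn_const hK.measure_lt_top.ne
    · filter_upwards [ae_restrict_mem hK.measurableSet] with p hp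
      have c := (hk.continuousOn_crossingDensity.continuousAt (x := (0, z p)) (by
        refine IsOpen.mem_nhds ?_ (by simpa using pos p hp)
        exact isOpen_lt continuous_const (by fun_prop)))
      have t : Tendsto (fun e : ℝ => (e, z p)) (𝓝[>] 0) (𝓝 (0, z p)) :=
        ((continuous_id.prodMk continuous_const).tendsto' 0 (0, z p) rfl).mono_left
          nhdsWithin_le_nhds
      have := (c.tendsto.comp t).mul_const (D p)
      simpa [crossingDensity] using this
  simpa using this

/-- The integral of the density concentrates at the finitely many zeros of the gap. -/
theorem IsLinkingKernel.tendsto_integral_crossingDensity_sum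
    (hk : IsLinkingKernel σ lam h h1 h2) {K : Set E} (hK : IsCompact K) {z D : E → ℝ}
    (hz : ContinuousOn z K) (hD : ContinuousOn D K) (nonneg : ∀ p ∈ K, 0 ≤ z p) {Z : Set E}
    (hZ : Z.Finite) (hZK : Z ⊆ interior K) (hzero : ∀ p ∈ K, z p = 0 → p ∈ Z) {c : E → ℝ}
    (loc : ∀ q ∈ Z, ∃ V ∈ 𝓝 q, ∀ U ⊆ V, IsOpen U → q ∈ U →
      Tendsto (fun e => ∫ p in U, crossingDensity σ h1 h2 e (z p) * D p ∂μ) (𝓝[>] 0)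
        (𝓝 (c q))) :
    Tendsto (fun e => ∫ p in K, crossingDensity σ h1 h2 e (z p) * D p ∂μ) (𝓝[>] 0)
      (𝓝 (∑ q ∈ hZ.toFinset, c q)) := by
  choose! V hV hVU using loc
  obtain ⟨W, hW, hdisj⟩ := hZ.t2_separation
  -- Disjoint neighbourhoods of the zeros, each small enough for its local limit; on the compact
  -- remainder of K the gap is positive.
  set U : E → Set E := fun q => W q ∩ (interior (V q) ∩ interior K) with hU
  have Uo : ∀ q, IsOpen (U q) := fun q =>
    (hW q).2.inter (isOpen_interior.inter isOpen_interior)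
  have Uq : ∀ q ∈ Z, q ∈ U q := fun q hq =>
    ⟨(hW q).1, mem_interior_iff_mem_nhds.mpr (hV q hq), hZK hq⟩
  have UK : ∀ q, U q ⊆ K := fun q => inter_subset_right.trans
    (inter_subset_right.trans interior_subset)
  set A := ⋃ q ∈ hZ.toFinset, U q with hA
  have Ao : IsOpen A := isOpen_biUnion fun q _ => Uo q
  have AK : A ⊆ K := iUnion₂_subset fun q _ => UK q
  have hKA : IsCompact (K \ A) := hK.diff Ao
  have rest := hk.tendsto_integral_crossingDensity_zero (μ := μ) hKA (hz.mono sdiff_subset)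
    (hD.mono sdiff_subset) (fun p hp => lt_of_le_of_ne (nonneg p hp.1) fun h0 => hp.2 <| by
      have pz := hzero p hp.1 h0.symm
      exact mem_iUnion₂.mpr ⟨p, hZ.mem_toFinset.mpr pz, Uq p pz⟩)
  have parts := tendsto_finsetSum hZ.toFinset fun q hq =>
    hVU q (hZ.mem_toFinset.mp hq) (U q) (inter_subset_right.trans
      (inter_subset_left.trans interior_subset)) (Uo q) (Uq q (hZ.mem_toFinset.mp hq))
  have tot := rest.add parts
  rw [zero_add] at tot
  refine tot.congr' ?_
  filter_upwards [self_mem_nhdsWithin] with e he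
  have he : 0 < e := he
  have ci : IntegrableOn (fun p => crossingDensity σ h1 h2 e (z p) * D p) K μ := by
    refine ContinuousOn.integrableOn_compact hK (ContinuousOn.mul ?_ hD)
    refine hk.continuousOn_crossingDensity.comp (f := fun p => (e, z p))
      (continuousOn_const.prodMk hz) fun p hp => ?_
    have := nonneg p hp
    change 0 < z p + e
    positivity
  rw [← integral_biUnion_finset hZ.toFinset (fun q _ => (Uo q).measurableSet)
    (fun q hq q' hq' hne => ((hdisj (by simpa using hq) (by simpa using hq') hne).mono
      inter_subset_left inter_subset_left)) (fun q _ => ci.mono_set (UK q)), ← hA,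
    ← setIntegral_union disjoint_sdiff_left Ao.measurableSet (ci.mono_set sdiff_subset)
      (ci.mono_set AK), sdiff_union_of_subset AK]

end

theorem form_isBigO {E : Type*} {l : Filter E} {σ : ℝ} {f g : E → R4} :
    (fun p => form σ (f p) (g p)) =O[l] fun p => ‖f p‖ * ‖g p‖ := by
  refine IsBigO.of_bound (1 + 3 * |σ|) (Eventually.of_forall fun p => ?_)
  have b : ∀ i, |f p i * g p i| ≤ ‖f p‖ * ‖g p‖ := fun i => by
    rw [abs_mul]
    exact mul_le_mul (norm_le_pi_norm (f p) i) (norm_le_pi_norm (g p) i) (abs_nonneg _)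
      (norm_nonneg _)
  have h3 : |f p 1 * g p 1 + f p 2 * g p 2 + f p 3 * g p 3| ≤ 3 * (‖f p‖ * ‖g p‖) := by
    refine (abs_add_three _ _ _).trans ?_
    linarith [b 1, b 2, b 3]
  rw [Real.norm_eq_abs, norm_mul, norm_norm, norm_norm, form]
  refine (abs_add_le _ _).trans ?_
  rw [abs_mul σ]
  have := mul_le_mul_of_nonneg_left h3 (abs_nonneg σ)
  linarith [b 0]

/-- The gap between two points depending smoothly on parameters, near a coincidence. -/
theorem form_self_sub_isLittleO {E : Type*} [NormedAddCommGroup E] [NormedSpace ℝ E] {σ : ℝ}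
    {G : E → R4} {L : E →L[ℝ] R4} {q : E} (hG : HasFDerivAt G L q) (h0 : G q = 0) :
    (fun p => form σ (G (q + p)) (G (q + p)) - form σ (L p) (L p)) =o[𝓝 0] fun p => ‖p‖ ^ 2 := by
  have hR : (fun p => G (q + p) - L p) =o[𝓝 0] fun p => p := by
    have := hasFDerivAt_iff_isLittleO_nhds_zero.mp hG
    simpa [h0] using this
  have hL : (fun p => L p) =O[𝓝 0] fun p => p := L.isBigO_id _
  -- With R = G(q + p) - Lp = o(p), the difference is 2⟨Lp, R⟩ + ⟨R, R⟩.
  have e : (fun p => form σ (G (q + p)) (G (q + p)) - form σ (L p) (L p)) =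
      fun p => 2 * form σ (L p) (G (q + p) - L p) + form σ (G (q + p) - L p) (G (q + p) - L p) := by
    funext p
    simp only [form_sub_left, form_sub_right, form_comm σ (L p) (G (q + p))]
    ring
  have sq : (fun p : E => ‖p‖ ^ 2) = fun p => ‖p‖ * ‖p‖ := by funext p; ring
  rw [e, sq]
  refine IsLittleO.add (IsLittleO.const_mul_left ?_ 2) ?_
  · exact form_isBigO.trans_isLittleO (hL.norm_norm.mul_isLittleO hR.norm_norm)
  · exact form_isBigO.trans_isLittleO (hR.norm_norm.mul hR.norm_norm)

instance : (volume : Measure (ℝ × ℝ)).IsAddHaarMeasure :=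
  Measure.prod.instIsAddHaarMeasure (volume : Measure ℝ) (volume : Measure ℝ)

instance : (volume : Measure ((ℝ × ℝ) × ℝ)).IsAddHaarMeasure :=
  Measure.prod.instIsAddHaarMeasure (volume : Measure (ℝ × ℝ)) (volume : Measure ℝ)

section
variable {σ lam : ℝ} {h h1 h2 : ℝ → ℝ} {M : Set R4} {X : ℝ × ℝ → R4}

/-- The volume form on the tangent plane of a square and the tangent of a curve. -/
noncomputable def squareVol (X : ℝ × ℝ → R4) (Y : ℝ → R4) (q : (ℝ × ℝ) × ℝ) : ℝ :=
  vol (X q.1) (partialDeriv X (1, 0) q.1) (partialDeriv X (0, 1) q.1) (deriv Y q.2)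

theorem ClosedCurve.hasDerivAt {M : Set R4} (K : ClosedCurve M) (t : ℝ) :
    HasDerivAt K.toFun (deriv K.toFun t) t :=
  (K.smooth.differentiable (by simp) t).hasDerivAt

theorem ClosedCurve.continuous_deriv {M : Set R4} (K : ClosedCurve M) :
    Continuous (deriv K.toFun) := K.smooth.continuous_deriv (by simp)

theorem ClosedCurve.form_deriv_eq_zero {M : Set R4} (hM : IsSpaceForm σ M) (K : ClosedCurve M)
    (t : ℝ) : form σ (K.toFun t) (deriv K.toFun t) = 0 := by
  have d := K.hasDerivAt t
  have a := hasDerivAt_form (σ := σ) d d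
  have b : HasDerivAt (fun s : ℝ => form σ (K.toFun s) (K.toFun s)) 0 t := by
    simp only [hM.form_self _ (K.mem _)]
    exact hasDerivAt_const t 1
  have := a.unique b
  rw [form_comm σ (deriv K.toFun t)] at this
  linarith

theorem ClosedCurve.deriv_periodic {M : Set R4} (K : ClosedCurve M) :
    Function.Periodic (deriv K.toFun) K.period := fun t => by
  rw [← deriv_comp_add_const, (funext K.periodic : (fun s => K.toFun (s + K.period)) = K.toFun)]

/-- The local contribution of a transverse crossing, and the isolation of crossings. -/
theorem IsLinkingKernel.crossing_contribution (hk : IsLinkingKernel σ lam h h1 h2)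
    (hM : IsSpaceForm σ M) (hX : ContDiffOn ℝ ∞ X unitSquare) (hXM : ∀ p ∈ unitSquare, X p ∈ M)
    (K : ClosedCurve M) {q : (ℝ × ℝ) × ℝ} (hq : q.1 ∈ openSquare) (h0 : X q.1 = K.toFun q.2)
    (tr : squareVol X K.toFun q ≠ 0) :
    (∀ᶠ p in 𝓝[≠] q, gap σ (X p.1) (K.toFun p.2) ≠ 0) ∧
    ∃ V ∈ 𝓝 q, ∀ U ⊆ V, IsOpen U → q ∈ U →
      Tendsto (fun e => ∫ p in U, crossingDensity σ h1 h2 e (gap σ (X p.1) (K.toFun p.2)) *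
        squareVol X K.toFun p) (𝓝[>] 0)
        (𝓝 (4 * Real.pi * lam * (SignType.sign (squareVol X K.toFun q) : ℝ))) := by
  set Xu := partialDeriv X (1, 0)
  set Xv := partialDeriv X (0, 1)
  set w := deriv K.toFun q.2 with hw
  have near : ∀ᶠ p : (ℝ × ℝ) × ℝ in 𝓝 q, p.1 ∈ openSquare :=
    continuousAt_fst.eventually (isOpen_openSquare.mem_nhds hq)
  have dG : HasFDerivAt (fun p : (ℝ × ℝ) × ℝ => X p.1 - K.toFun p.2)
      ((fderivWithin ℝ X unitSquare q.1).comp (ContinuousLinearMap.fst ℝ (ℝ × ℝ) ℝ) -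
        ((ContinuousLinearMap.toSpanSingleton ℝ w).comp (ContinuousLinearMap.snd ℝ (ℝ × ℝ) ℝ))) q :=
    ((hasFDerivAt_of_mem_openSquare hX hq).comp q hasFDerivAt_fst).sub
      ((K.hasDerivAt q.2).hasFDerivAt.comp q hasFDerivAt_snd)
  set L := (fderivWithin ℝ X unitSquare q.1).comp (ContinuousLinearMap.fst ℝ (ℝ × ℝ) ℝ) -
        ((ContinuousLinearMap.toSpanSingleton ℝ w).comp (ContinuousLinearMap.snd ℝ (ℝ × ℝ) ℝ))
    with hL
  -- The chord is the surface point minus the curve point, hence the third vector -w; its sign is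
  -- harmless, as only the absolute volume enters the model integral.
  have Lp : ∀ p : (ℝ × ℝ) × ℝ, L p = p.1.1 • Xu q.1 + p.1.2 • Xv q.1 + p.2 • (-w) := by
    intro p
    have : p.1 = p.1.1 • ((1 : ℝ), (0 : ℝ)) + p.1.2 • ((0 : ℝ), (1 : ℝ)) := by
      ext <;> simp
    simp only [hL, sub_apply, ContinuousLinearMap.comp_apply,
      ContinuousLinearMap.coe_fst', ContinuousLinearMap.coe_snd',
      ContinuousLinearMap.toSpanSingleton_apply]
    conv_lhs => rw [this]
    simp only [map_add, map_smul, Xu, Xv, partialDeriv]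
    module
  set z : (ℝ × ℝ) × ℝ → ℝ := fun p => gap σ (X p.1) (K.toFun p.2) with hz
  set Q : (ℝ × ℝ) × ℝ → ℝ := fun p => 1 / 2 * (σ * form σ (L p) (L p)) with hQ
  have zQ : (fun p => z (q + p) - Q p) =o[𝓝 0] fun p => ‖p‖ ^ 2 := by
    have := (form_self_sub_isLittleO (σ := σ) dG (by simp [h0])).const_mul_left (1 / 2 * σ)
    refine this.congr' ?_ EventuallyEq.rfl
    have t : Tendsto (fun p => q + p) (𝓝 0) (𝓝 q) := by
      simpa using (continuous_const_add q).tendsto 0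
    filter_upwards [t.eventually near] with p hp
    simp only [hz, hQ]
    rw [hM.gap_eq (hXM _ (openSquare_subset hp)) (K.mem _)]
    ring
  have qM : X q.1 ∈ M := hXM _ (openSquare_subset hq)
  have ta := form_partialDeriv_eq_zero hX hM hXM hq
  have tw : form σ (X q.1) (-w) = 0 := by
    have : -w = (-1 : ℝ) • w := by simp
    rw [this, form_smul_right, h0, hw, K.form_deriv_eq_zero hM, mul_zero]
  have vw : vol (X q.1) (Xu q.1) (Xv q.1) (-w) = -squareVol X K.toFun q := by
    simp only [squareVol, vol_eq, Pi.neg_apply, hw, Xu, Xv]; ring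
  obtain ⟨Qpos, Qint⟩ := integral_inv_powFiveHalves_form hM qM (ta (1, 0)) (ta (0, 1)) tw
    (by rw [vw]; exact neg_ne_zero.mpr tr)
  have Qpos' : ∀ p, p ≠ 0 → 0 < Q p := fun p hp => by
    have := Qpos p hp
    simp only [hQ, Lp]
    linarith
  have Qhom : ∀ (t : ℝ) p, Q (t • p) = t ^ 2 * Q p := fun t p => by
    simp only [hQ, map_smul, form_smul_left, form_smul_right]; ring
  have Qcont : Continuous Q := by
    have := (contDiff_form σ).continuous.comp (L.continuous.prodMk L.continuous)
    exact (this.const_mul σ).const_mul (1 / 2)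
  obtain ⟨a, ha, haQ⟩ := exists_pos_mul_norm_sq_le Qcont Qhom Qpos'
  have zc : ∀ᶠ p in 𝓝 q, ContinuousAt z p := by
    filter_upwards [near] with p hp
    have c1 : ContinuousAt (fun p : (ℝ × ℝ) × ℝ => X p.1) p :=
      ContinuousAt.comp (g := X) (f := Prod.fst)
        (hasFDerivAt_of_mem_openSquare hX hp).continuousAt continuousAt_fst
    have c2 : ContinuousAt (fun p : (ℝ × ℝ) × ℝ => K.toFun p.2) p :=
      (K.smooth.continuous.comp continuous_snd).continuousAt
    exact ContinuousAt.comp (g := fun q : R4 × R4 => gap σ q.1 q.2)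
      (f := fun p : (ℝ × ℝ) × ℝ => (X p.1, K.toFun p.2))
      (contDiff_gap σ).continuous.continuousAt (c1.prodMk c2)
  have Dc : ∀ᶠ p in 𝓝 q, ContinuousAt (squareVol X K.toFun) p := by
    filter_upwards [near] with p hp
    have cf : ∀ {F : ℝ × ℝ → R4}, ContDiffOn ℝ ∞ F unitSquare →
        ContinuousAt (fun p : (ℝ × ℝ) × ℝ => F p.1) p := fun {F} hF =>
      ContinuousAt.comp (g := F) (f := Prod.fst)
        (hasFDerivAt_of_mem_openSquare hF hp).continuousAt continuousAt_fst
    have c2 : ContinuousAt (fun p : (ℝ × ℝ) × ℝ => deriv K.toFun p.2) p :=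
      (K.continuous_deriv.comp continuous_snd).continuousAt
    exact ContinuousAt.comp (g := fun q : R4 × R4 × R4 × R4 => vol q.1 q.2.1 q.2.2.1 q.2.2.2)
      (f := fun p : (ℝ × ℝ) × ℝ => (X p.1, Xu p.1, Xv p.1, deriv K.toFun p.2))
      contDiff_vol.continuous.continuousAt ((cf hX).prodMk ((cf (contDiffOn_partialDeriv hX _)).prodMk
        ((cf (contDiffOn_partialDeriv hX _)).prodMk c2)))
  have zq : z q = 0 := by simp only [hz]; rw [h0]; exact hM.gap_self (K.mem _)
  refine ⟨?_, ?_⟩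
  · have ev := eventually_mul_norm_sq_le ha zQ haQ
    filter_upwards [ev.filter_mono nhdsWithin_le_nhds, self_mem_nhdsWithin] with p hp hne
    have : 0 < ‖p - q‖ := norm_pos_iff.mpr (sub_ne_zero.mpr hne)
    have : 0 < a / 2 * ‖p - q‖ ^ 2 := by positivity
    exact (this.trans_le hp).ne'
  · have main := hk.tendsto_integral_crossingDensity (volume : Measure ((ℝ × ℝ) × ℝ)) (by simp) ha
      zQ haQ Qhom zq zc Dc
    -- The constants combine as (3 lam / (2√2)) · 2√2 · (4π/3) = 4π lam, and the volume divided by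
    -- its absolute value is the sign.
    have val : 3 * lam / (2 * √2) * squareVol X K.toFun q * ∫ p, (powFiveHalves (1 + Q p))⁻¹ =
        4 * Real.pi * lam * (SignType.sign (squareVol X K.toFun q) : ℝ) := by
      simp only [hQ, Lp]
      rw [Qint, vw, abs_neg]
      have s2 : √2 ≠ 0 := by positivity
      rcases lt_or_gt_of_ne tr with hn | hp
      · rw [abs_of_neg hn, sign_neg hn]
        simp only [SignType.coe_neg_one]
        field_simp
      · rw [abs_of_pos hp, sign_pos hp]
        simp only [SignType.coe_one]
        field_simp
    rw [val] at main
    exact main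

end

end LinkingIntegral

/-! ### Stokes' theorem integrated over the second curve -/

namespace LinkingIntegral
open Set Filter Topology MeasureTheory Asymptotics

section
variable {σ lam : ℝ} {h h1 h2 : ℝ → ℝ} {M : Set R4} {X : ℝ × ℝ → R4}

theorem IsSpaceForm.eq_of_gap_eq_zero (hM : IsSpaceForm σ M) {x y : R4} (hx : x ∈ M) (hy : y ∈ M)
    (h : gap σ x y = 0) : x = y := by
  by_contra hne
  exact (hM.gap_pos x hx y hy hne).ne' h

/-- The completion form integrates to zero over one turn of a closed curve. -/
theorem IsLinkingKernel.integral_completionDeriv (hk : IsLinkingKernel σ lam h h1 h2)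
    (hM : IsSpaceForm σ M) (K : ClosedCurve M) {e : ℝ} (he : 0 < e) {a : R4} (ha : a ∈ M)
    (u v : R4) : ∫ t in (0 : ℝ)..K.period,
      completionDeriv σ h h1 h2 e a u v (K.toFun t) (deriv K.toFun t) = 0 := by
  have pos : ∀ t, 0 < gap σ a (K.toFun t) + e := fun t => by
    have := hM.gap_nonneg ha (K.mem t)
    positivity
  -- The integrand has a periodic primitive, which is defined even where the curve passes through a,
  -- thanks to the shift e.
  have ftc := intervalIntegral.integral_eq_sub_of_hasDerivAt (a := 0) (b := K.period)
    (f := fun t => ((1 - σ * gap σ a (K.toFun t)) * h1 (gap σ a (K.toFun t) + e)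
      - σ * h (gap σ a (K.toFun t) + e)) * vol a u v (K.toFun t))
    (f' := fun t => completionDeriv σ h h1 h2 e a u v (K.toFun t) (deriv K.toFun t)) ?_ ?_
  · rw [ftc]
    have := K.periodic 0
    rw [zero_add] at this
    simp only [this, sub_self]
  · intro t _
    have ca := hasDerivAt_const t a
    have dg := hasDerivAt_gap (σ := σ) ca (K.hasDerivAt t)
    have dge := dg.add_const e
    have dh1 := (hk.hasDerivAt_deriv _ (pos t)).comp t dge
    have dh := (hk.hasDerivAt _ (pos t)).comp t dge
    have dv := hasDerivAt_vol ca (hasDerivAt_const t u) (hasDerivAt_const t v) (K.hasDerivAt t)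
    refine (((((dg.const_mul σ).const_sub 1).mul dh1).sub (dh.const_mul σ)).mul dv).congr_deriv ?_
    have z1 : ∀ b c d : R4, vol 0 b c d = 0 := fun b c d => by simp [vol_eq]
    have z2 : ∀ b c d : R4, vol b 0 c d = 0 := fun b c d => by simp [vol_eq]
    have z3 : ∀ b c d : R4, vol b c 0 d = 0 := fun b c d => by simp [vol_eq]
    have z4 : ∀ b : R4, form σ 0 b = 0 := fun b => by simp [form]
    simp only [z1, z2, z3, z4, completionDeriv, Function.comp, Pi.mul_apply, Pi.sub_apply]
    ring
  · refine ContinuousOn.intervalIntegrable ?_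
    exact hk.continuousOn_completionDeriv continuousOn_const continuousOn_const continuousOn_const
      K.smooth.continuous.continuousOn K.continuous_deriv.continuousOn fun t _ => pos t

theorem measurableSet_unitSquare : MeasurableSet unitSquare :=
  measurableSet_Icc.prod measurableSet_Icc

/-- Stokes' theorem on a smooth square, integrated over one turn of a closed curve. The turn may
begin at any time `m - K.period`. -/
theorem IsLinkingKernel.integral_sum_lineInt (hk : IsLinkingKernel σ lam h h1 h2)
    (hM : IsSpaceForm σ M) (hX : ContDiffOn ℝ ∞ X unitSquare) (hXM : ∀ p ∈ unitSquare, X p ∈ M)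
    (K : ClosedCurve M) {e : ℝ} (he : 0 < e) (m : ℝ) :
    IntervalIntegrable (fun t => ∑ k, lineInt σ (fun z => -h1 (z + e))
      (fun s => X (squareEdge k s)) (K.toFun t) (deriv K.toFun t)) volume 0 K.period ∧
    ∫ t in (0 : ℝ)..K.period, ∑ k, lineInt σ (fun z => -h1 (z + e)) (fun s => X (squareEdge k s))
      (K.toFun t) (deriv K.toFun t) =
    ∫ p in unitSquare ×ˢ Icc (m - K.period) m,
      crossingDensity σ h1 h2 e (gap σ (X p.1) (K.toFun p.2)) * squareVol X K.toFun p := by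
  set T := K.period
  have hT : 0 < T := K.period_pos
  set C : (ℝ × ℝ) × ℝ → ℝ := fun p => completionDeriv σ h h1 h2 e (X p.1)
    (partialDeriv X (1, 0) p.1) (partialDeriv X (0, 1) p.1) (K.toFun p.2) (deriv K.toFun p.2) with hC
  set R : (ℝ × ℝ) × ℝ → ℝ := fun p =>
    crossingDensity σ h1 h2 e (gap σ (X p.1) (K.toFun p.2)) * squareVol X K.toFun p with hR
  have pos : ∀ p ∈ unitSquare ×ˢ (univ : Set ℝ), 0 < gap σ (X p.1) (K.toFun p.2) + e :=
    fun p hp => by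
      have := hM.gap_nonneg (hXM _ hp.1) (K.mem p.2)
      positivity
  have cX : ContinuousOn (fun p : (ℝ × ℝ) × ℝ => X p.1) (unitSquare ×ˢ univ) :=
    hX.continuousOn.comp continuousOn_fst fun p hp => hp.1
  have cu : ∀ d, ContinuousOn (fun p : (ℝ × ℝ) × ℝ => partialDeriv X d p.1) (unitSquare ×ˢ univ) :=
    fun d => (contDiffOn_partialDeriv hX d).continuousOn.comp continuousOn_fst fun p hp => hp.1
  have cK : ContinuousOn (fun p : (ℝ × ℝ) × ℝ => K.toFun p.2) (unitSquare ×ˢ univ) :=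
    (K.smooth.continuous.comp continuous_snd).continuousOn
  have cK' : ContinuousOn (fun p : (ℝ × ℝ) × ℝ => deriv K.toFun p.2) (unitSquare ×ˢ univ) :=
    (K.continuous_deriv.comp continuous_snd).continuousOn
  have cC : ContinuousOn C (unitSquare ×ˢ univ) :=
    hk.continuousOn_completionDeriv cX (cu _) (cu _) cK cK' pos
  have cR : ContinuousOn R (unitSquare ×ˢ univ) :=
    (hk.continuousOn_crossingDensity_gap cX cK pos).mul (continuousOn_vol cX (cu _) (cu _) cK')
  have ii : ∀ {F : (ℝ × ℝ) × ℝ → ℝ} (a b : ℝ), ContinuousOn F (unitSquare ×ˢ univ) →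
      IntegrableOn F (unitSquare ×ˢ Icc a b) := fun a b hF =>
    (hF.mono (prod_mono le_rfl (subset_univ _))).integrableOn_compact
      (isCompact_unitSquare.prod isCompact_Icc)
  have slice : ∀ {F : (ℝ × ℝ) × ℝ → ℝ} (a b : ℝ) (p : ℝ × ℝ), p ∈ unitSquare →
      ContinuousOn F (unitSquare ×ˢ univ) → IntervalIntegrable (fun t => F (p, t)) volume a b :=
    fun a b p hp hF => (hF.comp (f := fun t => (p, t)) (by fun_prop)
      fun t _ => ⟨hp, mem_univ t⟩).intervalIntegrable
  have per : ∀ p, Function.Periodic (fun t => R (p, t)) T := by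
    intro p t
    have e1 : K.toFun (t + T) = K.toFun t := K.periodic t
    have e2 : deriv K.toFun (t + T) = deriv K.toFun t := K.deriv_periodic t
    simp only [hR, squareVol, e1, e2]
  have toIcc : ∀ (a b : ℝ), a ≤ b → ∀ f : ℝ → ℝ, ∫ t in a..b, f t = ∫ t in Icc a b, f t :=
    fun a b hab f => by rw [intervalIntegral.integral_of_le hab, integral_Icc_eq_integral_Ioc]
  have step1 : ∀ t, ∑ k, lineInt σ (fun z => -h1 (z + e)) (fun s => X (squareEdge k s))
      (K.toFun t) (deriv K.toFun t) = ∫ p in unitSquare, (C (p, t) + R (p, t)) := fun t =>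
    sum_lineInt_squareEdge hk hM hX hXM he (K.mem t) (K.form_deriv_eq_zero hM t)
  have iCR : Integrable (Function.uncurry fun (t : ℝ) (p : ℝ × ℝ) => C (p, t) + R (p, t))
      ((volume.restrict (Icc 0 T)).prod (volume.restrict unitSquare)) := by
    have := (ii 0 T (cC.add cR))
    rw [IntegrableOn, Measure.volume_eq_prod, ← Measure.prod_restrict] at this
    exact this.swap
  have iR : IntegrableOn R (unitSquare ×ˢ Icc (m - T) m) (volume.prod volume) := by
    have := ii (m - T) m cR
    rwa [Measure.volume_eq_prod] at this
  simp only [step1]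
  refine ⟨(intervalIntegrable_iff_integrableOn_Icc_of_le hT.le).mpr iCR.integral_prod_left, ?_⟩
  rw [toIcc 0 T hT.le, integral_integral_swap iCR, Measure.volume_eq_prod (ℝ × ℝ) ℝ,
    setIntegral_prod _ iR]
  refine setIntegral_congr_fun measurableSet_unitSquare fun p hp => ?_
  rw [← toIcc 0 T hT.le, ← toIcc (m - T) m (by linarith),
    intervalIntegral.integral_add (slice 0 T p hp cC) (slice 0 T p hp cR)]
  have z := hk.integral_completionDeriv hM K he (hXM p hp) (partialDeriv X (1, 0) p)
    (partialDeriv X (0, 1) p)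
  rw [show ∫ t in (0 : ℝ)..T, C (p, t) = 0 from z, zero_add]
  have := (per p).intervalIntegral_add_eq 0 (m - T)
  rw [zero_add, sub_add_cancel] at this
  exact this

/-- The points of a square that lie on a closed curve, with the parameter of the curve. -/
def squareCrossings (X : ℝ × ℝ → R4) (K : ClosedCurve M) : Set ((ℝ × ℝ) × ℝ) :=
  {q | q.1 ∈ openSquare ∧ q.2 ∈ Ico 0 K.period ∧ X q.1 = K.toFun q.2}

/-- The boundary integrals of the regularized form of a square converge to the signed number of
crossings. -/
theorem IsLinkingKernel.tendsto_integral_sum_lineInt (hk : IsLinkingKernel σ lam h h1 h2)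
    (hM : IsSpaceForm σ M) (hX : ContDiffOn ℝ ∞ X unitSquare) (hXM : ∀ p ∈ unitSquare, X p ∈ M)
    (K : ClosedCurve M) (avoid : ∀ p ∈ unitSquare \ openSquare, ∀ t, X p ≠ K.toFun t)
    (tr : ∀ q ∈ squareCrossings X K, squareVol X K.toFun q ≠ 0) :
    (squareCrossings X K).Finite ∧
    Tendsto (fun e => ∫ t in (0 : ℝ)..K.period, ∑ k, lineInt σ (fun z => -h1 (z + e))
      (fun s => X (squareEdge k s)) (K.toFun t) (deriv K.toFun t)) (𝓝[>] 0)
      (𝓝 (4 * Real.pi * lam *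
        ∑ᶠ q ∈ squareCrossings X K, (SignType.sign (squareVol X K.toFun q) : ℝ))) := by
  set T := K.period with hTdef
  have hT : 0 < T := K.period_pos
  set Z := squareCrossings X K with hZdef
  set z : (ℝ × ℝ) × ℝ → ℝ := fun p => gap σ (X p.1) (K.toFun p.2) with hz
  have cX : ContinuousOn (fun p : (ℝ × ℝ) × ℝ => X p.1) (unitSquare ×ˢ univ) :=
    hX.continuousOn.comp continuousOn_fst fun p hp => hp.1
  have cK : ContinuousOn (fun p : (ℝ × ℝ) × ℝ => K.toFun p.2) (unitSquare ×ˢ univ) :=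
    (K.smooth.continuous.comp continuous_snd).continuousOn
  have cz : ContinuousOn z (unitSquare ×ˢ univ) := continuousOn_gap cX cK
  have cu : ∀ d, ContinuousOn (fun p : (ℝ × ℝ) × ℝ => partialDeriv X d p.1) (unitSquare ×ˢ univ) :=
    fun d => (contDiffOn_partialDeriv hX d).continuousOn.comp continuousOn_fst fun p hp => hp.1
  have cD : ContinuousOn (squareVol X K.toFun) (unitSquare ×ˢ univ) :=
    continuousOn_vol cX (cu _) (cu _) (K.continuous_deriv.comp continuous_snd).continuousOn
  have zero : ∀ p : (ℝ × ℝ) × ℝ, p.1 ∈ unitSquare → z p = 0 →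
      p.1 ∈ openSquare ∧ X p.1 = K.toFun p.2 := by
    intro p hp h0
    have he := hM.eq_of_gap_eq_zero (hXM _ hp) (K.mem _) h0
    refine ⟨?_, he⟩
    by_contra hno
    exact avoid p.1 ⟨hp, hno⟩ p.2 he
  -- Transversality is assumed for parameters in one turn; periodicity extends it to all.
  have tr' : ∀ q : (ℝ × ℝ) × ℝ, q.1 ∈ openSquare → X q.1 = K.toFun q.2 →
      squareVol X K.toFun q ≠ 0 := by
    intro q hq h0
    have per : Function.Periodic (fun t => (K.toFun t, deriv K.toFun t)) T := fun t =>
      Prod.ext (K.periodic t) (K.deriv_periodic t)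
    obtain ⟨t, ht, hKt⟩ := per.exists_mem_Ico₀ hT q.2
    have hK : K.toFun q.2 = K.toFun t := congrArg Prod.fst hKt
    have hK' : deriv K.toFun q.2 = deriv K.toFun t := congrArg Prod.snd hKt
    have := tr (q.1, t) ⟨hq, ht, h0.trans hK⟩
    simp only [squareVol] at this ⊢
    rwa [hK']
  have box : ∀ a b : ℝ, IsCompact (unitSquare ×ˢ Icc a b) := fun a b =>
    isCompact_unitSquare.prod isCompact_Icc
  have sub : ∀ a b : ℝ, unitSquare ×ˢ Icc a b ⊆ unitSquare ×ˢ (univ : Set ℝ) := fun a b =>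
    prod_mono le_rfl (subset_univ _)
  have hfin : Z.Finite := by
    refine (finite_zeros_of_isolated (box 0 T) (cz.mono (sub 0 T)) ?_).subset ?_
    · intro q hq h0
      obtain ⟨a, b⟩ := zero q hq.1 h0
      exact (hk.crossing_contribution hM hX hXM K a b (tr' q a b)).1
    · rintro q ⟨a, b, c⟩
      refine ⟨⟨openSquare_subset a, Ico_subset_Icc_self b⟩, ?_⟩
      simp only [hz]
      rw [c]
      exact hM.gap_self (K.mem _)
  refine ⟨hfin, ?_⟩
  -- A crossing at parameter 0 would lie on the boundary of the box over [0, T]. For m < T beyond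
  -- all crossing parameters, the turn [m - T, m] has every crossing in its interior, and it has no
  -- others: a crossing at a negative parameter would reappear, shifted by T, at a parameter at
  -- least m.
  obtain ⟨m, hmZ, hm0, hmT⟩ : ∃ m, (∀ q ∈ Z, q.2 < m) ∧ 0 < m ∧ m < T := by
    have ev : ∀ᶠ m in 𝓝[<] T, (∀ q ∈ Z, q.2 < m) ∧ m ∈ Ioo 0 T := by
      refine ((eventually_all_finite hfin).mpr fun q hq => ?_).and (Ioo_mem_nhdsLT hT)
      filter_upwards [Ioo_mem_nhdsLT hq.2.1.2] with m hm using hm.1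
    obtain ⟨m, h1, h2⟩ := ev.exists
    exact ⟨m, h1, h2.1, h2.2⟩
  have lim := hk.tendsto_integral_crossingDensity_sum (μ := (volume : Measure ((ℝ × ℝ) × ℝ)))
    (box (m - T) m) (cz.mono (sub _ _)) (cD.mono (sub _ _))
    (fun p hp => hM.gap_nonneg (hXM _ hp.1) (K.mem _)) hfin ?_ ?_
    (c := fun q => 4 * Real.pi * lam * (SignType.sign (squareVol X K.toFun q) : ℝ))
    (fun q hq => (hk.crossing_contribution hM hX hXM K hq.1 hq.2.2 (tr q hq)).2)
  · rw [finsum_mem_eq_finite_toFinset_sum _ hfin, Finset.mul_sum]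
    refine lim.congr' ?_
    filter_upwards [self_mem_nhdsWithin] with e he
    exact (hk.integral_sum_lineInt hM hX hXM K he m).2.symm
  · intro q hq
    refine mem_interior.mpr ⟨openSquare ×ˢ Ioo (m - T) m,
      prod_mono openSquare_subset Ioo_subset_Icc_self, isOpen_openSquare.prod isOpen_Ioo,
      hq.1, ?_, hmZ q hq⟩
    linarith [hq.2.1.1]
  · intro p hp h0
    obtain ⟨a, b⟩ := zero p hp.1 h0
    refine ⟨a, ⟨?_, lt_of_le_of_lt hp.2.2 hmT⟩, b⟩
    by_contra hneg
    have : (p.1, p.2 + T) ∈ Z :=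
      ⟨a, ⟨by linarith [hp.2.1], by linarith [not_le.mp hneg]⟩, b.trans (K.periodic p.2).symm⟩
    have := hmZ _ this
    simp only at this
    linarith [hp.2.1]

end

end LinkingIntegral

namespace LinkingIntegral
open Set Filter Topology MeasureTheory Asymptotics

/-! ### Gluing squares -/

/-- Equality on [0, 1] forces equal derivatives only at interior parameters, which are almost all.
-/
theorem lineInt_congr {σ : ℝ} {k : ℝ → ℝ} {γ γ' : ℝ → R4} {y w : R4}
    (h : ∀ u ∈ Icc (0 : ℝ) 1, γ u = γ' u) : lineInt σ k γ y w = lineInt σ k γ' y w := by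
  refine intervalIntegral.integral_congr_ae ?_
  have : ∀ᵐ s : ℝ, s ≠ 1 := by simp [ae_iff, measure_singleton]
  filter_upwards [this] with s hs hs2
  rw [uIoc_of_le zero_le_one] at hs2
  have mem : s ∈ Ioo (0 : ℝ) 1 := ⟨hs2.1, lt_of_le_of_ne hs2.2 hs⟩
  have ev : γ =ᶠ[𝓝 s] γ' := by
    filter_upwards [Ioo_mem_nhds mem.1 mem.2] with u hu using h u (Ioo_subset_Icc_self hu)
  rw [ev.deriv_eq, ev.eq_of_nhds]

theorem lineInt_reverse (σ : ℝ) (k : ℝ → ℝ) (γ : ℝ → R4) (y w : R4) :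
    lineInt σ k (fun u => γ (1 - u)) y w = -lineInt σ k γ y w := by
  have := intervalIntegral.integral_comp_sub_left (a := 0) (b := 1)
    (fun s => k (gap σ (γ s) y) * vol (γ s) (deriv γ s) y w) 1
  simp only [sub_self, sub_zero] at this
  simp only [lineInt]
  rw [← this, ← intervalIntegral.integral_neg]
  refine intervalIntegral.integral_congr fun u _ => ?_
  simp only [deriv_comp_const_sub, vol_neg_second]
  ring

/-- The integral of a form over the boundary of a glued surface is its integral over the free
edge. -/
theorem sum_lineInt_eq {M : Set R4} {K : ClosedCurve M} (F : BoundedSurface M K) (σ : ℝ)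
    (k : ℝ → ℝ) (y w : R4) :
    ∑ i, ∑ j, lineInt σ k (fun s => F.patch i (squareEdge j s)) y w =
      lineInt σ k (fun u => K.toFun (K.period * u)) y w := by
  set f : Fin F.count × Fin 4 → ℝ := fun e =>
    lineInt σ k (fun s => F.patch e.1 (squareEdge e.2 s)) y w with hf
  have anti : ∀ e, e ≠ F.free → f (F.glue e) = -f e := by
    intro e he
    simp only [hf]
    rw [lineInt_congr (F.glue_edge e he)]
    exact lineInt_reverse σ k (fun u => F.patch e.1 (squareEdge e.2 u)) y w
  rw [← Fintype.sum_prod_type' (f := fun i j => f (i, j)),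
    ← Finset.add_sum_erase _ _ (Finset.mem_univ F.free)]
  have zero : ∑ e ∈ Finset.univ.erase F.free, f (e.1, e.2) = 0 := by
    refine Finset.sum_involution (fun e _ => F.glue e) ?_ ?_ ?_ ?_
    · intro e he
      rw [show f ((F.glue e).1, (F.glue e).2) = f (F.glue e) from rfl,
        anti e (Finset.ne_of_mem_erase he)]
      exact add_neg_cancel _
    -- An edge folded onto itself has an integral equal to its own negative, so it contributes
    -- nothing.
    · intro e he h0 hg
      have := anti e (Finset.ne_of_mem_erase he)
      rw [hg] at this
      exact h0 (by linarith)
    · intro e he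
      refine Finset.mem_erase.mpr ⟨fun hg => Finset.ne_of_mem_erase he ?_, Finset.mem_univ _⟩
      rw [← F.glue_glue e, hg, F.glue_free]
    · intro e _
      exact F.glue_glue e
  rw [zero, add_zero]
  exact lineInt_congr F.free_edge

theorem lineInt_closedCurve {M : Set R4} (K : ClosedCurve M) (σ : ℝ) (k : ℝ → ℝ) (y w : R4) :
    lineInt σ k (fun u => K.toFun (K.period * u)) y w =
      ∫ s in (0 : ℝ)..K.period, k (gap σ (K.toFun s) y) * vol (K.toFun s) (deriv K.toFun s) y w := by
  have := intervalIntegral.mul_integral_comp_mul_left (a := 0) (b := 1)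
    (f := fun s => k (gap σ (K.toFun s) y) * vol (K.toFun s) (deriv K.toFun s) y w) K.period
  rw [mul_zero, mul_one] at this
  rw [← this, ← intervalIntegral.integral_const_mul, lineInt]
  refine intervalIntegral.integral_congr fun u _ => ?_
  simp only [deriv_comp_mul_left, vol_smul_second]
  ring

/-! ### The linking integral counts crossings -/

/-- The linking integrand in terms of `h1 = h'`. -/
noncomputable def kernelIntegrand (σ : ℝ) (h1 : ℝ → ℝ) (x v y w : R4) : ℝ :=
  -h1 (gap σ x y) * vol x v y w

section
variable {σ lam : ℝ} {h h1 h2 : ℝ → ℝ} {M : Set R4}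

theorem isCompact_paramBox (K₁ K₂ : ClosedCurve M) : IsCompact (paramBox K₁ K₂) :=
  isCompact_Icc.prod isCompact_Icc

theorem measurableSet_paramBox (K₁ K₂ : ClosedCurve M) : MeasurableSet (paramBox K₁ K₂) :=
  measurableSet_Icc.prod measurableSet_Icc

/-- Disjointness keeps the gap positive, so the shift may be 0. Joint continuity in shift and
parameters gives both integrability of the unshifted kernel and the limit e → 0. -/
theorem IsLinkingKernel.continuousOn_shift (hk : IsLinkingKernel σ lam h h1 h2)
    (hM : IsSpaceForm σ M) {K₁ K₂ : ClosedCurve M} (hd : K₁.Disjoint K₂) :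
    ContinuousOn (fun x : ℝ × ℝ × ℝ => -h1 (gap σ (K₁.toFun x.2.1) (K₂.toFun x.2.2) + x.1) *
      vol (K₁.toFun x.2.1) (deriv K₁.toFun x.2.1) (K₂.toFun x.2.2) (deriv K₂.toFun x.2.2))
      (Ici 0 ×ˢ univ) := by
  have c1 : ContinuousOn (fun x : ℝ × ℝ × ℝ => K₁.toFun x.2.1) (Ici 0 ×ˢ univ) :=
    (K₁.smooth.continuous.comp (by fun_prop)).continuousOn
  have c2 : ContinuousOn (fun x : ℝ × ℝ × ℝ => K₂.toFun x.2.2) (Ici 0 ×ˢ univ) :=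
    (K₂.smooth.continuous.comp (by fun_prop)).continuousOn
  have c3 : ContinuousOn (fun x : ℝ × ℝ × ℝ => deriv K₁.toFun x.2.1) (Ici 0 ×ˢ univ) :=
    (K₁.continuous_deriv.comp (by fun_prop)).continuousOn
  have c4 : ContinuousOn (fun x : ℝ × ℝ × ℝ => deriv K₂.toFun x.2.2) (Ici 0 ×ˢ univ) :=
    (K₂.continuous_deriv.comp (by fun_prop)).continuousOn
  refine ContinuousOn.mul (ContinuousOn.neg ?_) (continuousOn_vol c1 c3 c2 c4)
  refine hk.continuousOn_deriv.comp ((continuousOn_gap c1 c2).add continuousOn_fst) fun x hx => ?_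
  exact add_pos_of_pos_of_nonneg (hM.gap_pos _ (K₁.mem _) _ (K₂.mem _) (hd _ _)) hx.1

theorem IsLinkingKernel.continuous_pullback (hk : IsLinkingKernel σ lam h h1 h2)
    (hM : IsSpaceForm σ M) {K₁ K₂ : ClosedCurve M} (hd : K₁.Disjoint K₂) :
    Continuous (pullback (kernelIntegrand σ h1) K₁ K₂) := by
  rw [← continuousOn_univ]
  have := (hk.continuousOn_shift hM hd).comp (f := fun p : ℝ × ℝ => ((0 : ℝ), p))
    (s := univ) (by fun_prop) fun p _ => ⟨self_mem_Ici, mem_univ _⟩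
  simpa only [pullback, kernelIntegrand, Function.comp_def, add_zero] using! this

/-- The integral of the regularized kernel converges to the linking integral. -/
theorem IsLinkingKernel.tendsto_integral_lineInt (hk : IsLinkingKernel σ lam h h1 h2)
    (hM : IsSpaceForm σ M) {K₁ K₂ : ClosedCurve M} (hd : K₁.Disjoint K₂) :
    Tendsto (fun e => ∫ t in (0 : ℝ)..K₂.period, lineInt σ (fun z => -h1 (z + e))
      (fun u => K₁.toFun (K₁.period * u)) (K₂.toFun t) (deriv K₂.toFun t)) (𝓝[>] 0)
      (𝓝 (integralOver (kernelIntegrand σ h1) K₁ K₂)) := by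
  set F : ℝ × ℝ × ℝ → ℝ := fun x => -h1 (gap σ (K₁.toFun x.2.1) (K₂.toFun x.2.2) + x.1) *
      vol (K₁.toFun x.2.1) (deriv K₁.toFun x.2.1) (K₂.toFun x.2.2) (deriv K₂.toFun x.2.2) with hF
  have cF : ContinuousOn F (Ici 0 ×ˢ univ) := hk.continuousOn_shift hM hd
  have hB := isCompact_paramBox K₁ K₂
  have cFe : ∀ e : ℝ, 0 ≤ e → Continuous fun p => F (e, p) := fun e he => by
    rw [← continuousOn_univ]
    exact cF.comp (by fun_prop) fun p _ => ⟨he, mem_univ _⟩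
  have swap : ∀ e : ℝ, 0 < e → ∫ t in (0 : ℝ)..K₂.period, lineInt σ (fun z => -h1 (z + e))
      (fun u => K₁.toFun (K₁.period * u)) (K₂.toFun t) (deriv K₂.toFun t) =
      ∫ p in paramBox K₁ K₂, F (e, p) := by
    intro e he
    simp only [lineInt_closedCurve]
    have ii : IntegrableOn (fun p => F (e, p)) (paramBox K₁ K₂) :=
      (cFe e he.le).continuousOn.integrableOn_compact hB
    have toIcc : ∀ (b : ℝ), 0 < b → ∀ f : ℝ → ℝ, ∫ t in (0 : ℝ)..b, f t = ∫ t in Icc 0 b, f t :=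
      fun b hb f => by rw [intervalIntegral.integral_of_le hb.le, integral_Icc_eq_integral_Ioc]
    rw [toIcc _ K₂.period_pos]
    simp only [toIcc _ K₁.period_pos]
    rw [paramBox, Measure.volume_eq_prod, ← Measure.prod_restrict, integral_prod_symm]
    rwa [IntegrableOn, paramBox, Measure.volume_eq_prod, ← Measure.prod_restrict] at ii
  obtain ⟨C, hC⟩ := (isCompact_Icc (a := (0 : ℝ)) (b := 1)).prod hB |>.exists_bound_of_continuousOn
    (cF.mono (prod_mono Icc_subset_Ici_self (subset_univ _)))
  have ev : ∀ᶠ e : ℝ in 𝓝[>] 0, e ∈ Ioo (0 : ℝ) 1 := Ioo_mem_nhdsGT one_pos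
  have lim : Tendsto (fun e => ∫ p in paramBox K₁ K₂, F (e, p)) (𝓝[>] 0)
      (𝓝 (∫ p in paramBox K₁ K₂, F (0, p))) := by
    refine tendsto_integral_filter_of_dominated_convergence (fun _ => C) ?_ ?_ ?_ ?_
    · filter_upwards [ev] with e he using (cFe e he.1.le).aestronglyMeasurable
    · filter_upwards [ev] with e he
      filter_upwards [ae_restrict_mem (measurableSet_paramBox K₁ K₂)] with p hp
      exact hC (e, p) ⟨Ioo_subset_Icc_self he, hp⟩
    · exact integrableOn_const hB.measure_lt_top.ne
    · refine Eventually.of_forall fun p => ?_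
      have c : ContinuousWithinAt (fun e : ℝ => F (e, p)) (Ici 0) 0 :=
        (cF.comp (f := fun e : ℝ => (e, p)) (by fun_prop) fun e he => ⟨he, mem_univ _⟩) 0
          self_mem_Ici
      exact c.tendsto.mono_left (nhdsWithin_mono _ Ioi_subset_Ici_self)
  have e0 : ∫ p in paramBox K₁ K₂, F (0, p) = integralOver (kernelIntegrand σ h1) K₁ K₂ := by
    simp [integralOver, hF, pullback, kernelIntegrand]
  rw [← e0]
  refine lim.congr' ?_
  filter_upwards [self_mem_nhdsWithin] with e he using (swap e he).symm

/-- The linking integral is a multiple of the intersection number. -/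
theorem IsLinkingKernel.integralOver_eq (hk : IsLinkingKernel σ lam h h1 h2)
    (hM : IsSpaceForm σ M) {K₁ K₂ : ClosedCurve M} (hd : K₁.Disjoint K₂)
    (F : BoundedSurface M K₁) (tr : IsTransverse F K₂) :
    integralOver (kernelIntegrand σ h1) K₁ K₂ =
      4 * Real.pi * lam * (intersectionNumber F K₂ : ℝ) := by
  have cv : ∀ i, ∀ q ∈ squareCrossings (F.patch i) K₂,
      crossingVol F K₂ (i, q) = squareVol (F.patch i) K₂.toFun q := by
    intro i q hq
    simp only [crossingVol, squareVol, hq.2.2, partialDeriv_eq_fderiv (F.smooth i) hq.1]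
  have patch := fun i => hk.tendsto_integral_sum_lineInt hM (F.smooth i) (F.mem i) K₂ (tr.1 i)
    (fun q hq => by rw [← cv i q hq]; exact tr.2 (i, q) hq)
  have lim := tendsto_finsetSum Finset.univ fun i (_ : i ∈ Finset.univ) => (patch i).2
  have lim2 := hk.tendsto_integral_lineInt hM hd
  have swap : ∀ e : ℝ, 0 < e → ∑ i, ∫ t in (0 : ℝ)..K₂.period, ∑ k, lineInt σ (fun z => -h1 (z + e))
      (fun s => F.patch i (squareEdge k s)) (K₂.toFun t) (deriv K₂.toFun t) =
      ∫ t in (0 : ℝ)..K₂.period, lineInt σ (fun z => -h1 (z + e))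
      (fun u => K₁.toFun (K₁.period * u)) (K₂.toFun t) (deriv K₂.toFun t) := by
    intro e he
    rw [← intervalIntegral.integral_finsetSum]
    · refine intervalIntegral.integral_congr fun t _ => ?_
      exact sum_lineInt_eq F σ _ _ _
    · intro i _
      exact (hk.integral_sum_lineInt hM (F.smooth i) (F.mem i) K₂ he 0).1
  have ev : ∀ᶠ e : ℝ in 𝓝[>] 0, 0 < e := self_mem_nhdsWithin
  have lim3 := lim.congr' (ev.mono fun e he => swap e he)
  -- The same regularized integrals tend to the linking integral and to the signed count.
  rw [tendsto_nhds_unique lim2 lim3, ← Finset.mul_sum]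
  congr 1
  have union : crossings F K₂ = ⋃ i, Prod.mk i '' squareCrossings (F.patch i) K₂ := by
    ext ⟨i, q⟩
    simp only [crossings, squareCrossings, mem_ofPred_eq, mem_iUnion, mem_image, Prod.mk.injEq]
    constructor
    · intro hq
      exact ⟨i, q, hq, rfl, rfl⟩
    · rintro ⟨j, q', hq', rfl, rfl⟩
      exact hq'
  have fin : ∀ i, (Prod.mk i '' squareCrossings (F.patch i) K₂).Finite := fun i =>
    (patch i).1.image _
  have disj : Pairwise (Function.onFun _root_.Disjoint
      fun i => Prod.mk i '' squareCrossings (F.patch i) K₂) := by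
    intro i j hij
    rw [Function.onFun, Set.disjoint_left]
    rintro _ ⟨q, _, rfl⟩ ⟨q', _, hq'⟩
    exact hij (congrArg Prod.fst hq').symm
  rw [intersectionNumber, union]
  have := (Int.castAddHom ℝ).map_finsum_mem (s := ⋃ i, Prod.mk i '' squareCrossings (F.patch i) K₂)
    (fun q => ((SignType.sign (crossingVol F K₂ q) : SignType) : ℤ)) (finite_iUnion fin)
  simp only [Int.coe_castAddHom] at this
  rw [this, finsum_mem_iUnion disj fin, finsum_eq_sum_of_fintype]
  refine Finset.sum_congr rfl fun i _ => ?_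
  rw [finsum_mem_image (Prod.mk_right_injective i).injOn]
  refine finsum_mem_congr rfl fun q hq => ?_
  rw [cv i q hq]
  simp

/-- The linking integral is symmetric. -/
theorem integralOver_kernelIntegrand_comm (σ : ℝ) (h1 : ℝ → ℝ) (K₁ K₂ : ClosedCurve M) :
    integralOver (kernelIntegrand σ h1) K₂ K₁ = integralOver (kernelIntegrand σ h1) K₁ K₂ := by
  rw [integralOver, integralOver, paramBox, paramBox, Measure.volume_eq_prod,
    ← setIntegral_prod_swap]
  refine setIntegral_congr_fun (measurableSet_Icc.prod measurableSet_Icc) fun p _ => ?_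
  simp only [pullback, kernelIntegrand, Prod.fst_swap, Prod.snd_swap]
  rw [gap_comm, vol_swap_pairs]

end

end LinkingIntegral

namespace LinkingIntegral
open Set Filter Topology MeasureTheory

/-! ### Surfaces bounded by a closed curve -/

/-- The rescaling of a vector to a unit vector. -/
noncomputable def normalize (σ : ℝ) (W : R4) : R4 := (√(form σ W W))⁻¹ • W

/-- `C` is an open cone over `M`, so that central projection maps `C` to `M`. -/
structure IsConeOver (σ : ℝ) (M C : Set R4) : Prop where
  form_pos : ∀ W ∈ C, 0 < form σ W W
  normalize_mem : ∀ W ∈ C, normalize σ W ∈ M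

theorem det_eq_vol (L : R4 →L[ℝ] R4) : L.det =
    vol (L (Pi.single 0 1)) (L (Pi.single 1 1)) (L (Pi.single 2 1)) (L (Pi.single 3 1)) := by
  rw [ContinuousLinearMap.det, ← LinearMap.det_toMatrix', ← Matrix.det_transpose, vol]
  congr 1
  ext i j
  fin_cases i <;> simp [LinearMap.toMatrix'_apply, Matrix.transpose_apply]

/-- The critical values of a smooth map of `ℝ⁴` to itself form a null set. -/
theorem volume_critical_values {f : R4 → R4} (hf : ContDiff ℝ ∞ f) :
    volume (f '' {q | vol (fderiv ℝ f q (Pi.single 0 1)) (fderiv ℝ f q (Pi.single 1 1))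
      (fderiv ℝ f q (Pi.single 2 1)) (fderiv ℝ f q (Pi.single 3 1)) = 0}) = 0 := by
  refine addHaar_image_eq_zero_of_det_fderivWithin_eq_zero volume (f' := fderiv ℝ f) (fun q _ =>
    (hf.differentiable (by simp) q).hasFDerivAt.hasFDerivWithinAt) fun q hq => ?_
  rw [det_eq_vol]
  exact hq

/-- A map independent of its last coordinate has only critical points. This makes families with at
most three parameters negligible. -/
theorem volume_range_eq_zero {f : R4 → R4} (hf : ContDiff ℝ ∞ f)
    (h : ∀ q (s : ℝ), f (q + s • Pi.single 3 1) = f q) : volume (range f) = 0 := by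
  rw [← image_univ]
  convert volume_critical_values hf using 3
  refine (eq_univ_of_forall fun q => ?_).symm
  have d := (hf.differentiable (by simp) q).hasFDerivAt.hasLineDerivAt (Pi.single 3 1)
  have d0 : HasLineDerivAt ℝ f 0 q (Pi.single 3 1) := by
    simp only [HasLineDerivAt, h]
    exact hasDerivAt_const _ _
  change vol _ _ _ _ = 0
  rw [d.unique d0, vol_eq]
  simp

section
variable {σ : ℝ} {M C : Set R4} {K₁ K₂ : ClosedCurve M}

/-- The combinations of points of two curves. -/
noncomputable def spanMap (K₁ K₂ : ClosedCurve M) (q : R4) : R4 :=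
  q 0 • K₁.toFun (q 1) + q 2 • K₂.toFun (q 3)

theorem contDiff_spanMap (K₁ K₂ : ClosedCurve M) : ContDiff ℝ ∞ (spanMap K₁ K₂) := by
  have h1 := K₁.smooth
  have h2 := K₂.smooth
  unfold spanMap
  fun_prop

/-- If p is not a critical value of `spanMap`, the volume on the right is nonzero at every preimage
of p; this is what transversality of the cone with apex p requires. -/
theorem fderiv_spanMap (K₁ K₂ : ClosedCurve M) (q : R4) :
    vol (fderiv ℝ (spanMap K₁ K₂) q (Pi.single 0 1)) (fderiv ℝ (spanMap K₁ K₂) q (Pi.single 1 1))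
      (fderiv ℝ (spanMap K₁ K₂) q (Pi.single 2 1)) (fderiv ℝ (spanMap K₁ K₂) q (Pi.single 3 1)) =
    q 0 * q 2 * vol (K₁.toFun (q 1)) (deriv K₁.toFun (q 1)) (K₂.toFun (q 3))
      (deriv K₂.toFun (q 3)) := by
  have lin := fun v => ((contDiff_spanMap K₁ K₂).differentiable (by simp) q).hasFDerivAt.hasLineDerivAt v
  have id1 : ∀ a : ℝ, HasDerivAt (fun s : ℝ => a + s) 1 0 := fun a => (hasDerivAt_id 0).const_add a
  have e0 : fderiv ℝ (spanMap K₁ K₂) q (Pi.single 0 1) = K₁.toFun (q 1) := by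
    refine (lin _).unique ?_
    simp only [HasLineDerivAt, spanMap]
    simp
    simpa using ((id1 (q 0)).smul_const (K₁.toFun (q 1)))
  have e2 : fderiv ℝ (spanMap K₁ K₂) q (Pi.single 2 1) = K₂.toFun (q 3) := by
    refine (lin _).unique ?_
    simp only [HasLineDerivAt, spanMap]
    simp
    simpa using ((id1 (q 2)).smul_const (K₂.toFun (q 3)))
  have e1 : fderiv ℝ (spanMap K₁ K₂) q (Pi.single 1 1) = q 0 • deriv K₁.toFun (q 1) := by
    refine (lin _).unique ?_
    simp only [HasLineDerivAt, spanMap]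
    simp
    have := (HasDerivAt.scomp (0 : ℝ) (h := fun s : ℝ => q 1 + s) (g₁ := K₁.toFun)
      (by rw [add_zero]; exact K₁.hasDerivAt (q 1)) (id1 (q 1)))
    simpa using! this.const_smul (q 0)
  have e3 : fderiv ℝ (spanMap K₁ K₂) q (Pi.single 3 1) = q 2 • deriv K₂.toFun (q 3) := by
    refine (lin _).unique ?_
    simp only [HasLineDerivAt, spanMap]
    simp
    have := (HasDerivAt.scomp (0 : ℝ) (h := fun s : ℝ => q 3 + s) (g₁ := K₂.toFun)
      (by rw [add_zero]; exact K₂.hasDerivAt (q 3)) (id1 (q 3)))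
    simpa using! this.const_smul (q 2)
  rw [e0, e1, e2, e3]
  simp only [vol_eq, Pi.smul_apply, smul_eq_mul]
  ring

/-- The segments from the points of a curve to the point `p`. -/
noncomputable def segmentMap (K : ClosedCurve M) (p : R4) (q : ℝ × ℝ) : R4 :=
  (1 - q.2) • K.toFun (K.period * q.1) + q.2 • p

theorem contDiff_segmentMap (K : ClosedCurve M) (p : R4) : ContDiff ℝ ∞ (segmentMap K p) := by
  have h1 := K.smooth
  unfold segmentMap
  fun_prop

theorem fderiv_segmentMap (K : ClosedCurve M) (p : R4) (q : ℝ × ℝ) :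
    fderiv ℝ (segmentMap K p) q (1, 0) =
      ((1 - q.2) * K.period) • deriv K.toFun (K.period * q.1) ∧
    fderiv ℝ (segmentMap K p) q (0, 1) = p - K.toFun (K.period * q.1) := by
  have lin := fun v =>
    ((contDiff_segmentMap K p).differentiable (by simp) q).hasFDerivAt.hasLineDerivAt v
  have id1 : ∀ a : ℝ, HasDerivAt (fun s : ℝ => a + s) 1 0 := fun a => (hasDerivAt_id 0).const_add a
  constructor
  · refine (lin _).unique ?_
    simp only [HasLineDerivAt, segmentMap]
    simp
    have := (HasDerivAt.scomp (0 : ℝ) (h := fun s : ℝ => K.period * (q.1 + s)) (g₁ := K.toFun)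
      (by rw [add_zero]; exact K.hasDerivAt (K.period * q.1)) ((id1 q.1).const_mul K.period))
    have := (this.const_smul (1 - q.2)).add_const (q.2 • p)
    simpa [smul_smul, Function.comp_def] using! this
  · refine (lin _).unique ?_
    simp only [HasLineDerivAt, segmentMap]
    simp
    have := (((id1 q.2).const_sub 1).smul_const (K.toFun (K.period * q.1))).add
      ((id1 q.2).smul_const p)
    refine this.congr_deriv ?_
    module

theorem contDiffAt_normalize (hC : IsConeOver σ M C) {W : R4} (hW : W ∈ C) :
    ContDiffAt ℝ ∞ (fun W => (√(form σ W W))⁻¹) W := by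
  have h := hC.form_pos W hW
  have c : ContDiffAt ℝ ∞ (fun W => form σ W W) W :=
    ((contDiff_form σ).comp (contDiff_id.prodMk contDiff_id)).contDiffAt
  exact (c.sqrt h.ne').inv (Real.sqrt_pos.mpr h).ne'

theorem normalize_of_mem (hM : IsSpaceForm σ M) {x : R4} (hx : x ∈ M) : normalize σ x = x := by
  simp [normalize, hM.form_self x hx]

/-- The cone with apex `p` over a closed curve, projected to `M`: a disc bounded by the curve. -/
noncomputable def coneSurface (hM : IsSpaceForm σ M) (hC : IsConeOver σ M C) (K : ClosedCurve M)
    (p : R4) (hp : ∀ q ∈ unitSquare, segmentMap K p q ∈ C) : BoundedSurface M K where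
  count := 1
  patch _ q := normalize σ (segmentMap K p q)
  smooth _ q hq := by
    have := ((contDiffAt_normalize hC (hp q hq)).comp q
      (contDiff_segmentMap K p).contDiffAt).smul (contDiff_segmentMap K p).contDiffAt
    exact this.contDiffWithinAt
  mem _ q hq := hC.normalize_mem _ (hp q hq)
  -- Edge 0 is the curve; edges 1 and 3 agree because the curve closes up; edge 2 is collapsed to
  -- the apex and folded onto itself.
  glue e := (e.1, ![0, 3, 2, 1] e.2)
  free := (0, 0)
  glue_glue := by rintro ⟨i, k⟩; fin_cases k <;> rfl
  glue_free := rfl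
  glue_edge := by
    have h0 : K.toFun K.period = K.toFun 0 := by simpa using K.periodic 0
    rintro ⟨i, k⟩ hne u _
    fin_cases i
    fin_cases k
    · exact absurd rfl hne
    · simp [squareEdge, segmentMap, h0]
    · simp [squareEdge, segmentMap]
    · simp [squareEdge, segmentMap, h0]
  free_edge u _ := by
    simp [squareEdge, segmentMap, normalize_of_mem hM (K.mem _)]

/-- Where the cone meets a curve, its apex is a combination of points of the two curves. -/
theorem apex_eq_spanMap {p : R4} {q : ℝ × ℝ} {t : ℝ} (hC : IsConeOver σ M C)
    (hq : segmentMap K₁ p q ∈ C) (hq2 : q.2 ≠ 0)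
    (h : normalize σ (segmentMap K₁ p q) = K₂.toFun t) :
    p = (-((1 - q.2) / q.2)) • K₁.toFun (K₁.period * q.1) +
      (√(form σ (segmentMap K₁ p q) (segmentMap K₁ p q)) / q.2) • K₂.toFun t := by
  have hN := (Real.sqrt_pos.mpr (hC.form_pos _ hq)).ne'
  rw [← h, normalize, smul_smul, div_mul_eq_mul_div, mul_inv_cancel₀ hN, segmentMap]
  ext i
  simp only [Pi.add_apply, Pi.smul_apply, smul_eq_mul]
  field_simp
  ring

/-- A generic cone over a curve is transverse to another curve. -/
theorem exists_transverse_surface (hM : IsSpaceForm σ M) (hC : IsConeOver σ M C)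
    (hd : K₁.Disjoint K₂) {O : Set R4} (hO : volume O ≠ 0)
    (hOC : ∀ p ∈ O, ∀ q ∈ unitSquare, segmentMap K₁ p q ∈ C) :
    ∃ F : BoundedSurface M K₁, IsTransverse F K₂ := by
  -- Two null sets for the apex to avoid. The critical values B₁ would allow nontransverse
  -- crossings; the combinations B₂ of K₁(0) with points of K₂ would allow crossings on the edges of
  -- the patch other than K₁.
  set B₁ := spanMap K₁ K₂ '' {q | vol (fderiv ℝ (spanMap K₁ K₂) q (Pi.single 0 1))
    (fderiv ℝ (spanMap K₁ K₂) q (Pi.single 1 1)) (fderiv ℝ (spanMap K₁ K₂) q (Pi.single 2 1))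
    (fderiv ℝ (spanMap K₁ K₂) q (Pi.single 3 1)) = 0} with hB₁
  have b1 : volume B₁ = 0 := volume_critical_values (contDiff_spanMap K₁ K₂)
  set B₂ := range fun q : R4 => q 0 • K₁.toFun 0 + q 1 • K₂.toFun (q 2) with hB₂
  have b2 : volume B₂ = 0 := by
    refine volume_range_eq_zero ?_ ?_
    · have h2 := K₂.smooth
      fun_prop
    · intro q s
      simp
  obtain ⟨p, hpO, hp⟩ : (O \ (B₁ ∪ B₂)).Nonempty := by
    by_contra hne
    rw [not_nonempty_iff_eq_empty, sdiff_eq_empty] at hne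
    exact hO (measure_mono_null hne (measure_union_null b1 b2))
  have h0 : K₁.toFun K₁.period = K₁.toFun 0 := by simpa using K₁.periodic 0
  have hp1 : p ∉ B₁ := fun h => hp (Or.inl h)
  have hp2 : p ∉ B₂ := fun h => hp (Or.inr h)
  refine ⟨coneSurface hM hC K₁ p (hOC p hpO), ?_, ?_⟩
  · rintro i q ⟨hq, hqo⟩ t heq
    have heq : normalize σ (segmentMap K₁ p q) = K₂.toFun t := heq
    by_cases hq2 : q.2 = 0
    · have : normalize σ (segmentMap K₁ p q) = K₁.toFun (K₁.period * q.1) := by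
        simp [segmentMap, hq2, normalize_of_mem hM (K₁.mem _)]
      exact hd _ _ (this.symm.trans heq)
    have ap := apex_eq_spanMap hC (hOC p hpO q hq) hq2 heq
    have hv : 0 < q.2 := lt_of_le_of_ne hq.2.1 (Ne.symm hq2)
    have inB2 : ∀ a b : ℝ, p = a • K₁.toFun 0 + b • K₂.toFun t → False := fun a b hab =>
      hp2 ⟨![a, b, t, 0], by simp [hab]⟩
    by_cases hv1 : q.2 = 1
    · rw [hv1] at ap
      refine inB2 0 (√(form σ (segmentMap K₁ p q) (segmentMap K₁ p q))) ?_
      conv_lhs => rw [ap]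
      simp
    · have hv2 : q.2 < 1 := lt_of_le_of_ne hq.2.2 hv1
      have hu : q.1 = 0 ∨ q.1 = 1 := by
        by_contra! hne
        exact hqo ⟨⟨lt_of_le_of_ne hq.1.1 (Ne.symm hne.1), lt_of_le_of_ne hq.1.2 hne.2⟩, hv, hv2⟩
      have hK : K₁.toFun (K₁.period * q.1) = K₁.toFun 0 := by
        rcases hu with hu | hu <;> simp [hu, h0]
      rw [hK] at ap
      exact inB2 _ _ ap
  · rintro ⟨i, q, t⟩ ⟨hq, -, heq⟩
    have heq : normalize σ (segmentMap K₁ p q) = K₂.toFun t := heq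
    have hq : q ∈ openSquare := hq
    have hqC := hOC p hpO q (openSquare_subset hq)
    have hv := hq.2.1
    have ap := apex_eq_spanMap hC hqC hv.ne' heq
    have hNpos := Real.sqrt_pos.mpr (hC.form_pos _ hqC)
    set N := √(form σ (segmentMap K₁ p q) (segmentMap K₁ p q)) with hN
    have nonsing : vol (K₁.toFun (K₁.period * q.1)) (deriv K₁.toFun (K₁.period * q.1))
        (K₂.toFun t) (deriv K₂.toFun t) ≠ 0 := by
      intro hz
      refine hp1 ⟨![-((1 - q.2) / q.2), K₁.period * q.1, N / q.2, t], ?_, ?_⟩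
      · change vol _ _ _ _ = 0
        rw [fderiv_spanMap]
        simp [hz]
      · rw [ap]
        simp [spanMap]
    have dc : HasFDerivAt (fun q => (√(form σ (segmentMap K₁ p q) (segmentMap K₁ p q)))⁻¹) _ q :=
      (((contDiffAt_normalize hC hqC).comp q
        (contDiff_segmentMap K₁ p).contDiffAt).differentiableAt (by simp)).hasFDerivAt
    have dW := ((contDiff_segmentMap K₁ p).differentiable (by simp) q).hasFDerivAt
    have dF := (dc.smul dW).fderiv
    obtain ⟨eu, ev⟩ := fderiv_segmentMap K₁ p q
    have hW : segmentMap K₁ p q = N • K₂.toFun t := by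
      rw [← heq, normalize, smul_smul, mul_inv_cancel₀ hNpos.ne', one_smul]
    change vol (K₂.toFun t) (fderiv ℝ (fun q => (√(form σ (segmentMap K₁ p q)
      (segmentMap K₁ p q)))⁻¹ • segmentMap K₁ p q) q (1, 0)) (fderiv ℝ (fun q => (√(form σ
      (segmentMap K₁ p q) (segmentMap K₁ p q)))⁻¹ • segmentMap K₁ p q) q (0, 1))
      (deriv K₂.toFun t) ≠ 0
    have dF : fderiv ℝ (fun q => (√(form σ (segmentMap K₁ p q) (segmentMap K₁ p q)))⁻¹ •
      segmentMap K₁ p q) q = _ := dF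
    rw [dF]
    simp only [add_apply, smul_apply, ContinuousLinearMap.smulRight_apply, eu, ev, hW]
    generalize (fderiv ℝ (fun q => (√(form σ (segmentMap K₁ p q) (segmentMap K₁ p q)))⁻¹) q)
      (1, 0) = α
    generalize (fderiv ℝ (fun q => (√(form σ (segmentMap K₁ p q) (segmentMap K₁ p q)))⁻¹) q)
      (0, 1) = β
    -- Derivatives of the normalizing factor contribute multiples of y, which drop out of a volume
    -- that already contains y.
    have e : ∀ (c α β n m A B : ℝ) (x x' y y' : R4),
        vol y (c • A • x' + α • n • y) (c • (B • x + m • y) + β • n • y) y' =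
          -(c ^ 2 * A * B) * vol x x' y y' := by
      intro c α β n m A B x x' y y'
      simp only [vol_eq, Pi.add_apply, Pi.smul_apply, smul_eq_mul]
      ring
    have pe : p - K₁.toFun (K₁.period * q.1) =
        (-(1 / q.2)) • K₁.toFun (K₁.period * q.1) + (N / q.2) • K₂.toFun t := by
      conv_lhs => rw [ap]
      ext i
      simp only [Pi.add_apply, Pi.sub_apply, Pi.smul_apply, smul_eq_mul]
      field_simp
      ring
    rw [pe, e]
    have := K₁.period_pos
    have h1 : 0 < 1 - q.2 := sub_pos.mpr hq.2.2
    have hN2 : 0 < √(form σ (N • K₂.toFun t) (N • K₂.toFun t)) := by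
      rw [← hW]
      exact hNpos
    refine mul_ne_zero (neg_ne_zero.mpr (mul_ne_zero (mul_ne_zero (by positivity)
      (mul_ne_zero h1.ne' this.ne')) ?_)) nonsing
    exact neg_ne_zero.mpr (by positivity)

theorem continuous_form_self (σ : ℝ) : Continuous fun W : R4 => form σ W W :=
  ((contDiff_form σ).comp (contDiff_id.prodMk contDiff_id)).continuous

theorem form_normalize {σ : ℝ} {W : R4} (h : 0 < form σ W W) :
    form σ (normalize σ W) (normalize σ W) = 1 := by
  have h1 := Real.sq_sqrt h.le
  have h2 := Real.sqrt_pos.mpr h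
  rw [normalize, form_smul_left, form_smul_right, ← h1]
  simp only [Real.sqrt_sq h2.le]
  field_simp

theorem isConeOver_S3 : IsConeOver 1 S3 {W | W ≠ 0} where
  form_pos W hW := by
    rw [form_one]
    exact euc_self_pos hW
  normalize_mem W hW := by
    have := form_normalize (σ := 1) (W := W) (by rw [form_one]; exact euc_self_pos hW)
    rwa [form_one] at this

theorem isConeOver_H3 : IsConeOver (-1) H3 {W | 0 < form (-1) W W ∧ 0 < W 0} where
  form_pos W hW := hW.1
  normalize_mem W hW := by
    have := form_normalize hW.1
    rw [form_neg_one] at this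
    exact ⟨this, mul_pos (inv_pos.mpr (Real.sqrt_pos.mpr hW.1)) hW.2⟩

/-- A segment from K₁ to p meets the origin only if p is a multiple of a point of K₁, and such
multiples form a null set. -/
theorem exists_transverse_surface_S3 {K₁ K₂ : ClosedCurve S3} (hd : K₁.Disjoint K₂) :
    ∃ F : BoundedSurface S3 K₁, IsTransverse F K₂ := by
  set B := range fun q : R4 => q 0 • K₁.toFun (q 1) with hB
  have b : volume B = 0 := by
    refine volume_range_eq_zero ?_ ?_
    · have h2 := K₁.smooth
      fun_prop
    · intro q s
      simp
  refine exists_transverse_surface isSpaceForm_S3 isConeOver_S3 hd (O := Bᶜ) ?_ ?_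
  · intro hz
    have := measure_union_null b hz
    rw [union_compl_self] at this
    exact (isOpen_univ.measure_pos (volume : Measure R4) univ_nonempty).ne' this
  · rintro p hp ⟨u, v⟩ - hz
    simp only [segmentMap] at hz
    by_cases hv : v = 0
    · have h1 : euc (K₁.toFun (K₁.period * u)) (K₁.toFun (K₁.period * u)) = 1 := K₁.mem _
      have h2 : K₁.toFun (K₁.period * u) = 0 := by simpa [hv] using hz
      rw [h2] at h1
      simp [euc] at h1
    · refine hp ⟨![-((1 - v) / v), K₁.period * u, 0, 0], ?_⟩
      ext i
      have := congrFun hz i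
      simp only [Pi.add_apply, Pi.smul_apply, smul_eq_mul, Pi.zero_apply] at this
      simp
      field_simp
      linarith

/-- Cauchy–Schwarz for the spatial parts, each shorter than the time component. It makes the open
future cone convex. -/
theorem form_neg_one_pos_of_convex {x p : R4} (hx : 0 < form (-1) x x ∧ 0 < x 0)
    (hp : 0 < form (-1) p p ∧ 0 < p 0) : 0 < form (-1) x p := by
  obtain ⟨h1, h2⟩ := hx
  obtain ⟨h3, h4⟩ := hp
  simp only [form] at *
  have cs : (x 1 * p 1 + x 2 * p 2 + x 3 * p 3) ^ 2 ≤
      (x 1 ^ 2 + x 2 ^ 2 + x 3 ^ 2) * (p 1 ^ 2 + p 2 ^ 2 + p 3 ^ 2) := by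
    nlinarith [sq_nonneg (x 1 * p 2 - x 2 * p 1), sq_nonneg (x 1 * p 3 - x 3 * p 1),
      sq_nonneg (x 2 * p 3 - x 3 * p 2)]
  have lt : (x 1 ^ 2 + x 2 ^ 2 + x 3 ^ 2) * (p 1 ^ 2 + p 2 ^ 2 + p 3 ^ 2) <
      (x 0 ^ 2) * (p 0 ^ 2) :=
    mul_lt_mul'' (by linarith) (by linarith) (by positivity) (by positivity)
  have := abs_lt_of_sq_lt_sq' (a := x 1 * p 1 + x 2 * p 2 + x 3 * p 3) (b := x 0 * p 0)
    (by nlinarith) (by positivity)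
  linarith [this.2]

/-- The open future cone is convex and contains `H3`, so any apex in it is admissible. -/
theorem exists_transverse_surface_H3 {K₁ K₂ : ClosedCurve H3} (hd : K₁.Disjoint K₂) :
    ∃ F : BoundedSurface H3 K₁, IsTransverse F K₂ := by
  refine exists_transverse_surface isSpaceForm_H3 isConeOver_H3 hd
    (O := {W | 0 < form (-1) W W ∧ 0 < W 0}) ?_ ?_
  · refine (IsOpen.measure_pos volume ?_ ⟨Pi.single 0 1, ?_⟩).ne'
    · exact (isOpen_lt continuous_const (continuous_form_self _)).inter
        (isOpen_lt continuous_const (continuous_apply 0))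
    · simp [form]
  · rintro p hp ⟨u, v⟩ ⟨-, hv0, hv1⟩
    have hm := K₁.mem (K₁.period * u)
    set x := K₁.toFun (K₁.period * u) with hx
    have hxC : 0 < form (-1) x x ∧ 0 < x 0 := by
      rw [form_neg_one, hm.1]
      exact ⟨one_pos, hm.2⟩
    have hxp := form_neg_one_pos_of_convex hxC hp
    simp only at hv0 hv1
    have hv1 : 0 ≤ 1 - v := by linarith
    have e : form (-1) (segmentMap K₁ p (u, v)) (segmentMap K₁ p (u, v)) =
        (1 - v) ^ 2 * form (-1) x x + 2 * ((1 - v) * v) * form (-1) x p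
          + v ^ 2 * form (-1) p p := by
      simp only [segmentMap, form, Pi.add_apply, Pi.smul_apply, smul_eq_mul, ← hx]
      ring
    have e0 : segmentMap K₁ p (u, v) 0 = (1 - v) * x 0 + v * p 0 := by
      simp [segmentMap, hx]
    change 0 < _ ∧ 0 < _
    rw [e, e0]
    rcases hv0.eq_or_lt with h | h
    · rw [← h]
      simpa using hxC
    · exact ⟨by have := hxC.1; have := hp.1; positivity,
        by have := hxC.2; have := hp.2; positivity⟩

end

end LinkingIntegral

namespace LinkingIntegral
open Set Filter Topology MeasureTheory

/-! ### The linking number -/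

section
variable {σ lam : ℝ} {h h1 h2 : ℝ → ℝ} {M : Set R4}

/-- Because 4π lam ≠ 0, the integral determines the intersection number of every transverse surface,
so all of them agree; symmetry of the integral covers both choices of the bounding curve. -/
theorem IsLinkingKernel.exists_isLinkingNumber (hk : IsLinkingKernel σ lam h h1 h2)
    (hM : IsSpaceForm σ M) (hlam : 0 < lam)
    (ex : ∀ {K₁ K₂ : ClosedCurve M}, K₁.Disjoint K₂ → ∃ F : BoundedSurface M K₁, IsTransverse F K₂)
    {K₁ K₂ : ClosedCurve M} (hd : K₁.Disjoint K₂) :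
    ∃ n : ℤ, IsLinkingNumber K₁ K₂ n ∧
      integralOver (kernelIntegrand σ h1) K₁ K₂ = 4 * Real.pi * lam * (n : ℝ) := by
  have hd' : K₂.Disjoint K₁ := fun s t e => hd t s e.symm
  obtain ⟨F, hF⟩ := ex hd
  have hn := hk.integralOver_eq hM hd F hF
  have cancel : ∀ m : ℤ, integralOver (kernelIntegrand σ h1) K₁ K₂ = 4 * Real.pi * lam * (m : ℝ) →
      m = intersectionNumber F K₂ := fun m hm => by
    have pos : 4 * Real.pi * lam ≠ 0 := by positivity
    exact_mod_cast mul_left_cancel₀ pos (hm.symm.trans hn)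
  refine ⟨intersectionNumber F K₂, ⟨⟨F, hF⟩, fun G hG => cancel _ (hk.integralOver_eq hM hd G hG),
    ex hd', fun G hG => cancel _ ?_⟩, hn⟩
  rw [← integralOver_kernelIntegrand_comm]
  exact hk.integralOver_eq hM hd' G hG

end

theorem Continuous.integrableOver {M : Set R4} {I : R4 → R4 → R4 → R4 → ℝ} {K₁ K₂ : ClosedCurve M}
    (h : Continuous (pullback I K₁ K₂)) : IntegrableOver I K₁ K₂ :=
  h.continuousOn.integrableOn_compact (isCompact_paramBox K₁ K₂)

/-! ### Gradients -/

/-- The metric `g`, the distance `d` and the smooth curves of `S3` and `H3`. -/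
structure IsMetricSpaceForm (σ : ℝ) (M : Set R4) (g d : R4 → R4 → ℝ) : Prop
    extends IsSpaceForm σ M where
  metric_eq : ∀ v w, g v w = σ * form σ v w
  exists_curve : ∀ y ∈ M, ∀ v, form σ y v = 0 →
    ∃ c : ℝ → R4, ContDiff ℝ ∞ c ∧ (∀ t, c t ∈ M) ∧ c 0 = y ∧ HasDerivAt c v 0
  nondegenerate : ∀ u, (∀ z ∈ M, form σ u z = 0) → u = 0
  form_eq_of_dist_eq : ∀ x ∈ M, ∀ y ∈ M, ∀ x' ∈ M, ∀ y' ∈ M, d x y = d x' y' →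
    form σ x y = form σ x' y'

/-- A tangent vector v at y is the velocity of the normalized line y + tv, and the standard basis
lies in `S3`. -/
theorem isMetricSpaceForm_S3 : IsMetricSpaceForm 1 S3 metricS distS where
  toIsSpaceForm := isSpaceForm_S3
  metric_eq v w := by rw [form_one, one_mul, metricS]
  exists_curve y hy v hv := by
    have hy1 : form 1 y y = 1 := isSpaceForm_S3.form_self y hy
    have e : ∀ t : ℝ, form 1 (y + t • v) (y + t • v) = 1 + t ^ 2 * form 1 v v := fun t => by
      rw [form_add_left, form_add_right, form_add_right, form_smul_left, form_smul_left,
        form_smul_right, form_smul_right, hy1, form_comm 1 v y, hv]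
      ring
    have v0 : 0 ≤ form 1 v v := by
      rw [form_one, euc]
      nlinarith [mul_self_nonneg (v 0), mul_self_nonneg (v 1), mul_self_nonneg (v 2),
        mul_self_nonneg (v 3)]
    have pos : ∀ t : ℝ, 0 < 1 + t ^ 2 * form 1 v v := fun t => by positivity
    have sm : ContDiff ℝ ∞ fun t : ℝ => (√(1 + t ^ 2 * form 1 v v))⁻¹ := by
      refine ContDiff.inv (ContDiff.sqrt (by fun_prop) fun t => (pos t).ne') fun t => ?_
      exact (Real.sqrt_pos.mpr (pos t)).ne'
    refine ⟨fun t => (√(1 + t ^ 2 * form 1 v v))⁻¹ • (y + t • v), sm.smul (by fun_prop), ?_,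
      by simp, ?_⟩
    · intro t
      have := isConeOver_S3.normalize_mem (y + t • v) ?_
      · rwa [normalize, e] at this
      · intro h0
        have := e t
        rw [h0] at this
        have := pos t
        simp [form] at *
        linarith
    · have d1 : HasDerivAt (fun t : ℝ => (√(1 + t ^ 2 * form 1 v v))⁻¹) 0 0 := by
        have d0 : HasDerivAt (fun t : ℝ => 1 + t ^ 2 * form 1 v v) 0 0 := by
          simpa using (((hasDerivAt_pow 2 (0 : ℝ)).mul_const (form 1 v v)).const_add 1)
        have := (d0.sqrt (pos 0).ne').inv (Real.sqrt_pos.mpr (pos 0)).ne'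
        refine this.congr_deriv ?_
        simp
      have := d1.smul (((hasDerivAt_id (0 : ℝ)).smul_const v).const_add y)
      refine this.congr_deriv ?_
      simp
  nondegenerate u hu := by
    have h : ∀ i, (Pi.single i 1 : R4) ∈ S3 := fun i => by
      fin_cases i <;> simp [S3, euc]
    ext i
    have := hu _ (h i)
    fin_cases i <;> simpa [form] using this
  form_eq_of_dist_eq x hx y hy x' hx' y' hy' h := by
    have mem : ∀ x ∈ S3, ∀ y ∈ S3, euc x y ∈ Icc (-1 : ℝ) 1 := fun x hx y hy => by
      simp only [S3, mem_ofPred_eq, euc] at *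
      constructor
      · nlinarith [sq_nonneg (x 0 + y 0), sq_nonneg (x 1 + y 1), sq_nonneg (x 2 + y 2),
          sq_nonneg (x 3 + y 3)]
      · nlinarith [sq_nonneg (x 0 - y 0), sq_nonneg (x 1 - y 1), sq_nonneg (x 2 - y 2),
          sq_nonneg (x 3 - y 3)]
    rw [form_one, form_one]
    exact Real.arccos_injOn (mem x hx y hy) (mem x' hx' y' hy') h

theorem one_le_mink {x y : R4} (hx : x ∈ H3) (hy : y ∈ H3) : 1 ≤ mink x y := by
  have := isSpaceForm_H3.gap_nonneg hx hy
  rw [gap, form_neg_one] at this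
  linarith

/-- A tangent vector v at y is the velocity of √(1 + t² g(v, v)) y + tv, kept on the upper sheet by
`metricH_bound`. The points e₀ and √2 e₀ + eᵢ of `H3` span the whole space. -/
theorem isMetricSpaceForm_H3 : IsMetricSpaceForm (-1) H3 metricH distH where
  toIsSpaceForm := isSpaceForm_H3
  metric_eq v w := by rw [form_neg_one, metricH]; ring
  exists_curve y hy v hv := by
    rw [form_neg_one] at hv
    have v0 : 0 ≤ metricH v v := by
      by_cases h : v = 0
      · simp [h, metricH, mink]
      · exact (metricH_pos hy hv h).le
    have pos : ∀ t : ℝ, 0 < 1 + t ^ 2 * metricH v v := fun t => by positivity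
    refine ⟨fun t => √(1 + t ^ 2 * metricH v v) • y + t • v, ?_, ?_, by simp, ?_⟩
    · exact ((ContDiff.sqrt (by fun_prop) fun t => (pos t).ne').smul contDiff_const).add
        (by fun_prop)
    · intro t
      have hs := Real.sq_sqrt (pos t).le
      set r := √(1 + t ^ 2 * metricH v v) with hr
      have hr0 : 0 < r := Real.sqrt_pos.mpr (pos t)
      have e : mink (r • y + t • v) (r • y + t • v) =
          r ^ 2 * mink y y + 2 * r * t * mink y v + t ^ 2 * mink v v := by
        simp only [mink, Pi.add_apply, Pi.smul_apply, smul_eq_mul]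
        ring
      refine ⟨?_, ?_⟩
      · rw [e, hv, hs, hy.1, metricH]
        ring
      · have hb := metricH_bound hy hv
        have hy0 := hy.2
        have lt : (t * v 0) ^ 2 < (r * y 0) ^ 2 := by
          have h1 : t ^ 2 * v 0 ^ 2 ≤ t ^ 2 * (metricH v v * (y 0 ^ 2 - 1)) :=
            mul_le_mul_of_nonneg_left hb (sq_nonneg t)
          have h2 : 0 ≤ t ^ 2 * metricH v v := by positivity
          rw [mul_pow, mul_pow, hs]
          nlinarith [sq_pos_of_pos hy0]
        have := (abs_lt_of_sq_lt_sq' lt (by positivity)).1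
        simp only [Pi.add_apply, Pi.smul_apply, smul_eq_mul]
        linarith
    · have d0 : HasDerivAt (fun t : ℝ => 1 + t ^ 2 * metricH v v) 0 0 := by
        simpa using (((hasDerivAt_pow 2 (0 : ℝ)).mul_const (metricH v v)).const_add 1)
      have := ((d0.sqrt (pos 0).ne').smul_const y).add ((hasDerivAt_id (0 : ℝ)).smul_const v)
      refine this.congr_deriv ?_
      simp
  nondegenerate u hu := by
    have h0 : (Pi.single 0 1 : R4) ∈ H3 := by simp [H3, mink]
    have h : ∀ i, i ≠ 0 → (√2 • Pi.single 0 1 + Pi.single i 1 : R4) ∈ H3 := fun i hi => by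
      fin_cases i
      · exact absurd rfl hi
      all_goals
        simp [H3, mink]
        norm_num
    have u0 : u 0 = 0 := by simpa [form] using hu _ h0
    have u1 := hu _ (h 1 (by decide))
    have u2 := hu _ (h 2 (by decide))
    have u3 := hu _ (h 3 (by decide))
    simp [form, u0] at u1 u2 u3
    ext i
    fin_cases i <;> simpa
  form_eq_of_dist_eq x hx y hy x' hx' y' hy' h := by
    rw [form_neg_one, form_neg_one]
    exact Real.arcosh_injOn (one_le_mink hx hy) (one_le_mink hx' hy') h

section
variable {σ : ℝ} {M : Set R4} {g d : R4 → R4 → ℝ}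

theorem IsMetricSpaceForm.isTangent_iff (hM : IsMetricSpaceForm σ M g d) {x v : R4} :
    IsTangent g x v ↔ form σ x v = 0 := by
  have : σ ≠ 0 := fun h => by simpa [h] using hM.sq
  simp [IsTangent, hM.metric_eq, this]

/-- Gradients are unique, so the choice in `grad` is harmless: two candidates u, w are compared
along a curve with velocity u - w, and the metric is positive definite. -/
theorem IsMetricSpaceForm.grad_eq (hM : IsMetricSpaceForm σ M g d) {f : R4 → ℝ} {y w : R4}
    (hy : y ∈ M) (hw : IsGradient M g f y w) : grad M g f y = w := by
  have ex : ∃ w, IsGradient M g f y w := ⟨w, hw⟩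
  rw [grad, dif_pos ex]
  have hu := ex.choose_spec
  set u := ex.choose
  have t1 := hM.isTangent_iff.mp hu.1
  have t2 := hM.isTangent_iff.mp hw.1
  by_contra hne
  have t3 : form σ y (u - w) = 0 := by rw [form_sub_right, t1, t2, sub_zero]
  obtain ⟨c, sm, cM, c0, dc⟩ := hM.exists_curve y hy _ t3
  have := (hu.2 c sm cM c0).unique (hw.2 c sm cM c0)
  rw [dc.deriv, hM.metric_eq, hM.metric_eq, ← sub_eq_zero, ← mul_sub, ← form_sub_left] at this
  exact (hM.metric_pos y hy _ t3 (sub_ne_zero.mpr hne)).ne' this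

/-- The gradient of a function of the distance to `x`. -/
theorem IsMetricSpaceForm.grad_comp_gap (hM : IsMetricSpaceForm σ M g d) {f : R4 → ℝ} {φ : ℝ → ℝ}
    {φ' : ℝ} {x y : R4} (hy : y ∈ M) (hxy : x ≠ y)
    (hf : ∀ z ∈ M, x ≠ z → f z = φ (gap σ x z)) (hφ : HasDerivAt φ φ' (gap σ x y)) :
    grad M g f y = (-φ') • (x - form σ x y • y) := by
  refine hM.grad_eq hy ⟨?_, ?_⟩
  · rw [hM.isTangent_iff, form_smul_right, form_sub_right, form_smul_right, hM.form_self y hy,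
      form_comm σ y x]
    ring
  · intro c sm cM c0
    have dc : HasDerivAt c (deriv c 0) 0 := (sm.differentiable (by simp) 0).hasDerivAt
    have ev : (fun t => f (c t)) =ᶠ[𝓝 0] fun t => φ (gap σ x (c t)) := by
      have : ∀ᶠ t in 𝓝 (0 : ℝ), c t ≠ x := dc.continuousAt.eventually_ne (by rw [c0]; exact hxy.symm)
      filter_upwards [this] with t ht using hf _ (cM t) ht.symm
    have tan : form σ y (deriv c 0) = 0 := by
      have a := hasDerivAt_form (σ := σ) dc dc
      have b : HasDerivAt (fun t => form σ (c t) (c t)) 0 0 := by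
        simp only [hM.form_self _ (cM _)]
        exact hasDerivAt_const 0 1
      have := a.unique b
      rw [form_comm σ (deriv c 0), c0] at this
      linarith
    have dg := hasDerivAt_gap (σ := σ) (hasDerivAt_const (0 : ℝ) x) dc
    have hφ : HasDerivAt φ φ' (gap σ x (c 0)) := by rwa [c0]
    refine ((hφ.comp 0 dg).congr_of_eventuallyEq ev).congr_deriv ?_
    rw [hM.metric_eq, form_smul_left, form_sub_left, form_smul_left, tan]
    simp [form]
    ring

/-! ### Isometries -/

variable {f : R4 → R4}

theorem IsMetricSpaceForm.form_map (hM : IsMetricSpaceForm σ M g d)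
    (hf : IsOrientedIsometry M g d f) {x y : R4} (hx : x ∈ M) (hy : y ∈ M) :
    form σ (f x) (f y) = form σ x y :=
  hM.form_eq_of_dist_eq _ (hf.bijOn.mapsTo hx) _ (hf.bijOn.mapsTo hy) _ hx _ hy
    (hf.dist_eq x hx y hy)

theorem IsOrientedIsometry.hasDerivAt_comp (hf : IsOrientedIsometry M g d f) {c : ℝ → R4} {v : R4}
    (hc : HasDerivAt c v 0) : HasDerivAt (fun t => f (c t)) (fderiv ℝ f (c 0) v) 0 :=
  (hf.smooth.differentiable (by simp) (c 0)).hasFDerivAt.comp_hasDerivAt 0 hc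

/-- Isometries are only assumed to preserve distances, hence inner products of points.
Differentiating along a curve with velocity v carries this over to the differential; differentiating
again in y gives `form_fderiv_fderiv`. -/
theorem IsMetricSpaceForm.form_fderiv_left (hM : IsMetricSpaceForm σ M g d)
    (hf : IsOrientedIsometry M g d f) {x y v : R4} (hx : x ∈ M) (hy : y ∈ M)
    (hv : form σ x v = 0) : form σ (fderiv ℝ f x v) (f y) = form σ v y := by
  obtain ⟨c, -, cM, rfl, dc⟩ := hM.exists_curve x hx v hv
  have a := hasDerivAt_form (σ := σ) (hf.hasDerivAt_comp dc) (hasDerivAt_const (0 : ℝ) (f y))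
  have b := hasDerivAt_form (σ := σ) dc (hasDerivAt_const (0 : ℝ) y)
  simp only [hM.form_map hf (cM _) hy] at a
  simpa [form] using a.unique b

theorem IsMetricSpaceForm.form_fderiv_fderiv (hM : IsMetricSpaceForm σ M g d)
    (hf : IsOrientedIsometry M g d f) {x y v w : R4} (hx : x ∈ M) (hy : y ∈ M)
    (hv : form σ x v = 0) (hw : form σ y w = 0) :
    form σ (fderiv ℝ f x v) (fderiv ℝ f y w) = form σ v w := by
  obtain ⟨c, -, cM, rfl, dc⟩ := hM.exists_curve y hy w hw
  have a := hasDerivAt_form (σ := σ) (hasDerivAt_const (0 : ℝ) (fderiv ℝ f x v))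
    (hf.hasDerivAt_comp dc)
  have b := hasDerivAt_form (σ := σ) (hasDerivAt_const (0 : ℝ) v) dc
  simp only [hM.form_fderiv_left hf hx (cM _) hv] at a
  simpa [form] using a.unique b

/-- Surjectivity onto M and nondegeneracy: pairings with image points determine a vector. This lets
linear relations be carried through f although f itself is not assumed linear. -/
theorem IsMetricSpaceForm.eq_of_form_map (hM : IsMetricSpaceForm σ M g d)
    (hf : IsOrientedIsometry M g d f) {a b : R4}
    (h : ∀ z ∈ M, form σ a (f z) = form σ b (f z)) : a = b := by
  rw [← sub_eq_zero]
  refine hM.nondegenerate _ fun z hz => ?_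
  obtain ⟨p, hp, rfl⟩ := hf.bijOn.surjOn hz
  rw [form_sub_left, h p hp, sub_self]

/-- Equal Gram determinants give equality up to sign, and the orientation fixes the sign; a negative
triple becomes positive after a swap. -/
theorem IsMetricSpaceForm.vol_fderiv (hM : IsMetricSpaceForm σ M g d)
    (hf : IsOrientedIsometry M g d f) {x u v w : R4} (hx : x ∈ M) (hu : form σ x u = 0)
    (hv : form σ x v = 0) (hw : form σ x w = 0) :
    vol (f x) (fderiv ℝ f x u) (fderiv ℝ f x v) (fderiv ℝ f x w) = vol x u v w := by
  have t : ∀ v, form σ x v = 0 → form σ (f x) (fderiv ℝ f x v) = 0 := fun v hv => by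
    rw [form_comm, hM.form_fderiv_left hf hx hx hv, form_comm, hv]
  have sq : vol (f x) (fderiv ℝ f x u) (fderiv ℝ f x v) (fderiv ℝ f x w) ^ 2 = vol x u v w ^ 2 := by
    rw [vol_sq_eq_gram σ hM.sq x u v w (hM.form_self x hx) hu hv hw,
      vol_sq_eq_gram σ hM.sq _ _ _ _ (hM.form_self _ (hf.bijOn.mapsTo hx)) (t u hu) (t v hv)
        (t w hw)]
    simp only [hM.form_fderiv_fderiv hf hx hx, hu, hv, hw]
  have or := hf.oriented x hx
  simp only [hM.isTangent_iff] at or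
  rcases lt_trichotomy (vol x u v w) 0 with h | h | h
  · have sw : ∀ a b c d : R4, vol a b d c = -vol a b c d := fun a b c d => by
      simp only [vol_eq]; ring
    have := or u w v hu hw hv (by rw [sw]; linarith)
    rw [sw] at this
    nlinarith
  · rw [h] at sq ⊢
    exact pow_eq_zero_iff two_ne_zero |>.mp (by simpa using sq)
  · have := or u v w hu hv hw h
    nlinarith

/-- A function of inner products and volumes is invariant under isometries. -/
theorem IsMetricSpaceForm.isometryInvariant (hM : IsMetricSpaceForm σ M g d)
    (J : ℝ → ℝ → ℝ → ℝ → ℝ → ℝ) {I : R4 → R4 → R4 → R4 → ℝ}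
    (h : ∀ x ∈ M, ∀ y ∈ M, x ≠ y → ∀ v w, form σ x v = 0 → form σ y w = 0 →
      I x v y w = J (form σ x y) (form σ v w) (form σ v y) (form σ x w) (vol x v y w)) :
    IsometryInvariant M g d I := by
  intro f hf x hx y hy hxy v w hv hw
  rw [hM.isTangent_iff] at hv hw
  have fx := hf.bijOn.mapsTo hx
  have fy := hf.bijOn.mapsTo hy
  have tv : form σ (f x) (fderiv ℝ f x v) = 0 := by
    rw [form_comm, hM.form_fderiv_left hf hx hx hv, form_comm, hv]
  have tw : form σ (f y) (fderiv ℝ f y w) = 0 := by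
    rw [form_comm, hM.form_fderiv_left hf hy hy hw, form_comm, hw]
  have fxw : form σ (f x) (fderiv ℝ f y w) = form σ x w := by
    rw [form_comm, hM.form_fderiv_left hf hy hx hw, form_comm]
  -- Removing the x-components moves y and w into the tangent space at x without changing the
  -- volume. Below, f y and the image of w split over f x with the same coefficients.
  set y' := y - form σ x y • x with hy'
  set w' := w - form σ x w • x with hw'
  have ty : form σ x y' = 0 := by
    rw [hy', form_sub_right, form_smul_right, hM.form_self x hx]; ring
  have tw' : form σ x w' = 0 := by
    rw [hw', form_sub_right, form_smul_right, hM.form_self x hx]; ring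
  have ey : f y = form σ x y • f x + fderiv ℝ f x y' := hM.eq_of_form_map hf fun z hz => by
    rw [form_add_left, form_smul_left, hM.form_map hf hx hz, hM.form_map hf hy hz,
      hM.form_fderiv_left hf hx hz ty, hy', form_sub_left, form_smul_left]
    ring
  have ew : fderiv ℝ f y w = form σ x w • f x + fderiv ℝ f x w' :=
    hM.eq_of_form_map hf fun z hz => by
      rw [form_add_left, form_smul_left, hM.form_map hf hx hz, hM.form_fderiv_left hf hy hz hw,
        hM.form_fderiv_left hf hx hz tw', hw', form_sub_left, form_smul_left]
      ring
  have add : ∀ (a b : ℝ) (x v p q : R4), vol x v (a • x + p) (b • x + q) = vol x v p q :=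
    fun a b x v p q => by
      simp only [vol_eq, Pi.add_apply, Pi.smul_apply, smul_eq_mul]; ring
  have ev : vol (f x) (fderiv ℝ f x v) (f y) (fderiv ℝ f y w) = vol x v y w := by
    rw [ey, ew, add, hM.vol_fderiv hf hx hv ty tw', ← add (form σ x y) (form σ x w), hy', hw',
      add_sub_cancel, add_sub_cancel]
  rw [h _ fx _ fy (hf.bijOn.injOn.ne hx hy hxy) _ _ tv tw, h x hx y hy hxy v w hv hw,
    hM.form_map hf hx hy, hM.form_fderiv_fderiv hf hx hy hv hw,
    hM.form_fderiv_left hf hx hy hv, fxw, ev]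

end

end LinkingIntegral

namespace LinkingIntegral
open Set Filter Topology MeasureTheory

/-! ### The kernels as functions of the gap -/

theorem gap_S3_bounds {x z : R4} (hx : x ∈ S3) (hz : z ∈ S3) (h : x ≠ z) :
    0 < distS x z ∧ Real.cos (distS x z) = euc x z := by
  have hg := isSpaceForm_S3.gap_pos x hx z hz h
  rw [form_one] at hg
  have hm : -1 ≤ euc x z := by
    simp only [S3, mem_ofPred_eq, euc] at *
    nlinarith [sq_nonneg (x 0 + z 0), sq_nonneg (x 1 + z 1), sq_nonneg (x 2 + z 2),
      sq_nonneg (x 3 + z 3)]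
  exact ⟨Real.arccos_pos.mpr (by linarith), Real.cos_arccos hm (by linarith)⟩

theorem kernelCsc_distS {x z : R4} (hx : x ∈ S3) (hz : z ∈ S3) (h : x ≠ z) :
    kernelCsc (distS x z) = cscGap (gap 1 x z) := by
  obtain ⟨h0, hc⟩ := gap_S3_bounds hx hz h
  have hg : gap 1 x z = 1 - Real.cos (distS x z) := by rw [gap, form_one, hc]; ring
  rw [hg, kernelCsc]
  split_ifs with hpi
  · rw [hpi, Real.cos_pi, sub_neg_eq_add, one_add_one_eq_two, cscGap_two]
  · have hlt : distS x z < Real.pi := lt_of_le_of_ne (Real.arccos_le_pi _) hpi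
    have := (Real.sin_pos_of_pos_of_lt_pi h0 hlt).ne'
    rw [← sin_mul_cscGap h0 hlt.le]
    field_simp

theorem kernelCot_distS {x z : R4} (hx : x ∈ S3) (hz : z ∈ S3) (h : x ≠ z) :
    kernelCot (distS x z) = (1 - gap 1 x z) * cscGap (gap 1 x z) := by
  obtain ⟨h0, hc⟩ := gap_S3_bounds hx hz h
  have hg : gap 1 x z = 1 - Real.cos (distS x z) := by rw [gap, form_one, hc]; ring
  rw [hg, kernelCot]
  split_ifs with hpi
  · rw [hpi, Real.cos_pi, sub_neg_eq_add, one_add_one_eq_two, cscGap_two]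
    norm_num
  · have hlt : distS x z < Real.pi := lt_of_le_of_ne (Real.arccos_le_pi _) hpi
    have := (Real.sin_pos_of_pos_of_lt_pi h0 hlt).ne'
    rw [← sin_mul_cscGap h0 hlt.le, Real.cot_eq_cos_div_sin]
    field_simp
    ring

theorem kernelCsch_distH {x z : R4} (hx : x ∈ H3) (hz : z ∈ H3) :
    kernelCsch (distH x z) = cschGap (gap (-1) x z) := by
  rw [kernelCsch, distH, Real.sinh_arcosh (one_le_mink hx hz), cschGap, gap, form_neg_one]
  congr 2
  ring

/-! ### Explicit forms of the integrands -/

/-- Transport changes v by a multiple of x + y, and the gradient is a combination of x and y;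
alternation of the determinant removes everything but the x-part of the gradient. -/
theorem vol_transport (a b c : ℝ) (x v y w : R4) :
    vol y (v - a • (x + y)) w (b • (x - c • y)) = b * vol x v y w := by
  simp only [vol_eq, Pi.add_apply, Pi.sub_apply, Pi.smul_apply, smul_eq_mul]
  ring

theorem transportIntegrandS_eq {x y : R4} (hx : x ∈ S3) (hy : y ∈ S3) (hxy : x ≠ y) (v w : R4) :
    transportIntegrandS x v y w = kernelIntegrand 1 cscGapDeriv x v y w := by
  rw [transportIntegrandS, metricS_crossS, isMetricSpaceForm_S3.grad_comp_gap hy hxy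
    (fun z hz hxz => kernelCsc_distS hx hz hxz)
    (hasDerivAt_cscGap (isSpaceForm_S3.gap_pos x hx y hy hxy)), transportS, vol_transport]
  rfl

theorem transportIntegrandH_eq {x y : R4} (hx : x ∈ H3) (hy : y ∈ H3) (hxy : x ≠ y) (v w : R4) :
    transportIntegrandH x v y w = kernelIntegrand (-1) cschGapDeriv x v y w := by
  rw [transportIntegrandH, metricH_crossH, isMetricSpaceForm_H3.grad_comp_gap hy hxy
    (fun z hz _ => kernelCsch_distH hx hz)
    (hasDerivAt_cschGap (isSpaceForm_H3.gap_pos x hx y hy hxy)), transportH, vol_transport]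
  rfl

theorem toQuat_re (x : R4) : (toQuat x).re = x 0 := rfl

theorem toQuat_imI (x : R4) : (toQuat x).imI = x 1 := rfl

theorem toQuat_imJ (x : R4) : (toQuat x).imJ = x 2 := rfl

theorem toQuat_imK (x : R4) : (toQuat x).imK = x 3 := rfl

theorem inv_toQuat {x : R4} (hx : x ∈ S3) : (toQuat x)⁻¹ = star (toQuat x) := by
  have : Quaternion.normSq (toQuat x) = 1 := by
    rw [Quaternion.normSq_def', toQuat_re, toQuat_imI, toQuat_imJ, toQuat_imK]
    exact Eq.trans (by rw [euc]; ring) hx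
  rw [Quaternion.inv_def, this, inv_one, one_smul]

/-- Left multiplication by a quaternion, in coordinates. -/
def quatMul (p v : R4) : R4 :=
  ![p 0 * v 0 - p 1 * v 1 - p 2 * v 2 - p 3 * v 3, p 0 * v 1 + p 1 * v 0 + p 2 * v 3 - p 3 * v 2,
    p 0 * v 2 - p 1 * v 3 + p 2 * v 0 + p 3 * v 1, p 0 * v 3 + p 1 * v 2 - p 2 * v 1 + p 3 * v 0]

theorem ofQuat_mul (p q : Quaternion ℝ) : ofQuat (p * q) = quatMul (ofQuat p) (ofQuat q) := by
  simp only [ofQuat, quatMul, Quaternion.re_mul, Quaternion.imI_mul, Quaternion.imJ_mul,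
    Quaternion.imK_mul]
  rfl

theorem ofQuat_star (x : R4) : ofQuat (star (toQuat x)) = ![x 0, -x 1, -x 2, -x 3] := by
  simp only [ofQuat, Quaternion.re_star, Quaternion.imI_star, Quaternion.imJ_star,
    Quaternion.imK_star]
  rfl

theorem ofQuat_toQuat (x : R4) : ofQuat (toQuat x) = x := by
  ext i
  fin_cases i <;> rfl

theorem leftTranslate_eq {x : R4} (hx : x ∈ S3) (y v : R4) :
    leftTranslate x y v = quatMul (quatMul y ![x 0, -x 1, -x 2, -x 3]) v := by
  rw [leftTranslate, inv_toQuat hx, ofQuat_mul, ofQuat_mul, ofQuat_star, ofQuat_toQuat,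
    ofQuat_toQuat]

/-- Rewriting the quaternion product y x⁻¹ v by inner products and one volume makes isometry
invariance visible. -/
theorem euc_leftTranslate {x : R4} (hx : x ∈ S3) (y v w : R4) :
    euc (leftTranslate x y v) w =
      euc x y * euc v w + euc x v * euc y w - euc v y * euc x w - vol x v y w := by
  rw [leftTranslate_eq hx]
  simp [quatMul, euc, vol_eq]
  ring

theorem vol_leftTranslate {x : R4} (hx : x ∈ S3) (y v w : R4) :
    vol y (leftTranslate x y v) w x = euc x y * vol x v y w
      - (euc x y * (euc v w * euc x y - euc x v * euc y w)
        - euc x w * (euc v y * euc x y - euc x v * euc y y)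
        + euc x x * (euc v y * euc y w - euc v w * euc y y)) := by
  rw [leftTranslate_eq hx]
  simp [quatMul, euc, vol_eq]
  ring

/-- The left-translation correction term on tangent vectors. -/
noncomputable def correctionForm (c vw vy xw V : ℝ) : ℝ := c * vw - V - vy * xw

theorem leftCorrection_eq {x y v w : R4} (hx : x ∈ S3) (hv : form 1 x v = 0) :
    leftCorrection x v y w =
      correctionForm (form 1 x y) (form 1 v w) (form 1 v y) (form 1 x w) (vol x v y w) := by
  rw [form_one] at hv
  simp only [leftCorrection, metricS, euc_leftTranslate hx, form_one, correctionForm, hv]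
  ring

/-- The kernel is φ = (1 - w)h(w) with h = `cscGap`, so -φ' = h - ⟨x, y⟩h'; the other factor comes
from `vol_leftTranslate`. -/
theorem leftIntegrand_eq {x y v w : R4} (hx : x ∈ S3) (hy : y ∈ S3) (hxy : x ≠ y)
    (hv : form 1 x v = 0) (hw : form 1 y w = 0) :
    leftIntegrand x v y w =
      (cscGap (gap 1 x y) - form 1 x y * cscGapDeriv (gap 1 x y)) * (form 1 v w - form 1 x y *
        correctionForm (form 1 x y) (form 1 v w) (form 1 v y) (form 1 x w) (vol x v y w)) := by
  have hg := isSpaceForm_S3.gap_pos x hx y hy hxy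
  have d := ((hasDerivAt_id (gap 1 x y)).const_sub 1).mul (hasDerivAt_cscGap hg)
  rw [leftIntegrand, metricS_crossS, isMetricSpaceForm_S3.grad_comp_gap hy hxy
    (fun z hz hxz => kernelCot_distS hx hz hxz) d]
  have e : ∀ (a b : ℝ) (u : R4), vol y u w (a • (x - b • y)) = a * vol y u w x := by
    intro a b u
    simp only [vol_eq, Pi.sub_apply, Pi.smul_apply, smul_eq_mul]
    ring
  have hg1 : gap 1 x y = 1 - form 1 x y := by rw [gap, one_mul]
  rw [e, vol_leftTranslate hx]
  rw [form_one] at hv hw hg1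
  have hx : euc x x = 1 := hx
  have hy : euc y y = 1 := hy
  simp only [form_one, hv, hw, hx, hy, correctionForm, id_eq]
  rw [hg1]
  ring

/-- The two integrands in left-translation format differ from the integrand in parallel transport
format by a derivative along the second curve. -/
theorem leftIntegrand_sub_leftCorrection {x y v w : R4} (hx : x ∈ S3) (hy : y ∈ S3) (hxy : x ≠ y)
    (hv : form 1 x v = 0) (hw : form 1 y w = 0) :
    leftIntegrand x v y w = leftCorrection x v y w + transportIntegrandS x v y w +
      (cscGap (gap 1 x y) * form 1 v w - cscGapDeriv (gap 1 x y) * form 1 v y * form 1 x w) := by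
  have ode := cscGap_ode (isSpaceForm_S3.gap_pos x hx y hy hxy)
  change (2 * gap 1 x y - _) * cscGapDeriv (gap 1 x y) + _ * cscGap (gap 1 x y) = -1 at ode
  have hg1 : form 1 x y = 1 - gap 1 x y := by rw [gap]; ring
  rw [leftIntegrand_eq hx hy hxy hv hw, leftCorrection_eq hx hv, transportIntegrandS_eq hx hy hxy,
    kernelIntegrand, hg1]
  simp only [correctionForm]
  change (2 * gap 1 x y - 1 * gap 1 x y ^ 2) * _ + (1 - 1 * gap 1 x y) * _ = -1 at ode
  -- The first-order equation is multiplied by minus the correction form; its constant -1 reproduces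
  -- the correction term.
  linear_combination (-((1 - gap 1 x y) * form 1 v w - vol x v y w - form 1 v y * form 1 x w)) * ode

/-! ### Integrals over pairs of disjoint curves -/

section
variable {K₁ K₂ : ClosedCurve S3}

theorem continuous_cscGap_comp (hd : K₁.Disjoint K₂) :
    Continuous (fun p : ℝ × ℝ => cscGap (gap 1 (K₁.toFun p.1) (K₂.toFun p.2))) ∧
      Continuous (fun p : ℝ × ℝ => cscGapDeriv (gap 1 (K₁.toFun p.1) (K₂.toFun p.2))) := by
  have cg : Continuous fun p : ℝ × ℝ => gap 1 (K₁.toFun p.1) (K₂.toFun p.2) :=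
    (contDiff_gap 1).continuous.comp ((K₁.smooth.continuous.comp continuous_fst).prodMk
      (K₂.smooth.continuous.comp continuous_snd))
  have pos : ∀ p : ℝ × ℝ, gap 1 (K₁.toFun p.1) (K₂.toFun p.2) ∈ Ioi (0 : ℝ) := fun p =>
    isSpaceForm_S3.gap_pos _ (K₁.mem _) _ (K₂.mem _) (hd _ _)
  exact ⟨isLinkingKernel_csc.continuousOn_self.comp_continuous cg pos,
    isLinkingKernel_csc.continuousOn_deriv.comp_continuous cg pos⟩

theorem continuous_form_comp (K₁ K₂ : ClosedCurve S3) :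
    Continuous (fun p : ℝ × ℝ => form 1 (deriv K₁.toFun p.1) (deriv K₂.toFun p.2)) ∧
    Continuous (fun p : ℝ × ℝ => form 1 (deriv K₁.toFun p.1) (K₂.toFun p.2)) ∧
    Continuous (fun p : ℝ × ℝ => form 1 (K₁.toFun p.1) (deriv K₂.toFun p.2)) ∧
    Continuous (fun p : ℝ × ℝ => form 1 (K₁.toFun p.1) (K₂.toFun p.2)) ∧
    Continuous (fun p : ℝ × ℝ => vol (K₁.toFun p.1) (deriv K₁.toFun p.1) (K₂.toFun p.2)
      (deriv K₂.toFun p.2)) := by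
  have a := K₁.smooth.continuous
  have b := K₂.smooth.continuous
  have a' := K₁.continuous_deriv
  have b' := K₂.continuous_deriv
  simp only [vol_eq, form]
  refine ⟨?_, ?_, ?_, ?_, ?_⟩ <;> fun_prop

/-- A derivative along the second curve. -/
noncomputable def exactTerm (x v y w : R4) : ℝ :=
  cscGap (gap 1 x y) * form 1 v w - cscGapDeriv (gap 1 x y) * form 1 v y * form 1 x w

theorem continuous_pullback_exactTerm (hd : K₁.Disjoint K₂) :
    Continuous (pullback exactTerm K₁ K₂) := by
  obtain ⟨c0, c1⟩ := continuous_cscGap_comp hd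
  obtain ⟨f1, f2, f3, -⟩ := continuous_form_comp K₁ K₂
  exact (c0.mul f1).sub ((c1.mul f2).mul f3)

/-- For fixed s the integrand is the t-derivative of h(gap)⟨x'(s), y(t)⟩ with h = `cscGap`, which is
periodic in t and, by disjointness, never singular. -/
theorem integralOver_exactTerm (hd : K₁.Disjoint K₂) : integralOver exactTerm K₁ K₂ = 0 := by
  have c := continuous_pullback_exactTerm hd
  have hi := (c.continuousOn (s := paramBox K₁ K₂)).integrableOn_compact (μ := volume)
    (isCompact_paramBox K₁ K₂)
  rw [paramBox, Measure.volume_eq_prod] at hi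
  rw [integralOver, paramBox, Measure.volume_eq_prod, setIntegral_prod _ hi]
  refine integral_eq_zero_of_ae (Eventually.of_forall fun s => ?_)
  change ∫ t in Icc 0 K₂.period, pullback exactTerm K₁ K₂ (s, t) = 0
  rw [integral_Icc_eq_integral_Ioc, ← intervalIntegral.integral_of_le K₂.period_pos.le]
  have d : ∀ t, HasDerivAt (fun t => cscGap (gap 1 (K₁.toFun s) (K₂.toFun t)) *
      form 1 (deriv K₁.toFun s) (K₂.toFun t)) (pullback exactTerm K₁ K₂ (s, t)) t := by
    intro t
    have hg : 0 < gap 1 (K₁.toFun s) (K₂.toFun t) :=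
      isSpaceForm_S3.gap_pos _ (K₁.mem s) _ (K₂.mem t) (hd s t)
    have dh : HasDerivAt cscGap _ _ := hasDerivAt_cscGap hg
    have dg := hasDerivAt_gap (σ := 1) (hasDerivAt_const t (K₁.toFun s)) (K₂.hasDerivAt t)
    have df := hasDerivAt_form (σ := 1) (hasDerivAt_const t (deriv K₁.toFun s)) (K₂.hasDerivAt t)
    refine ((dh.comp t dg).mul df).congr_deriv ?_
    have z : ∀ y, form 1 0 y = 0 := fun y => by simp [form]
    simp only [pullback, exactTerm, z, Function.comp_apply, cscGap]
    ring
  rw [intervalIntegral.integral_eq_sub_of_hasDerivAt (fun t _ => d t)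
    ((c.comp (by fun_prop : Continuous fun t : ℝ => (s, t))).intervalIntegrable _ _)]
  have : K₂.toFun K₂.period = K₂.toFun 0 := by simpa using K₂.periodic 0
  rw [this, sub_self]

theorem pullback_leftIntegrand (hd : K₁.Disjoint K₂) : pullback leftIntegrand K₁ K₂ = fun p =>
    pullback leftCorrection K₁ K₂ p + pullback transportIntegrandS K₁ K₂ p +
      pullback exactTerm K₁ K₂ p := funext fun _ =>
  leftIntegrand_sub_leftCorrection (K₁.mem _) (K₂.mem _) (hd _ _)
    (K₁.form_deriv_eq_zero isSpaceForm_S3 _) (K₂.form_deriv_eq_zero isSpaceForm_S3 _)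

theorem pullback_transportIntegrandS (hd : K₁.Disjoint K₂) :
    pullback transportIntegrandS K₁ K₂ = pullback (kernelIntegrand 1 cscGapDeriv) K₁ K₂ :=
  funext fun _ => transportIntegrandS_eq (K₁.mem _) (K₂.mem _) (hd _ _) _ _

theorem pullback_transportIntegrandH {K₁ K₂ : ClosedCurve H3} (hd : K₁.Disjoint K₂) :
    pullback transportIntegrandH K₁ K₂ = pullback (kernelIntegrand (-1) cschGapDeriv) K₁ K₂ :=
  funext fun _ => transportIntegrandH_eq (K₁.mem _) (K₂.mem _) (hd _ _) _ _

theorem continuous_pullback_leftCorrection : Continuous (pullback leftCorrection K₁ K₂) := by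
  obtain ⟨f1, f2, f3, f4, f5⟩ := continuous_form_comp K₁ K₂
  have : pullback leftCorrection K₁ K₂ = fun p => form 1 (K₁.toFun p.1) (K₂.toFun p.2) *
      form 1 (deriv K₁.toFun p.1) (deriv K₂.toFun p.2) -
      vol (K₁.toFun p.1) (deriv K₁.toFun p.1) (K₂.toFun p.2) (deriv K₂.toFun p.2) -
      form 1 (deriv K₁.toFun p.1) (K₂.toFun p.2) * form 1 (K₁.toFun p.1) (deriv K₂.toFun p.2) :=
    funext fun _ => leftCorrection_eq (K₁.mem _) (K₁.form_deriv_eq_zero isSpaceForm_S3 _)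
  rw [this]
  exact ((f4.mul f1).sub f5).sub (f2.mul f3)

end

end LinkingIntegral

/-! ### Assembly of the three formulas and of the invariance statements -/

theorem theorem1 :
    -- (1) the 3-sphere, left-translation format
    ((∀ K₁ K₂ : ClosedCurve S3, K₁.Disjoint K₂ →
        IntegrableOver leftIntegrand K₁ K₂ ∧
        IntegrableOver leftCorrection K₁ K₂ ∧
        ∃ n : ℤ, IsLinkingNumber K₁ K₂ n ∧
          (n : ℝ) =
            1 / (4 * Real.pi ^ 2) *
                integralOver leftIntegrand K₁ K₂ -
              1 / (4 * Real.pi ^ 2) *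
                integralOver leftCorrection K₁ K₂) ∧
      IsometryInvariant S3 metricS distS
        leftIntegrand ∧
      IsometryInvariant S3 metricS distS
        leftCorrection) ∧
    -- (2) the 3-sphere, parallel transport format
    ((∀ K₁ K₂ : ClosedCurve S3, K₁.Disjoint K₂ →
        IntegrableOver transportIntegrandS K₁ K₂ ∧
        ∃ n : ℤ, IsLinkingNumber K₁ K₂ n ∧
          (n : ℝ) =
            1 / (4 * Real.pi ^ 2) *
              integralOver transportIntegrandS K₁ K₂) ∧
      IsometryInvariant S3 metricS distS
        transportIntegrandS) ∧
    -- (3) hyperbolic 3-space, parallel transport format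
    ((∀ K₁ K₂ : ClosedCurve H3, K₁.Disjoint K₂ →
        IntegrableOver transportIntegrandH K₁ K₂ ∧
        ∃ n : ℤ, IsLinkingNumber K₁ K₂ n ∧
          (n : ℝ) =
            1 / (4 * Real.pi) *
              integralOver transportIntegrandH K₁ K₂) ∧
      IsometryInvariant H3 metricH distH
        transportIntegrandH) := by
  have contS : ∀ {K₁ K₂ : ClosedCurve S3}, K₁.Disjoint K₂ →
      Continuous (pullback transportIntegrandS K₁ K₂) := fun hd => by
    rw [pullback_transportIntegrandS hd]
    exact isLinkingKernel_csc.continuous_pullback isSpaceForm_S3 hd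
  have linkS : ∀ {K₁ K₂ : ClosedCurve S3}, K₁.Disjoint K₂ → ∃ n : ℤ, IsLinkingNumber K₁ K₂ n ∧
      integralOver transportIntegrandS K₁ K₂ = 4 * Real.pi ^ 2 * n := fun {K₁ K₂} hd => by
    obtain ⟨n, hn, hi⟩ := isLinkingKernel_csc.exists_isLinkingNumber isSpaceForm_S3 Real.pi_pos
      exists_transverse_surface_S3 hd
    refine ⟨n, hn, ?_⟩
    rw [integralOver, pullback_transportIntegrandS hd]
    exact hi.trans (by ring)
  refine ⟨⟨fun K₁ K₂ hd => ?_, ?_, ?_⟩, ⟨fun K₁ K₂ hd => ?_, ?_⟩, fun K₁ K₂ hd => ?_, ?_⟩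
  · have cC : Continuous (pullback leftCorrection K₁ K₂) := continuous_pullback_leftCorrection
    have cE := continuous_pullback_exactTerm hd
    have cT := contS hd
    refine ⟨Continuous.integrableOver ?_, Continuous.integrableOver cC, ?_⟩
    · rw [pullback_leftIntegrand hd]
      exact (cC.add cT).add cE
    · obtain ⟨n, hn, hi⟩ := linkS hd
      refine ⟨n, hn, ?_⟩
      have iC := Continuous.integrableOver cC
      have iE := Continuous.integrableOver cE
      have iT := Continuous.integrableOver cT
      have e : integralOver leftIntegrand K₁ K₂ = integralOver leftCorrection K₁ K₂ +
          integralOver transportIntegrandS K₁ K₂ + integralOver exactTerm K₁ K₂ := by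
        rw [integralOver, pullback_leftIntegrand hd]
        exact (MeasureTheory.integral_add (iC.add iT) iE).trans
          (congrArg (· + _) (MeasureTheory.integral_add iC iT))
      rw [e, integralOver_exactTerm hd, hi]
      field_simp
      ring
  · exact isMetricSpaceForm_S3.isometryInvariant
      -- The argument 1 * (1 - c) is `gap 1` unfolded, so that `leftIntegrand_eq` applies
      -- definitionally.
      (fun c vw vy xw V => (cscGap (1 * (1 - c)) - c * cscGapDeriv (1 * (1 - c))) *
        (vw - c * correctionForm c vw vy xw V))
      fun x hx y hy hxy v w hv hw => leftIntegrand_eq hx hy hxy hv hw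
  · exact isMetricSpaceForm_S3.isometryInvariant correctionForm
      fun x hx y _ _ v w hv _ => leftCorrection_eq hx hv
  · obtain ⟨n, hn, hi⟩ := linkS hd
    refine ⟨Continuous.integrableOver (contS hd), n, hn, ?_⟩
    rw [hi]
    field_simp
  · exact isMetricSpaceForm_S3.isometryInvariant
      (fun c _ _ _ V => -cscGapDeriv (1 * (1 - c)) * V)
      fun x hx y hy hxy v w _ _ => transportIntegrandS_eq hx hy hxy v w
  · obtain ⟨n, hn, hi⟩ := isLinkingKernel_csch.exists_isLinkingNumber isSpaceForm_H3 one_pos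
      exists_transverse_surface_H3 hd
    have e := pullback_transportIntegrandH hd
    refine ⟨Continuous.integrableOver ?_, n, hn, ?_⟩
    · rw [e]
      exact isLinkingKernel_csch.continuous_pullback isSpaceForm_H3 hd
    · rw [integralOver, e]
      change _ = _ * integralOver (kernelIntegrand (-1) cschGapDeriv) K₁ K₂
      rw [hi]
      field_simp
  · exact isMetricSpaceForm_H3.isometryInvariant
      (fun c _ _ _ V => -cschGapDeriv (-1 * (1 - c)) * V)
      fun x hx y hy hxy v w _ _ => transportIntegrandH_eq hx hy hxy v w
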